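/- **Setting.** Fix integers $1\le k\le n$, $t\le n$, $\mu\ge 0$; $\kappa$ is the security parameter. Clients $C_1,\dots,C_n$ hold pairwise distinct $\mu$-bit integers $x_1,\dots,x_n$, a server $S$ has no input, and the functionality $\mathcal F_{\mathrm{KRE}}$ gives to each client the $k$-th smallest input. *Somewhat homomorphic encryption with $t$-out-of-$n$ threshold decryption.* Plaintexts are vectors of $m\ge\mu$ bits (slots); all ciphertexts have the same bit length $\lambda(\kappa)$ and all partial decryptions the same bit length. The polynomial-time algorithms are $(pk,ek,sk_1,\dots,sk_n)\leftarrow KeyGen(1^\kappa)$, $c\leftarrow Enc(pk,v)$, $c\leftarrow Eval(ek,f,c_1,\dots,c_N)$ for permitted circuits $f$ of slotwise additions and multiplications mod 2, $\tilde m_i\leftarrow PartDec(sk_i,c)$, and $FinDec$. Any $t$ partial decryptions of an encryption of $v$ (of an evaluation of $f$ on encryptions of $v_1,\dots,v_N$) are combined by $FinDec$ to $v$ (to $f(v_1,\dots,v_N)$). A bit $b$ is encrypted as $(b,\dots,b)$. *IND-CPA security of such a scheme.* For every permitted $f$ with $N$ inputs, every set $C$ of fewer than $t$ clients and every set $R$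 of inputs of $f$, every probabilistic polynomial-time adversary has negligible advantage in the following game: it gets $1^\kappa,pk,ek$ and $(sk_i)_{i\in C}$ and chooses two $N$-tuples of plaintexts that agree on $R$; one of the two tuples is encrypted entrywise, and the adversary gets the ciphertexts, with the encryption randomness of those in $R$; if $f$ has the same value on both tuples, it also gets the ciphertext $c\leftarrow Eval(ek,f,\cdot)$ of this value and $PartDec(sk_i,c)$ for all $i\notin C$; it has to tell which tuple was encrypted. *Protocol SKE-SHE.* A trusted party runs $KeyGen$, publishes $pk,ek$ and gives $sk_i$ to $C_i$. Each $C_i$ generates and publishes a key $pk_i$ of a public-key encryption scheme whose message space contains the partial decryptions. (1) Each $C_i$ sends to $S$ the encryptions under $pk$ of the bits of $x_i$ and of the packed vector $(x_{i\mu},\dots,x_{i1},0,\dots,0)$. (2) $S$ encrypts the bits of $k$ and the constant $1$ under $pk$, and homomorphically evaluates the circuit that computes the comparison bits $b_{ij}$ ($b_{ii}=1$, $b_{ij}=[x_i>x_j]$ for $i\ne j$), the ranks $r_i=\sum_j b_{ij}$ in binary by an adder, the bits $\beta_i=[r_i=k]$, and $\sum_i\beta_i\cdot(x_{i\mu},\dots,x_{i1},0,\dots,0)$.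 (3) $S$ chooses a uniformly random set of $t$ clients and sends them the resulting ciphertext; each of them computes its partial decryption and sends it to $S$, encrypted under each of $pk_1,\dots,pk_n$. (4) $S$ forwards to each $C_i$ the $t$ partial decryptions encrypted under $pk_i$; $C_i$ decrypts them and applies $FinDec$. The view of a party consists of its input, its random choices, and all keys and messages that it receives. **Theorem.** Let $\tau<t$. Assume that the somewhat homomorphic scheme permits the circuit above and is IND-CPA secure, and that the public-key scheme with keys $pk_i$ is correct and IND-CPA secure. Then SKE-SHE computes $\mathcal F_{\mathrm{KRE}}$ correctly, and it does so $\tau$-privately in the semi-honest model with a non-colluding server and with leakage $\mathcal L=\{k,n,t,\lambda,\kappa,\mu\}$: 1. there is a probabilistic polynomial-time simulator $\mathrm{Sim}$ such that for every set $I$ of $\tau$ clients and all pairwise distinct inputs $x_1,\dots,x_n$, $\mathrm{Sim}\big(I,(x_i)_{i\in I},\mathcal F_{\mathrm{KRE}}(x_1,\dots,x_n),\mathcal L\big)$ is computationally indistinguishable from the joint view of the clients in $I$; 2. there is a probabilistic polynomial-time simulator $\mathrm{Sim}_S$ such that for all pairwise distinct inputs $x_1,\dots,x_n$, $\mathrm{Sim}_S(\mathcal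 L)$ is computationally indistinguishable from the view of the server. -/

import Mathlib

noncomputable section

open scoped Classical

/-! ## Bit strings, a register machine with a step count, polynomial time -/

/-- Bit strings. -/
abbrev Str := List Bool

/-- The random tape of length `ℓ`. -/
abbrev Bits (ℓ : ℕ) := Fin ℓ → Bool

/-- A random tape as a bit string. -/
def Bits.str {ℓ : ℕ} (r : Bits ℓ) : Str := List.ofFn r

/-- Unary notation `1^m`. -/
def unary (m : ℕ) : Str := List.replicate m true

/-- `none` and `some w` as strings. -/
def optStr : Option Str → Str
  | none => []
  | some w => true :: w

/-- Structured programs over registers `0, 1, 2, …`, each of which holds a bit string. -/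
inductive Prog : Type
  | nop : Prog
  | push : Bool → ℕ → Prog
  | pop : ℕ → Prog
  /-- `copy a b` overwrites register `b` with the content of register `a` -/
  | copy : ℕ → ℕ → Prog
  | seq : Prog → Prog → Prog
  /-- `branch r p₀ p₁ p₂`: run `p₀`, `p₁`, `p₂` if register `r` is empty, starts with `false`,
  starts with `true` -/
  | branch : ℕ → Prog → Prog → Prog → Prog
  /-- `loop r p`: run `p` as long as register `r` is not empty -/
  | loop : ℕ → Prog → Prog

/-- Contents of all registers. -/
abbrev Store := ℕ → Str

/-- `Runs p s s' c`: program `p`, started in `s`, halts in `s'` after `c` elementary steps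
(copying a string costs its length). -/
inductive Runs : Prog → Store → Store → ℕ → Prop
  | nop (s : Store) : Runs Prog.nop s s 1
  | push (b : Bool) (r : ℕ) (s : Store) :
      Runs (Prog.push b r) s (Function.update s r (b :: s r)) 1
  | pop (r : ℕ) (s : Store) : Runs (Prog.pop r) s (Function.update s r (s r).tail) 1
  | copy (a b : ℕ) (s : Store) :
      Runs (Prog.copy a b) s (Function.update s b (s a)) ((s a).length + 1)
  | seq {p q : Prog} {s s' s'' : Store} {c d : ℕ} :
      Runs p s s' c → Runs q s' s'' d → Runs (Prog.seq p q) s s'' (c + d)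
  | branchNil {r : ℕ} {p q w : Prog} {s s' : Store} {c : ℕ} :
      s r = [] → Runs p s s' c → Runs (Prog.branch r p q w) s s' (c + 1)
  | branchFalse {r : ℕ} {p q w : Prog} {s s' : Store} {c : ℕ} :
      (s r).head? = some false → Runs q s s' c → Runs (Prog.branch r p q w) s s' (c + 1)
  | branchTrue {r : ℕ} {p q w : Prog} {s s' : Store} {c : ℕ} :
      (s r).head? = some true → Runs w s s' c → Runs (Prog.branch r p q w) s s' (c + 1)
  | loopNil {r : ℕ} {p : Prog} {s : Store} : s r = [] → Runs (Prog.loop r p) s s 1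
  | loopCons {r : ℕ} {p : Prog} {s s' s'' : Store} {c d : ℕ} :
      s r ≠ [] → Runs p s s' c → Runs (Prog.loop r p) s' s'' d →
        Runs (Prog.loop r p) s s'' (c + d + 1)

/-- The initial store: the inputs in the first registers, all other registers empty. -/
def load (l : List Str) : Store := fun i => l.getD i []

/-- Total length of a tuple of strings. -/
def totalLength (l : List Str) : ℕ := (l.map List.length).sum

/-- One program maps the tuple `inp a` to the tuple `out a`, for all `a`, in a number of steps
polynomial in the total length of `inp a`. -/
def PolyTime {ι : Type} (inp out : ι → List Str) : Prop :=
  ∃ (p : Prog) (q : Polynomial ℕ), ∀ a : ι, ∃ (s : Store) (c : ℕ),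
    Runs p (load (inp a)) s c ∧ c ≤ q.eval (totalLength (inp a)) ∧
      ∀ (j : ℕ) (hj : j < (out a).length), s j = (out a)[j]

/-- The randomness of an algorithm: a uniform choice from a set of fixed finite size and finitely
many uniform bit strings whose lengths are polynomials in the security parameter. -/
structure RandSpec where
  die : ℕ
  num : ℕ
  tape : Fin num → Polynomial ℕ

abbrev RandSpec.Space (R : RandSpec) (κ : ℕ) : Type :=
  Fin (R.die + 1) × (∀ i : Fin R.num, Bits ((R.tape i).eval κ))

def RandSpec.strs (R : RandSpec) {κ : ℕ} (ω : R.Space κ) : List Str :=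
  unary ω.1 :: List.ofFn fun i => (ω.2 i).str

/-- A probabilistic polynomial-time algorithm with `a` input and `b` output strings. Its random
choices are passed as additional inputs. -/
structure PPT (a b : ℕ) where
  rand : RandSpec
  run : List Str → List Str
  run_length : ∀ l, l.length = a + (rand.num + 1) → (run l).length = b
  poly : PolyTime (fun l : {l : List Str // l.length = a + (rand.num + 1)} => l.1)
    (fun l => run l.1)

/-- The output on the inputs `l` with random choices `ω`. -/
def PPT.exec {a b : ℕ} (A : PPT a b) {κ : ℕ} (l : List Str) (ω : A.rand.Space κ) : List Str :=
  A.run (l ++ A.rand.strs ω)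

/-- Probability of `p` under the uniform distribution on `Ω`. -/
def prob {Ω : Type} [Fintype Ω] (p : Ω → Prop) : ℝ :=
  ((Finset.univ.filter p).card : ℝ) / (Fintype.card Ω : ℝ)

/-- Negligible functions of the security parameter. -/
def Negligible (ε : ℕ → ℝ) : Prop :=
  Asymptotics.SuperpolynomialDecay Filter.atTop (fun κ : ℕ => (κ : ℝ)) ε

/-- Computational indistinguishability of two ensembles of `b`-tuples of strings: no probabilistic
polynomial-time algorithm that outputs one bit tells them apart, except with negligible
advantage. The samples of `X κ` are drawn by a uniform choice from `Ω₁ κ`, likewise for `Y`. -/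
def CompIndist (b : ℕ) {Ω₁ Ω₂ : ℕ → Type} [∀ κ, Fintype (Ω₁ κ)] [∀ κ, Fintype (Ω₂ κ)]
    (X : ∀ κ, Ω₁ κ → List Str) (Y : ∀ κ, Ω₂ κ → List Str) : Prop :=
  ∀ D : PPT (b + 1) 1, Negligible fun κ =>
    |prob (fun ω : Ω₁ κ × D.rand.Space κ => D.exec (unary κ :: X κ ω.1) ω.2 = [[true]]) -
      prob (fun ω : Ω₂ κ × D.rand.Space κ => D.exec (unary κ :: Y κ ω.1) ω.2 = [[true]])|

/-! ## Public-key encryption -/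

/-- A public-key encryption scheme for messages of `msgLen κ` bits. The last argument of `keyGen`
and `enc` is the random tape. -/
structure PKE where
  msgLen : ℕ → ℕ
  keyRand : Polynomial ℕ
  encRand : Polynomial ℕ
  /-- from `1^κ`: public key and private key -/
  keyGen : Str → Str → Str × Str
  enc : Str → Str → Str → Str
  dec : Str → Str → Str
  keyGen_poly : PolyTime (fun a : Str × Str => [a.1, a.2])
    (fun a => [(keyGen a.1 a.2).1, (keyGen a.1 a.2).2])
  enc_poly : PolyTime (fun a : Str × Str × Str => [a.1, a.2.1, a.2.2])
    (fun a => [enc a.1 a.2.1 a.2.2])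
  dec_poly : PolyTime (fun a : Str × Str => [a.1, a.2]) (fun a => [dec a.1 a.2])
  dec_enc : ∀ (κ : ℕ) (r : Bits (keyRand.eval κ)) (r' : Bits (encRand.eval κ)) (m : Str),
    m.length = msgLen κ →
      dec (keyGen (unary κ) r.str).2 (enc (keyGen (unary κ) r.str).1 m r'.str) = m

namespace PKE

/-- The IND-CPA game with challenge bit `b`: from `1^κ` and the public key the adversary chooses
two messages and a state of `st` strings; from the state and an encryption of message `b` it
outputs a bit. The proposition says that this bit is `1`. -/
def Game (E : PKE) {st : ℕ} (A₁ : PPT 2 (2 + st)) (A₂ : PPT (st + 1) 1) (b : Bool) (κ : ℕ)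
    (ω : Bits (E.keyRand.eval κ) × A₁.rand.Space κ × Bits (E.encRand.eval κ) × A₂.rand.Space κ) :
    Prop :=
  let pk := (E.keyGen (unary κ) ω.1.str).1
  let o := A₁.exec [unary κ, pk] ω.2.1
  let m₀ := o.getD 0 []
  let m₁ := o.getD 1 []
  let c := E.enc pk (if b then m₁ else m₀) ω.2.2.1.str
  m₀.length = E.msgLen κ ∧ m₁.length = E.msgLen κ ∧
    A₂.exec (o.drop 2 ++ [c]) ω.2.2.2 = [[true]]

def IndCPA (E : PKE) : Prop :=
  ∀ (st : ℕ) (A₁ : PPT 2 (2 + st)) (A₂ : PPT (st + 1) 1),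
    Negligible fun κ => |prob (E.Game A₁ A₂ false κ) - prob (E.Game A₁ A₂ true κ)|

end PKE

/-! ## Somewhat homomorphic encryption with threshold decryption -/

/-- Circuits of addition and multiplication gates modulo 2 with input wires `ι`. -/
inductive Circuit (ι : Type) : Type
  | var : ι → Circuit ι
  | add : Circuit ι → Circuit ι → Circuit ι
  | mul : Circuit ι → Circuit ι → Circuit ι

namespace Circuit

def eval {ι : Type} (v : ι → Bool) : Circuit ι → Bool
  | var i => v i
  | add f g => xor (f.eval v) (g.eval v)
  | mul f g => f.eval v && g.eval v

def rename {ι ι' : Type} (e : ι → ι') : Circuit ι → Circuit ι'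
  | var i => var (e i)
  | add f g => add (f.rename e) (g.rename e)
  | mul f g => mul (f.rename e) (g.rename e)

end Circuit

/-- Plaintexts are vectors of `m` bits (slots). They are written as strings in one of two ways:
`[false, b]` stands for `(b, …, b)`, and `true :: v` with `|v| ≤ m` for `(v, 0, …, 0)`. -/
def IsPlaintext (m : ℕ) (w : Str) : Prop :=
  (∃ b, w = [false, b]) ∨ ∃ v : Str, v.length ≤ m ∧ w = true :: v

/-- The content of slot `s` of a plaintext. -/
def slot (w : Str) (s : ℕ) : Bool :=
  match w with
  | false :: b :: _ => b
  | true :: v => v.getD s false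
  | _ => false

/-- The plaintext of a single bit, replicated to all slots. -/
def bitMsg (b : Bool) : Str := [false, b]

/-- The plaintext of a packed bit vector. -/
def packMsg (v : Str) : Str := true :: v

/-- A somewhat homomorphic encryption scheme with `t`-out-of-`n` threshold decryption: it can
evaluate the circuits in `Permitted`, slot by slot. The last string argument of `keyGen`, `enc`,
`eval` and `partDec` is the random tape. -/
structure ThresholdSHE (n t : ℕ) where
  /-- number of slots -/
  slots : ℕ → ℕ
  /-- bit length of ciphertexts -/
  ctLen : ℕ → ℕ
  /-- bit length of partial decryptions -/
  pdLen : ℕ → ℕ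
  Permitted : ∀ {N : ℕ}, Circuit (Fin N) → Prop
  keyRand : Polynomial ℕ
  encRand : Polynomial ℕ
  evalRand : ∀ {N : ℕ}, Circuit (Fin N) → Polynomial ℕ
  decRand : Polynomial ℕ
  /-- from `1^κ`: public key, evaluation key, and one share of the private key per client -/
  keyGen : Str → Str → Str × Str × (Fin n → Str)
  /-- from the public key and a plaintext -/
  enc : Str → Str → Str → Str
  /-- from the evaluation key and ciphertexts -/
  eval : ∀ {N : ℕ}, Circuit (Fin N) → Str → (Fin N → Str) → Str → Str
  /-- from a share of the private key and a ciphertext -/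
  partDec : Str → Str → Str → Str
  finDec : (Fin t → Str) → Str
  keyGen_poly : PolyTime (fun a : Str × Str => [a.1, a.2])
    (fun a => (keyGen a.1 a.2).1 :: (keyGen a.1 a.2).2.1 :: List.ofFn (keyGen a.1 a.2).2.2)
  enc_poly : PolyTime (fun a : Str × Str × Str => [a.1, a.2.1, a.2.2])
    (fun a => [enc a.1 a.2.1 a.2.2])
  eval_poly : ∀ {N : ℕ} (f : Circuit (Fin N)), Permitted f →
    PolyTime (fun a : Str × (Fin N → Str) × Str => a.1 :: a.2.2 :: List.ofFn a.2.1)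
      (fun a => [eval f a.1 a.2.1 a.2.2])
  partDec_poly : PolyTime (fun a : Str × Str × Str => [a.1, a.2.1, a.2.2])
    (fun a => [partDec a.1 a.2.1 a.2.2])
  finDec_poly : PolyTime (fun a : Fin t → Str => List.ofFn a) (fun a => [finDec a])
  enc_length : ∀ (κ : ℕ) (r : Bits (keyRand.eval κ)) (r' : Bits (encRand.eval κ)) (w : Str),
    IsPlaintext (slots κ) w → (enc (keyGen (unary κ) r.str).1 w r'.str).length = ctLen κ
  eval_length : ∀ {N : ℕ} (f : Circuit (Fin N)), Permitted f →
    ∀ (κ : ℕ) (r : Bits (keyRand.eval κ)) (c : Fin N → Str) (r' : Bits ((evalRand f).eval κ)),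
      (∀ i, (c i).length = ctLen κ) →
        (eval f (keyGen (unary κ) r.str).2.1 c r'.str).length = ctLen κ
  partDec_length : ∀ (κ : ℕ) (r : Bits (keyRand.eval κ)) (i : Fin n) (c : Str)
    (r' : Bits (decRand.eval κ)), c.length = ctLen κ →
      (partDec ((keyGen (unary κ) r.str).2.2 i) c r'.str).length = pdLen κ
  /-- any `t` clients decrypt a ciphertext to its plaintext -/
  dec_enc : ∀ (κ : ℕ) (r : Bits (keyRand.eval κ)) (w : Str) (r' : Bits (encRand.eval κ))
    (T : Finset (Fin n)) (hT : T.card = t) (r'' : Fin t → Bits (decRand.eval κ)),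
    IsPlaintext (slots κ) w →
      finDec (fun j => partDec ((keyGen (unary κ) r.str).2.2 (T.orderEmbOfFin hT j))
        (enc (keyGen (unary κ) r.str).1 w r'.str) (r'' j).str) =
      List.ofFn fun s : Fin (slots κ) => slot w s
  /-- any `t` clients decrypt a homomorphically evaluated ciphertext to the value of the circuit -/
  dec_eval : ∀ {N : ℕ} (f : Circuit (Fin N)), Permitted f →
    ∀ (κ : ℕ) (r : Bits (keyRand.eval κ)) (w : Fin N → Str) (r' : Fin N → Bits (encRand.eval κ))
      (e : Bits ((evalRand f).eval κ)) (T : Finset (Fin n)) (hT : T.card = t)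
      (r'' : Fin t → Bits (decRand.eval κ)),
      (∀ i, IsPlaintext (slots κ) (w i)) →
        finDec (fun j => partDec ((keyGen (unary κ) r.str).2.2 (T.orderEmbOfFin hT j))
          (eval f (keyGen (unary κ) r.str).2.1
            (fun i => enc (keyGen (unary κ) r.str).1 (w i) (r' i).str) e.str) (r'' j).str) =
        List.ofFn fun s : Fin (slots κ) => f.eval fun i => slot (w i) s

namespace ThresholdSHE

/-- Random choices of the game `Game` below. -/
abbrev GameSpace {n t : ℕ} (S : ThresholdSHE n t) {N : ℕ} (f : Circuit (Fin N)) (R₁ R₂ : RandSpec)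
    (κ : ℕ) : Type :=
  Bits (S.keyRand.eval κ) × R₁.Space κ × (Fin N → Bits (S.encRand.eval κ)) ×
    Bits ((S.evalRand f).eval κ) × (Fin n → Bits (S.decRand.eval κ)) × R₂.Space κ

/-- The IND-CPA game for threshold homomorphic encryption, with challenge bit `b`, a circuit `f`
with `N` inputs, a set `C` of corrupted clients and a set `R` of inputs of `f` that the adversary
contributes itself.

From `1^κ`, the public key, the evaluation key and the shares of the clients in `C` the adversary
chooses two `N`-tuples of plaintexts, which agree on `R`, and a state of `st` strings. Tuple `b` is
encrypted. The adversary gets the ciphertexts, together with the random tapes of those in `R`. If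
`f` takes the same value on both tuples, it also gets the result of the homomorphic evaluation of
`f` on the ciphertexts and the partial decryptions of this result by all clients outside `C`.
Then it outputs a bit. The proposition says that this bit is `1`. -/
def Game {n t : ℕ} (S : ThresholdSHE n t) {N : ℕ} (f : Circuit (Fin N)) (C : Finset (Fin n))
    (R : Finset (Fin N)) {st : ℕ} (A₁ : PPT (3 + n) (N + N + st))
    (A₂ : PPT (st + N + N + (1 + n)) 1) (b : Bool) (κ : ℕ)
    (ω : S.GameSpace f A₁.rand A₂.rand κ) : Prop :=
  let keys := S.keyGen (unary κ) ω.1.str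
  let pk := keys.1
  let ek := keys.2.1
  let share := keys.2.2
  let o := A₁.exec ([unary κ, pk, ek] ++ List.ofFn fun i => if i ∈ C then share i else []) ω.2.1
  let m₀ : Fin N → Str := fun j => o.getD j []
  let m₁ : Fin N → Str := fun j => o.getD (N + j) []
  let tape := ω.2.2.1
  let c : Fin N → Str := fun j => S.enc pk (if b then m₁ j else m₀ j) (tape j).str
  let e := S.eval f ek c ω.2.2.2.1.str
  let decryption : List Str :=
    if ∀ s : Fin (S.slots κ), f.eval (fun j => slot (m₀ j) s) = f.eval (fun j => slot (m₁ j) s)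
    then [e] ++ List.ofFn fun i =>
      if i ∈ C then [] else S.partDec (share i) e (ω.2.2.2.2.1 i).str
    else List.replicate (1 + n) []
  (∀ j, IsPlaintext (S.slots κ) (m₀ j)) ∧ (∀ j, IsPlaintext (S.slots κ) (m₁ j)) ∧
    (∀ j ∈ R, m₀ j = m₁ j) ∧
    A₂.exec (o.drop (N + N) ++ List.ofFn c ++
      (List.ofFn fun j => if j ∈ R then (tape j).str else []) ++ decryption) ω.2.2.2.2.2 = [[true]]

/-- IND-CPA security against adversaries that hold fewer than `t` shares of the private key. -/
def IndCPA {n t : ℕ} (S : ThresholdSHE n t) : Prop :=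
  ∀ (N : ℕ) (f : Circuit (Fin N)), S.Permitted f →
    ∀ (C : Finset (Fin n)), C.card < t → ∀ (R : Finset (Fin N)) (st : ℕ)
      (A₁ : PPT (3 + n) (N + N + st)) (A₂ : PPT (st + N + N + (1 + n)) 1),
      Negligible fun κ => |prob (S.Game f C R A₁ A₂ false κ) - prob (S.Game f C R A₁ A₂ true κ)|

end ThresholdSHE

/-! ## The `k`-th ranked element -/

/-- Clients' inputs: integers of `μ` bits. -/
abbrev Inputs (n μ : ℕ) := Fin n → Fin (2 ^ μ)

/-- The `k`-th smallest of the integers `x i` (counted from 1). -/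
def kre {n μ : ℕ} (k : ℕ) (x : Inputs n μ) : ℕ :=
  ((Finset.univ.image fun i => (x i : ℕ)).sort (· ≤ ·)).getD (k - 1) 0

/-- The `μ`-bit representation of `v`, most significant bit first. -/
def bitRep (μ v : ℕ) : Str := List.ofFn fun j : Fin μ => v.testBit (μ - 1 - j)

/-! ## The circuit that the server evaluates homomorphically -/

/-- Number of bits of a rank, `1 ≤ rank ≤ n`. -/
abbrev rankLen (n : ℕ) : ℕ := Nat.size n

/-- Input wires: the bits of each input, the packed inputs, the bits of `k`, and the constant 1. -/
abbrev Wire (n μ : ℕ) : Type := (Fin n × Fin μ) ⊕ (Fin n ⊕ (Fin (rankLen n) ⊕ Fin 1))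

abbrev wireCount (n μ : ℕ) : ℕ := n * μ + (n + (rankLen n + 1))

def wireEquiv (n μ : ℕ) : Wire n μ ≃ Fin (wireCount n μ) :=
  (Equiv.sumCongr finProdFinEquiv
    ((Equiv.sumCongr (Equiv.refl _) finSumFinEquiv).trans finSumFinEquiv)).trans finSumFinEquiv

namespace Wire

def xBit {n μ : ℕ} (i : Fin n) (j : Fin μ) : Wire n μ := Sum.inl (i, j)
def xPacked {n μ : ℕ} (i : Fin n) : Wire n μ := Sum.inr (Sum.inl i)
def kBit {n μ : ℕ} (j : Fin (rankLen n)) : Wire n μ := Sum.inr (Sum.inr (Sum.inl j))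
def one {n μ : ℕ} : Wire n μ := Sum.inr (Sum.inr (Sum.inr 0))

end Wire

section Routines

variable {n μ : ℕ}

def cOne : Circuit (Wire n μ) := .var Wire.one
def cZero : Circuit (Wire n μ) := .add cOne cOne
def cNot (a : Circuit (Wire n μ)) : Circuit (Wire n μ) := .add cOne a

/-- `[a > b]` for bit representations `a`, `b` of the same length, most significant bit first. -/
def sheGreater : List (Circuit (Wire n μ)) → List (Circuit (Wire n μ)) → Circuit (Wire n μ)
  | a :: as, b :: bs =>
      .add (.mul a (cNot b)) (.mul (cNot (.add a b)) (sheGreater as bs))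
  | _, _ => cZero

/-- Comparison: the bits `[a > b]` and `[b > a]`. -/
def sheCmp (a b : List (Circuit (Wire n μ))) : Circuit (Wire n μ) × Circuit (Wire n μ) :=
  (sheGreater a b, sheGreater b a)

/-- Adds the bit `c` to a number given by its bits, least significant bit first. -/
def addBit : List (Circuit (Wire n μ)) → Circuit (Wire n μ) → List (Circuit (Wire n μ))
  | [], _ => []
  | a :: as, c => .add a c :: addBit as (.mul a c)

/-- The bit representation, most significant bit first, of the sum of a list of bits. -/
def sheFadder (bs : List (Circuit (Wire n μ))) : List (Circuit (Wire n μ)) :=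
  (bs.foldl addBit (List.replicate (rankLen n) cZero)).reverse

/-- Equality test. -/
def sheEqual (a b : List (Circuit (Wire n μ))) : Circuit (Wire n μ) :=
  .add (.add (sheCmp a b).1 (sheCmp a b).2) cOne

/-- Sum of several ciphertexts. -/
def sheAdd : List (Circuit (Wire n μ)) → Circuit (Wire n μ)
  | [] => cZero
  | [a] => a
  | a :: as => .add a (sheAdd as)

end Routines

section ComputeKre

variable (n μ : ℕ)

def cInput (i : Fin n) : List (Circuit (Wire n μ)) := List.ofFn fun j => .var (Wire.xBit i j)

def cRankK : List (Circuit (Wire n μ)) := List.ofFn fun j => .var (Wire.kBit j)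

/-- The comparison bit of the inputs `i` and `j`. -/
def cCmpBit (i j : Fin n) : Circuit (Wire n μ) :=
  if i = j then cOne
  else if i < j then (sheCmp (cInput n μ i) (cInput n μ j)).1
  else (sheCmp (cInput n μ j) (cInput n μ i)).2

/-- The rank of input `i`. -/
def cRank (i : Fin n) : List (Circuit (Wire n μ)) := sheFadder (List.ofFn fun j => cCmpBit n μ i j)

/-- The bit `[rank of input i = k]`. -/
def cSelect (i : Fin n) : Circuit (Wire n μ) := sheEqual (cRank n μ i) (cRankK n μ)

def computeKre : Circuit (Wire n μ) :=
  sheAdd (List.ofFn fun i => .mul (.var (Wire.xPacked i)) (cSelect n μ i))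

/-- The same circuit with numbered input wires. -/
def kreCircuit : Circuit (Fin (wireCount n μ)) := (computeKre n μ).rename (wireEquiv n μ)

end ComputeKre

/-- The plaintexts on the input wires: bits are replicated to all slots, the packed inputs have one
bit per slot. -/
def wireMsg {n μ : ℕ} (k : ℕ) (x : Inputs n μ) : Wire n μ → Str
  | Sum.inl (i, j) => bitMsg ((bitRep μ (x i)).getD j false)
  | Sum.inr (Sum.inl i) => packMsg (bitRep μ (x i))
  | Sum.inr (Sum.inr (Sum.inl j)) => bitMsg ((bitRep (rankLen n) k).getD j false)
  | Sum.inr (Sum.inr (Sum.inr _)) => bitMsg true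

/-! ## The protocol -/

/-- All random choices in one execution: of the trusted key generation, of the clients and of the
server. -/
structure Coins {n t : ℕ} (S : ThresholdSHE n t) (E : PKE) (μ κ : ℕ) where
  /-- trusted generation of the threshold keys -/
  key : Bits (S.keyRand.eval κ)
  /-- client `i` generates its own key pair -/
  ownKey : Fin n → Bits (E.keyRand.eval κ)
  /-- encryption of the input wires: client `i` encrypts its input (bitwise and packed), the server
  encrypts the bits of `k` and the constant 1 -/
  enc : Wire n μ → Bits (S.encRand.eval κ)
  /-- homomorphic evaluation by the server -/
  eval : Bits ((S.evalRand (kreCircuit n μ)).eval κ)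
  /-- the server chooses `t` clients for the decryption -/
  decryptors : {T : Finset (Fin n) // T.card = t}
  /-- partial decryption by client `i` -/
  dec : Fin n → Bits (S.decRand.eval κ)
  /-- encryption of the partial decryption of client `i` for client `l` -/
  reEnc : Fin n → Fin n → Bits (E.encRand.eval κ)

namespace Coins

def equivProd {n t : ℕ} (S : ThresholdSHE n t) (E : PKE) (μ κ : ℕ) :
    Coins S E μ κ ≃ Bits (S.keyRand.eval κ) × (Fin n → Bits (E.keyRand.eval κ)) ×
      (Wire n μ → Bits (S.encRand.eval κ)) × Bits ((S.evalRand (kreCircuit n μ)).eval κ) ×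
      {T : Finset (Fin n) // T.card = t} × (Fin n → Bits (S.decRand.eval κ)) ×
      (Fin n → Fin n → Bits (E.encRand.eval κ)) where
  toFun ω := (ω.key, ω.ownKey, ω.enc, ω.eval, ω.decryptors, ω.dec, ω.reEnc)
  invFun p := ⟨p.1, p.2.1, p.2.2.1, p.2.2.2.1, p.2.2.2.2.1, p.2.2.2.2.2.1, p.2.2.2.2.2.2⟩
  left_inv _ := rfl
  right_inv _ := rfl

instance instFintype {n t : ℕ} (S : ThresholdSHE n t) (E : PKE) (μ κ : ℕ) :
    Fintype (Coins S E μ κ) := Fintype.ofEquiv _ (equivProd S E μ κ).symm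

end Coins

namespace Protocol

section

variable {n t : ℕ} {S : ThresholdSHE n t} {E : PKE} {μ κ : ℕ} (k : ℕ) (x : Inputs n μ)
  (ω : Coins S E μ κ)

/-- Threshold public key, evaluation key and shares. -/
def pk : Str := (S.keyGen (unary κ) ω.key.str).1
def ek : Str := (S.keyGen (unary κ) ω.key.str).2.1
def share (i : Fin n) : Str := (S.keyGen (unary κ) ω.key.str).2.2 i

/-- Own key pair of client `i`. -/
def ownPk (i : Fin n) : Str := (E.keyGen (unary κ) (ω.ownKey i).str).1
def ownSk (i : Fin n) : Str := (E.keyGen (unary κ) (ω.ownKey i).str).2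

/-- Ciphertexts on the input wires. -/
def wireCt (v : Wire n μ) : Str := S.enc (pk ω) (wireMsg k x v) (ω.enc v).str

/-- The ciphertext of the result, computed by the server. -/
def kreCt : Str :=
  S.eval (kreCircuit n μ) (ek ω) (fun v => wireCt k x ω ((wireEquiv n μ).symm v)) ω.eval.str

/-- The `j`-th decryptor. -/
def decryptor (j : Fin t) : Fin n := ω.decryptors.1.orderEmbOfFin ω.decryptors.2 j

/-- The partial decryption by client `i`. -/
def partialDec (i : Fin n) : Str := S.partDec (share ω i) (kreCt k x ω) (ω.dec i).str

/-- The partial decryption by the `j`-th decryptor, encrypted for client `l`. -/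
def reEncrypted (j : Fin t) (l : Fin n) : Str :=
  E.enc (ownPk ω l) (partialDec k x ω (decryptor ω j)) (ω.reEnc (decryptor ω j) l).str

/-- Output of client `i`. -/
def output (i : Fin n) : Str :=
  (S.finDec fun j => E.dec (ownSk ω i) (reEncrypted k x ω j i)).take μ

/-- View of client `i`: its input, its random tapes, the keys it gets in the initialization, the
ciphertext of the result (if it is a decryptor), and the encrypted partial decryptions. -/
def clientView (i : Fin n) : List Str :=
  [bitRep μ (x i)] ++
  ([(ω.ownKey i).str] ++ (List.ofFn fun j => (ω.enc (Wire.xBit i j)).str) ++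
    [(ω.enc (Wire.xPacked i)).str, (ω.dec i).str] ++ List.ofFn fun l => (ω.reEnc i l).str) ++
  ([pk ω, ek ω, share ω i] ++ List.ofFn fun l => ownPk ω l) ++
  [optStr (if i ∈ ω.decryptors.1 then some (kreCt k x ω) else none)] ++
  List.ofFn fun j => reEncrypted k x ω j i

/-- A subset of the clients as a tuple of strings. -/
def subsetStrs (I : Finset (Fin n)) : List Str := List.ofFn fun i => if i ∈ I then [true] else []

/-- Joint view of the clients in `I`; the places of the other clients are left empty. -/
def jointView (I : Finset (Fin n)) : List Str :=
  subsetStrs I ++ (List.ofFn fun i =>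
    if i ∈ I then clientView k x ω i else List.replicate (2 * n + μ + t + 8) []).flatten

/-- View of the server: its random choices, the public keys, the encrypted inputs, and the encrypted
partial decryptions. -/
def serverView : List Str :=
  ((List.ofFn fun j => (ω.enc (Wire.kBit j)).str) ++ [(ω.enc Wire.one).str, ω.eval.str] ++
    subsetStrs ω.decryptors.1) ++
  ([pk ω, ek ω] ++ List.ofFn fun l => ownPk ω l) ++
  (List.ofFn fun i => (List.ofFn fun j => wireCt k x ω (Wire.xBit i j)) ++
    [wireCt k x ω (Wire.xPacked i)]).flatten ++
  (List.ofFn fun j => List.ofFn fun l => reEncrypted k x ω j l).flatten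

end

/-- Number of strings in a joint view of clients. -/
abbrev jointViewLen (n t μ : ℕ) : ℕ := n + n * (2 * n + μ + t + 8)

/-- Number of strings in a view of the server. -/
abbrev serverViewLen (n t μ : ℕ) : ℕ :=
  (rankLen n + 2 + n) + (2 + n) + n * (μ + 1) + t * n

theorem jointView_length {n t : ℕ} {S : ThresholdSHE n t} {E : PKE} {μ κ : ℕ} (k : ℕ)
    (x : Inputs n μ) (ω : Coins S E μ κ) (I : Finset (Fin n)) :
    (jointView k x ω I).length = jointViewLen n t μ := by
  have h : ∀ i : Fin n, (if i ∈ I then clientView k x ω i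
      else List.replicate (2 * n + μ + t + 8) []).length = 2 * n + μ + t + 8 := by
    intro i
    split_ifs
    · simp [clientView]; omega
    · simp
  simp [jointView, subsetStrs, jointViewLen, List.length_flatten, List.map_ofFn,
    Function.comp_def, h]

theorem serverView_length {n t : ℕ} {S : ThresholdSHE n t} {E : PKE} {μ κ : ℕ} (k : ℕ)
    (x : Inputs n μ) (ω : Coins S E μ κ) :
    (serverView k x ω).length = serverViewLen n t μ := by
  simp [serverView, subsetStrs, serverViewLen, List.length_flatten, List.map_ofFn,
    Function.comp_def]
  omega

/-- The leakage: the public parameters `k`, `n`, `t`, ciphertext length, `κ`, `μ`. -/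
def leakage {n t : ℕ} (S : ThresholdSHE n t) (k μ κ : ℕ) : List Str :=
  [unary k, unary n, unary t, unary (S.ctLen κ), unary κ, unary μ]

/-- What the simulator for the clients in `I` is given: `I` with the inputs of the clients in `I`,
the `k`-th ranked element, and the leakage. -/
def simInput {n t : ℕ} (S : ThresholdSHE n t) {μ : ℕ} (k : ℕ) (x : Inputs n μ)
    (I : Finset (Fin n)) (κ : ℕ) : List Str :=
  (List.ofFn fun i => optStr (if i ∈ I then some (bitRep μ (x i)) else none)) ++
    [bitRep μ (kre k x)] ++ leakage S k μ κ

/-- Every client outputs the `k`-th ranked element. -/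
def Correct {n t : ℕ} (S : ThresholdSHE n t) (E : PKE) (k μ : ℕ) : Prop :=
  ∀ (x : Inputs n μ), Function.Injective x → ∀ (κ : ℕ) (ω : Coins S E μ κ) (i : Fin n),
    output k x ω i = bitRep μ (kre k x)

/-- One simulator reproduces the joint view of any `τ` clients. -/
def PrivateAgainstClients {n t : ℕ} (S : ThresholdSHE n t) (E : PKE) (k μ τ : ℕ) : Prop :=
  ∃ Sim : PPT (n + 1 + 6) (jointViewLen n t μ),
    ∀ I : Finset (Fin n), I.card = τ → ∀ x : Inputs n μ, Function.Injective x →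
      CompIndist (jointViewLen n t μ)
        (fun κ (ω : Sim.rand.Space κ) => Sim.exec (simInput S k x I κ) ω)
        (fun κ (ω : Coins S E μ κ) => jointView k x ω I)

/-- A simulator that is given the leakage only reproduces the view of the server. -/
def PrivateAgainstServer {n t : ℕ} (S : ThresholdSHE n t) (E : PKE) (k μ : ℕ) : Prop :=
  ∃ Sim : PPT 6 (serverViewLen n t μ),
    ∀ x : Inputs n μ, Function.Injective x →
      CompIndist (serverViewLen n t μ)
        (fun κ (ω : Sim.rand.Space κ) => Sim.exec (leakage S k μ κ) ω)
        (fun κ (ω : Coins S E μ κ) => serverView k x ω)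

end Protocol

end

noncomputable section

open scoped Classical

/-! ## Composing register programs -/

/-! Correctness. Distinct inputs have distinct ranks, and some input has rank `k`; so exactly one
selection bit is 1, and the sum of the masked packed inputs is the packed `k`-th smallest input
(`eval_kreCircuit`). The decryption laws of the two schemes carry this value to every client.

Clients. The simulator picks any distinct inputs that agree with the given ones on `I` and have the
same `k`-th smallest element, and executes the protocol on them. The circuit then has the same value
in every slot as in the real execution. Hence the threshold game with corrupted set `I`, whose size
`τ` is below `t`, releases the evaluated ciphertext and the partial decryptions of the honest
clients. That is all an adversary needs in order to rebuild the joint view, so a distinguisher of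
the views would win the game (`close_jointView`).

Server. The simulator executes the protocol with all inputs 0. Now the circuit values may differ,
and the game need not release any partial decryption. Therefore the `t * n` encrypted partial
decryptions are first replaced, one at a time, by encryptions of a dummy of the same length, each
time by security of the public-key scheme (`close_hybridProb_insert`). Then the inputs are exchanged
by the threshold game without corrupted clients (`close_hybridProb_inputs`), and finally the dummies
are removed again.

The remaining work makes these reductions genuine polynomial-time programs. `PolyFun` and `PolyList`
are closed under calls of the schemes, concatenation, case distinction and look-up in finite tables;
since `n`, `t` and `μ` are fixed, every choice of inputs or of subsets of clients is such a table.
Randomness consists of a finite part (decryptors, dice), which is fixed and averaged over at the end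
(`compIndist_of_close`), and of tapes, which are regrouped or resampled along maps that preserve the
uniform distribution (`Unif`). -/

/-- The same program on registers shifted by `d`. -/
def Prog.shift (d : ℕ) : Prog → Prog
  | nop => nop
  | push b r => push b (r + d)
  | pop r => pop (r + d)
  | copy a b => copy (a + d) (b + d)
  | seq p q => seq (p.shift d) (q.shift d)
  | branch r p q w => branch (r + d) (p.shift d) (q.shift d) (w.shift d)
  | loop r p => loop (r + d) (p.shift d)

/-- All registers used by a program are below this bound. -/
def Prog.regs : Prog → ℕ
  | nop => 0
  | push _ r => r + 1
  | pop r => r + 1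
  | copy a b => a + b + 1
  | seq p q => p.regs + q.regs
  | branch r p q w => r + 1 + p.regs + q.regs + w.regs
  | loop r p => r + 1 + p.regs

/-- The store with `s` in the registers below `d` and `u` in the registers from `d` on. -/
def glue (d : ℕ) (s u : Store) : Store := fun j => if j < d then s j else u (j - d)

theorem glue_low {d : ℕ} {s u : Store} {j : ℕ} (h : j < d) : glue d s u j = s j := if_pos h

theorem glue_high {d : ℕ} {s u : Store} (j : ℕ) : glue d s u (j + d) = u j := by
  simp [glue]

theorem update_glue_high (d : ℕ) (s u : Store) (r : ℕ) (w : Str) :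
    Function.update (glue d s u) (r + d) w = glue d s (Function.update u r w) := by
  funext j
  simp only [glue, Function.update_apply]
  by_cases h : j < d
  · have : j ≠ r + d := by omega
    simp [h, this]
  · by_cases h' : j = r + d
    · simp [h']
    · have : j - d ≠ r := by omega
      simp [h, h', this]

theorem update_glue_low (d : ℕ) (s u : Store) (r : ℕ) (hr : r < d) (w : Str) :
    Function.update (glue d s u) r w = glue d (Function.update s r w) u := by
  funext j
  simp only [glue, Function.update_apply]
  by_cases h' : j = r
  · simp [h', hr]
  · simp [h']

/-- A shifted program touches only the upper bank of registers, so results stored below `d` survive.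
-/
theorem Runs.shift {p : Prog} {u u' : Store} {c : ℕ} (h : Runs p u u' c) (d : ℕ) (s : Store) :
    Runs (p.shift d) (glue d s u) (glue d s u') c := by
  induction h with
  | nop u => exact Runs.nop _
  | push b r u =>
    have := Runs.push b (r + d) (glue d s u)
    rwa [update_glue_high, glue_high] at this
  | pop r u =>
    have := Runs.pop (r + d) (glue d s u)
    rwa [update_glue_high, glue_high] at this
  | copy a b u =>
    have := Runs.copy (a + d) (b + d) (glue d s u)
    rwa [update_glue_high, glue_high] at this
  | seq _ _ ih₁ ih₂ => exact Runs.seq ih₁ ih₂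
  | branchNil h _ ih => exact Runs.branchNil (by rwa [glue_high]) ih
  | branchFalse h _ ih => exact Runs.branchFalse (by rwa [glue_high]) ih
  | branchTrue h _ ih => exact Runs.branchTrue (by rwa [glue_high]) ih
  | loopNil h => exact Runs.loopNil (by rwa [glue_high])
  | loopCons h _ _ ih₁ ih₂ => exact Runs.loopCons (by rwa [glue_high]) ih₁ ih₂

/-- Counterpart of `Runs.shift`: data parked from register `d` on survives. That `regs` adds up the
bounds of subprograms is generous, but passes to each of them by linear arithmetic. -/
theorem Runs.low {p : Prog} {s s' : Store} {c : ℕ} (h : Runs p s s' c) (d : ℕ) (u : Store)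
    (hp : p.regs ≤ d) : Runs p (glue d s u) (glue d s' u) c := by
  induction h with
  | nop s => exact Runs.nop _
  | push b r s =>
    have hr : r < d := hp
    have := Runs.push b r (glue d s u)
    rwa [update_glue_low _ _ _ _ hr, glue_low hr] at this
  | pop r s =>
    have hr : r < d := hp
    have := Runs.pop r (glue d s u)
    rwa [update_glue_low _ _ _ _ hr, glue_low hr] at this
  | copy a b s =>
    simp only [Prog.regs] at hp
    have ha : a < d := by omega
    have hb : b < d := by omega
    have := Runs.copy a b (glue d s u)
    rwa [update_glue_low _ _ _ _ hb, glue_low ha] at this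
  | seq _ _ ih₁ ih₂ =>
    simp only [Prog.regs] at hp
    exact Runs.seq (ih₁ (by omega)) (ih₂ (by omega))
  | branchNil h _ ih =>
    simp only [Prog.regs] at hp
    exact Runs.branchNil (by rwa [glue_low (by omega)]) (ih (by omega))
  | branchFalse h _ ih =>
    simp only [Prog.regs] at hp
    exact Runs.branchFalse (by rwa [glue_low (by omega)]) (ih (by omega))
  | branchTrue h _ ih =>
    simp only [Prog.regs] at hp
    exact Runs.branchTrue (by rwa [glue_low (by omega)]) (ih (by omega))
  | loopNil h =>
    simp only [Prog.regs] at hp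
    exact Runs.loopNil (by rwa [glue_low (by omega)])
  | loopCons h _ _ ih₁ ih₂ =>
    have hp' := hp
    simp only [Prog.regs] at hp
    exact Runs.loopCons (by rwa [glue_low (by omega)]) (ih₁ (by omega)) (ih₂ hp')

/-- In `c` steps no register gets longer than the longest one at the start, plus `c`. -/
theorem Runs.length_le {p : Prog} {s s' : Store} {c : ℕ} (h : Runs p s s' c) {M : ℕ}
    (hM : ∀ r, (s r).length ≤ M) (r : ℕ) : (s' r).length ≤ M + c := by
  induction h generalizing M r with
  | nop s => exact (hM r).trans (by omega)
  | push b a s =>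
    have := hM r
    have := hM a
    by_cases h : r = a
    · subst h; simpa using this
    · simp [h]; omega
  | pop a s =>
    have := hM r
    have := hM a
    by_cases h : r = a
    · subst h; simp; omega
    · simp [h]; omega
  | copy a b s =>
    have := hM r
    have := hM a
    by_cases h : r = b
    · subst h; simp; omega
    · simp [h]; omega
  | seq _ _ ih₁ ih₂ => exact (ih₂ (ih₁ hM) r).trans (by omega)
  | branchNil h _ ih => exact (ih hM r).trans (by omega)
  | branchFalse h _ ih => exact (ih hM r).trans (by omega)
  | branchTrue h _ ih => exact (ih hM r).trans (by omega)
  | loopNil h => exact (hM r).trans (by omega)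
  | loopCons h _ _ ih₁ ih₂ => exact (ih₂ (ih₁ hM) r).trans (by omega)

/-- Copies the registers `a, …, a + m - 1` to `b, …, b + m - 1`. -/
def Prog.copyBlock (a b : ℕ) : ℕ → Prog
  | 0 => nop
  | m + 1 => seq (copyBlock a b m) (copy (a + m) (b + m))

/-- The source bank never changes, so `M` bounds every copied string: `M + 1` steps per register,
and one for the final `nop`. -/
theorem runs_copyBlock_up (d : ℕ) (s u : Store) {M : ℕ} (hM : ∀ r, (s r).length ≤ M) (m : ℕ)
    (hm : m ≤ d) : ∃ c ≤ m * (M + 1) + 1, Runs (Prog.copyBlock 0 d m) (glue d s u)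
      (glue d s fun j => if j < m then s j else u j) c := by
  induction m with
  | zero => exact ⟨1, by omega, by simpa [Prog.copyBlock] using Runs.nop _⟩
  | succ m ih =>
    obtain ⟨c, hc, h⟩ := ih (by omega)
    have h' := Runs.copy (0 + m) (d + m) (glue d s fun j => if j < m then s j else u j)
    rw [add_comm d m, update_glue_high, zero_add, glue_low (by omega)] at h'
    have e : (Function.update (fun j => if j < m then s j else u j) m (s m)) =
        fun j => if j < m + 1 then s j else u j := by
      funext j
      by_cases h : j = m
      · subst h; simp
      · have : j < m + 1 ↔ j < m := by omega
        simp [h, this]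
    rw [e] at h'
    refine ⟨_, ?_, Runs.seq h (by rw [add_comm d m, zero_add]; exact h')⟩
    have := hM m
    have : (m + 1) * (M + 1) = m * (M + 1) + (M + 1) := by ring
    omega

/-- The offset `b` lets results be placed behind outputs that already occupy the first registers. -/
theorem runs_copyBlock_down (d b : ℕ) (s u : Store) {M : ℕ} (hM : ∀ r, (u r).length ≤ M) (m : ℕ)
    (hm : b + m ≤ d) : ∃ c ≤ m * (M + 1) + 1, Runs (Prog.copyBlock d b m) (glue d s u)
      (glue d (fun j => if b ≤ j ∧ j < b + m then u (j - b) else s j) u) c := by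
  induction m with
  | zero =>
    refine ⟨1, by omega, ?_⟩
    have : (fun j => if b ≤ j ∧ j < b + 0 then u (j - b) else s j) = s := by
      funext j
      rw [if_neg (by omega)]
    rw [this]
    exact Runs.nop _
  | succ m ih =>
    obtain ⟨c, hc, h⟩ := ih (by omega)
    have h' := Runs.copy (d + m) (b + m)
      (glue d (fun j => if b ≤ j ∧ j < b + m then u (j - b) else s j) u)
    rw [add_comm d m, update_glue_low _ _ _ _ (by omega), glue_high] at h'
    have e : (Function.update (fun j => if b ≤ j ∧ j < b + m then u (j - b) else s j) (b + m)
        (u m)) = fun j => if b ≤ j ∧ j < b + (m + 1) then u (j - b) else s j := by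
      funext j
      by_cases h : j = b + m
      · subst h; simp
      · have : (b ≤ j ∧ j < b + (m + 1)) ↔ (b ≤ j ∧ j < b + m) := by omega
        simp [h, this]
    rw [e] at h'
    refine ⟨_, ?_, Runs.seq h (by rw [add_comm d m]; exact h')⟩
    have := hM m
    have : (m + 1) * (M + 1) = m * (M + 1) + (M + 1) := by ring
    omega

theorem load_length_le (l : List Str) (r : ℕ) : (load l r).length ≤ totalLength l := by
  unfold load totalLength
  by_cases h : r < l.length
  · rw [List.getD_eq_getElem _ _ h]
    exact List.le_sum_of_mem (List.mem_map_of_mem (List.getElem_mem h))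
  · rw [List.getD_eq_default _ _ (by omega)]
    simp

theorem load_eq_glue (l : List Str) (d : ℕ) (h : l.length ≤ d) :
    load l = glue d (load l) (load []) := by
  funext j
  by_cases hj : j < d
  · rw [glue_low hj]
  · simp only [glue, if_neg hj]
    simp only [load, List.getD_nil]
    rw [List.getD_eq_default _ _ (by omega)]

theorem ite_load_eq (l : List Str) {a : ℕ} (h : l.length = a) :
    (fun j => if j < a then load l j else load [] j) = load l := by
  funext j
  by_cases hj : j < a
  · rw [if_pos hj]
  · rw [if_neg hj]
    simp only [load, List.getD_nil]
    rw [List.getD_eq_default _ _ (by omega)]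

theorem totalLength_le {l : List Str} {M : ℕ} (h : ∀ w ∈ l, w.length ≤ M) :
    totalLength l ≤ l.length * M := by
  have := List.sum_le_card_nsmul (l.map List.length) M (by simpa using h)
  simpa [totalLength] using this

/-- Coefficients in `ℕ` are nonnegative. This allows inserting a bound for an input length into a
time bound. -/
theorem Polynomial.eval_nat_mono (q : Polynomial ℕ) {a b : ℕ} (h : a ≤ b) :
    q.eval a ≤ q.eval b := by
  induction q using Polynomial.induction_on' with
  | add p q hp hq => simpa using add_le_add hp hq
  | monomial m c => simpa using Nat.mul_le_mul_left _ (Nat.pow_le_pow_left h m)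

/-! ### Closure properties of polynomial-time computability. -/

section Closure

variable {ι : Type} {inp : ι → List Str} {a : ℕ}

/-- Output strings of fixed number and polynomial length are a new input. -/
theorem PolyTime.comp {ι' : Type} {mid out : ι → List Str} {inp' out' : ι' → List Str} {m m' : ℕ}
    (ha : ∀ i, (inp i).length = a) (hm : ∀ i, (mid i).length = m)
    (hm' : ∀ i, (out i).length = m') (h₁ : PolyTime inp mid) (h₂ : PolyTime inp' out') (e : ι → ι')
    (he : ∀ i, inp' (e i) = mid i) (he' : ∀ i, out' (e i) = out i) : PolyTime inp out := by
  obtain ⟨p₁, q₁, h₁⟩ := h₁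
  obtain ⟨p₂, q₂, h₂⟩ := h₂
  -- Large enough for the registers of `p₁` and for the input, intermediate and output blocks.
  set d := p₁.regs + a + m + m' with hd
  -- Each of the `m` intermediate strings exceeds the input length by at most the running time of
  -- `p₁`.
  let Q : Polynomial ℕ := .C m * (.X + q₁)
  -- The scratch registers of `p₁` may be dirty; therefore `p₂` works in the upper bank, which is
  -- still empty apart from its input.
  refine ⟨.seq (.seq p₁ (.copyBlock 0 d m)) (.seq (p₂.shift d) (.copyBlock d 0 m')),
    q₁ + (.C m * (.X + q₁ + 1) + 1) + (q₂.comp Q + (.C m' * (Q + q₂.comp Q + 1) + 1)), ?_⟩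
  intro i
  obtain ⟨s₁, c₁, hr₁, hc₁, ho₁⟩ := h₁ i
  obtain ⟨s₂, c₂, hr₂, hc₂, ho₂⟩ := h₂ (e i)
  rw [he] at hr₂ hc₂
  set L := totalLength (inp i) with hL
  have hlen₁ : ∀ r, (s₁ r).length ≤ L + q₁.eval L := fun r =>
    (hr₁.length_le (load_length_le _) r).trans (by omega)
  have htot : totalLength (mid i) ≤ m * (L + q₁.eval L) := by
    rw [← hm i]
    refine totalLength_le fun w hw => ?_
    obtain ⟨j, hj, rfl⟩ := List.getElem_of_mem hw
    rw [← ho₁ j hj]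
    exact hlen₁ j
  have hc₂' : c₂ ≤ q₂.eval (m * (L + q₁.eval L)) :=
    hc₂.trans (Polynomial.eval_nat_mono _ htot)
  have hlen₂ : ∀ r, (s₂ r).length ≤ m * (L + q₁.eval L) + q₂.eval (m * (L + q₁.eval L)) := fun r =>
    (hr₂.length_le (load_length_le _) r).trans (by omega)
  have hr₁' := hr₁.low d (load []) (by omega)
  rw [← load_eq_glue _ _ (by rw [ha]; omega)] at hr₁'
  obtain ⟨c₃, hc₃, hr₃⟩ := runs_copyBlock_up d s₁ (load []) hlen₁ m (by omega)
  have hmid : (fun j => if j < m then s₁ j else load [] j) = load (mid i) := by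
    funext j
    by_cases hj : j < m
    · rw [if_pos hj, ho₁ j (by rw [hm]; exact hj), load, List.getD_eq_getElem]
    · rw [if_neg hj]
      simp only [load, List.getD_nil]
      rw [List.getD_eq_default _ _ (by rw [hm]; omega)]
  rw [hmid] at hr₃
  obtain ⟨c₄, hc₄, hr₄⟩ := runs_copyBlock_down d 0 s₁ s₂ hlen₂ m' (by omega)
  refine ⟨_, _, Runs.seq (Runs.seq hr₁' hr₃) (Runs.seq (hr₂.shift d s₁) hr₄), ?_, ?_⟩
  · simp only [Q, Polynomial.eval_add, Polynomial.eval_mul, Polynomial.eval_C, Polynomial.eval_X,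
      Polynomial.eval_one, Polynomial.eval_comp]
    omega
  · intro j hj
    have hj' : j < m' := by rw [← hm' i]; exact hj
    rw [glue_low (by omega)]
    simp only [Nat.zero_le, zero_add, true_and, hj', if_true, Nat.sub_zero]
    rw [ho₂ j (by rw [he']; exact hj)]
    simp [he']

/-- Two programs with the same input, one after the other. -/
theorem PolyTime.append {out₁ out₂ : ι → List Str} {m₁ m₂ : ℕ}
    (ha : ∀ i, (inp i).length = a) (hm₁ : ∀ i, (out₁ i).length = m₁)
    (hm₂ : ∀ i, (out₂ i).length = m₂) (h₁ : PolyTime inp out₁) (h₂ : PolyTime inp out₂) :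
    PolyTime inp (fun i => out₁ i ++ out₂ i) := by
  obtain ⟨p₁, q₁, h₁⟩ := h₁
  obtain ⟨p₂, q₂, h₂⟩ := h₂
  set d := p₁.regs + a + m₁ + m₂ with hd
  -- The input is saved in the upper bank before `p₁` destroys it.
  refine ⟨.seq (.seq (.copyBlock 0 d a) p₁) (.seq (p₂.shift d) (.copyBlock d m₁ m₂)),
    (.C a * (.X + 1) + 1) + q₁ + (q₂ + (.C m₂ * (.X + q₂ + 1) + 1)), ?_⟩
  intro i
  obtain ⟨s₁, c₁, hr₁, hc₁, ho₁⟩ := h₁ i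
  obtain ⟨s₂, c₂, hr₂, hc₂, ho₂⟩ := h₂ i
  set L := totalLength (inp i) with hL
  have hlen₂ : ∀ r, (s₂ r).length ≤ L + q₂.eval L := fun r =>
    (hr₂.length_le (load_length_le _) r).trans (by omega)
  obtain ⟨c₃, hc₃, hr₃⟩ := runs_copyBlock_up d (load (inp i)) (load []) (load_length_le _) a
    (by omega)
  rw [ite_load_eq _ (ha i), ← load_eq_glue _ _ (by rw [ha]; omega)] at hr₃
  obtain ⟨c₄, hc₄, hr₄⟩ := runs_copyBlock_down d m₁ s₁ s₂ hlen₂ m₂ (by omega)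
  refine ⟨_, _, Runs.seq (Runs.seq hr₃ (hr₁.low d _ (by omega)))
    (Runs.seq (hr₂.shift d s₁) hr₄), ?_, ?_⟩
  · simp only [Polynomial.eval_add, Polynomial.eval_mul, Polynomial.eval_C, Polynomial.eval_X,
      Polynomial.eval_one]
    rw [← hL] at hc₃
    omega
  · intro j hj
    rw [List.length_append, hm₁, hm₂] at hj
    rw [glue_low (by omega)]
    by_cases hj' : j < m₁
    · rw [if_neg (by omega), List.getElem_append_left (by rw [hm₁]; exact hj'), ho₁]
    · rw [if_pos (by omega), List.getElem_append_right (by rw [hm₁]; omega)]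
      simp only [hm₁]
      rw [ho₂]

/-- Case distinction by the first bit of the output of `h`. -/
theorem PolyTime.branch {g : ι → Str} {out out₀ out₁ out₂ : ι → List Str} {m : ℕ}
    (ha : ∀ i, (inp i).length = a) (hm : ∀ i, (out i).length = m)
    (h : PolyTime inp fun i => [g i])
    (h₀ : PolyTime inp out₀) (h₁ : PolyTime inp out₁) (h₂ : PolyTime inp out₂)
    (e₀ : ∀ i, g i = [] → out i = out₀ i) (e₁ : ∀ i, (g i).head? = some false → out i = out₁ i)
    (e₂ : ∀ i, (g i).head? = some true → out i = out₂ i) : PolyTime inp out := by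
  obtain ⟨p, q, h⟩ := h
  obtain ⟨p₀, q₀, h₀⟩ := h₀
  obtain ⟨p₁, q₁, h₁⟩ := h₁
  obtain ⟨p₂, q₂, h₂⟩ := h₂
  set d := p.regs + a + m + 1 with hd
  -- Register 0 holds the guard computed by `p`, and the saved input in the upper bank serves
  -- whichever branch is taken. The sum of the three time bounds covers each case.
  refine ⟨.seq (.seq (.copyBlock 0 d a) p) (.seq (.branch 0 (p₀.shift d) (p₁.shift d) (p₂.shift d))
    (.copyBlock d 0 m)),
    (.C a * (.X + 1) + 1) + q + (q₀ + q₁ + q₂ + 1 + (.C m * (.X + (q₀ + q₁ + q₂) + 1) + 1)), ?_⟩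
  intro i
  obtain ⟨s, c, hr, hc, ho⟩ := h i
  have hs : s 0 = g i := ho 0 (by simp)
  set L := totalLength (inp i) with hL
  obtain ⟨s', c', hr', hc', ho'⟩ : ∃ s' c', Runs (.branch 0 (p₀.shift d) (p₁.shift d) (p₂.shift d))
      (glue d s (load (inp i))) (glue d s s') (c' + 1) ∧
      (c' ≤ q₀.eval L + q₁.eval L + q₂.eval L ∧ ∀ r, (s' r).length ≤ L + c') ∧
      ∀ (j : ℕ) (hj : j < (out i).length), s' j = (out i)[j] := by
    have h0 : glue d s (load (inp i)) 0 = g i := by rw [glue_low (by omega), hs]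
    rcases hg : g i with _ | ⟨_ | _, w⟩
    · obtain ⟨s', c', hr', hc', ho'⟩ := h₀ i
      exact ⟨s', c', Runs.branchNil (by rw [h0, hg]) (hr'.shift d s),
        ⟨by rw [← hL] at hc'; omega, hr'.length_le (load_length_le _)⟩, by simpa [e₀ i hg] using ho'⟩
    · obtain ⟨s', c', hr', hc', ho'⟩ := h₁ i
      have := e₁ i (by rw [hg]; rfl)
      exact ⟨s', c', Runs.branchFalse (by rw [h0, hg]; rfl) (hr'.shift d s),
        ⟨by rw [← hL] at hc'; omega, hr'.length_le (load_length_le _)⟩, by simpa [this] using ho'⟩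
    · obtain ⟨s', c', hr', hc', ho'⟩ := h₂ i
      have := e₂ i (by rw [hg]; rfl)
      exact ⟨s', c', Runs.branchTrue (by rw [h0, hg]; rfl) (hr'.shift d s),
        ⟨by rw [← hL] at hc'; omega, hr'.length_le (load_length_le _)⟩, by simpa [this] using ho'⟩
  obtain ⟨c₃, hc₃, hr₃⟩ := runs_copyBlock_up d (load (inp i)) (load []) (load_length_le _) a
    (by omega)
  rw [ite_load_eq _ (ha i), ← load_eq_glue _ _ (by rw [ha]; omega)] at hr₃
  have hlen' : ∀ r, (s' r).length ≤ L + (q₀.eval L + q₁.eval L + q₂.eval L) := fun r =>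
    (hc'.2 r).trans (by omega)
  obtain ⟨c₄, hc₄, hr₄⟩ := runs_copyBlock_down d 0 s s' hlen' m (by omega)
  refine ⟨_, _, Runs.seq (Runs.seq hr₃ (hr.low d _ (by omega))) (Runs.seq hr' hr₄), ?_, ?_⟩
  · simp only [Polynomial.eval_add, Polynomial.eval_mul, Polynomial.eval_C, Polynomial.eval_X,
      Polynomial.eval_one]
    rw [← hL] at hc₃
    omega
  · intro j hj
    have hj' : j < m := by rw [← hm i]; exact hj
    rw [glue_low (by omega)]
    simp only [Nat.zero_le, zero_add, true_and, hj', if_true, Nat.sub_zero]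
    exact ho' j hj

theorem PolyTime.nil : PolyTime inp fun _ => [] :=
  ⟨.nop, 1, fun _ => ⟨_, _, Runs.nop _, by simp, by simp⟩⟩

/-- An index beyond the input reads an empty register, in agreement with the default value. -/
theorem PolyTime.getD (j : ℕ) : PolyTime inp fun i => [(inp i).getD j []] := by
  refine ⟨.copy j 0, .X + 1, fun i => ⟨_, _, Runs.copy j 0 _, ?_, ?_⟩⟩
  · simpa using load_length_le (inp i) j
  · intro l hl
    obtain rfl : l = 0 := by simpa using hl
    simp [load]

theorem PolyTime.tail : PolyTime (fun w : Str => [w]) fun w => [w.tail] := by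
  refine ⟨.pop 0, 1, fun i => ⟨_, _, Runs.pop 0 _, by simp, ?_⟩⟩
  intro l hl
  obtain rfl : l = 0 := by simpa using hl
  simp [load]

theorem PolyTime.cons_const (b : Bool) : PolyTime (fun w : Str => [w]) fun w => [b :: w] := by
  refine ⟨.push b 0, 1, fun i => ⟨_, _, Runs.push b 0 _, by simp, ?_⟩⟩
  intro l hl
  obtain rfl : l = 0 := by simpa using hl
  simp [load]

end Closure

/-! ## Polynomial-time functions of finitely many string variables -/

/-- The values of finitely many variables as a list. -/
def varList {A : Type} [Fintype A] (v : A → Str) : List Str :=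
  List.ofFn fun i : Fin (Fintype.card A) => v ((Fintype.equivFin A).symm i)

/-- A polynomial-time computable string. -/
def PolyFun {A : Type} [Fintype A] (g : (A → Str) → Str) : Prop :=
  PolyTime varList fun v => [g v]

/-- A polynomial-time computable list of `m` strings. -/
structure PolyList {A : Type} [Fintype A] (m : ℕ) (g : (A → Str) → List Str) : Prop where
  length_eq : ∀ v, (g v).length = m
  polyTime : PolyTime varList g

/-- A polynomial-time decidable property. -/
def PolyPred {A : Type} [Fintype A] (P : (A → Str) → Prop) : Prop :=
  PolyFun fun v => if P v then [true] else []

section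

variable {A : Type} [Fintype A]

theorem varList_length (v : A → Str) : (varList v).length = Fintype.card A := by simp [varList]

theorem varList_getD (v : A → Str) (a : A) : (varList v).getD (Fintype.equivFin A a) [] = v a := by
  rw [List.getD_eq_getElem _ _ (by rw [varList_length]; exact (Fintype.equivFin A a).2)]
  simp [varList]

theorem PolyFun.polyList {g : (A → Str) → Str} (h : PolyFun g) : PolyList 1 fun v => [g v] :=
  ⟨fun _ => rfl, h⟩

theorem PolyList.polyFun {g : (A → Str) → Str} (h : PolyList 1 fun v => [g v]) : PolyFun g := h.2

/-- Calling a polynomial-time algorithm. -/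
theorem PolyList.call {ι : Type} {inp out : ι → List Str} {m m' : ℕ} (h : PolyTime inp out)
    {g : (A → Str) → List Str} (hg : PolyList m g) (e : (A → Str) → ι) (he : ∀ v, inp (e v) = g v)
    (hm : ∀ v, (out (e v)).length = m') : PolyList m' fun v => out (e v) :=
  ⟨hm, PolyTime.comp varList_length hg.1 hm hg.2 h e he fun _ => rfl⟩

theorem PolyFun.var (a : A) : PolyFun fun v : A → Str => v a := by
  have := PolyTime.getD (inp := varList (A := A)) (Fintype.equivFin A a)
  simp only [varList_getD] at this
  exact this

theorem PolyFun.tail {g : (A → Str) → Str} (h : PolyFun g) : PolyFun fun v => (g v).tail :=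
  (PolyList.call PolyTime.tail h.polyList g (fun _ => rfl) fun _ => rfl).polyFun

theorem PolyFun.cons {g : (A → Str) → Str} (h : PolyFun g) (b : Bool) : PolyFun fun v => b :: g v :=
  (PolyList.call (PolyTime.cons_const b) h.polyList g (fun _ => rfl) fun _ => rfl).polyFun

theorem PolyFun.const (w : Str) : PolyFun fun _ : A → Str => w := by
  induction w with
  | nil =>
    -- Reading past the last variable produces the empty string.
    have := PolyTime.getD (inp := varList (A := A)) (Fintype.card A)
    have e : ∀ v : A → Str, (varList v).getD (Fintype.card A) [] = [] := fun v =>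
      List.getD_eq_default _ _ (varList_length v).le
    simp only [e] at this
    exact this
  | cons b w ih => exact ih.cons b

theorem PolyList.nil : PolyList 0 fun _ : A → Str => [] := ⟨fun _ => rfl, PolyTime.nil⟩

theorem PolyList.append {m m' : ℕ} {g h : (A → Str) → List Str} (hg : PolyList m g)
    (hh : PolyList m' h) : PolyList (m + m') fun v => g v ++ h v :=
  ⟨fun v => by rw [List.length_append, hg.1, hh.1],
    PolyTime.append varList_length hg.1 hh.1 hg.2 hh.2⟩

theorem PolyList.cast {m m' : ℕ} {g : (A → Str) → List Str} (hg : PolyList m g) (h : m = m') :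
    PolyList m' g := h ▸ hg

theorem PolyList.cons {m : ℕ} {g : (A → Str) → Str} {h : (A → Str) → List Str} (hg : PolyFun g)
    (hh : PolyList m h) : PolyList (m + 1) fun v => g v :: h v :=
  (hg.polyList.append hh).cast (add_comm _ _)

theorem PolyList.ofFn {m : ℕ} {g : Fin m → (A → Str) → Str} (hg : ∀ j, PolyFun (g j)) :
    PolyList m fun v => List.ofFn fun j => g j v := by
  induction m with
  | zero => simpa using PolyList.nil
  | succ m ih =>
    simp only [List.ofFn_succ]
    exact (ih fun j => hg j.succ).cons (hg 0)

theorem PolyList.flatten_ofFn {m m' : ℕ} {g : Fin m → (A → Str) → List Str}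
    (hg : ∀ j, PolyList m' (g j)) :
    PolyList (m * m') fun v => (List.ofFn fun j => g j v).flatten := by
  induction m with
  | zero => simpa using PolyList.nil
  | succ m ih =>
    simp only [List.ofFn_succ, List.flatten_cons]
    exact ((hg 0).append (ih fun j => hg j.succ)).cast (by ring)

theorem PolyList.getD {m : ℕ} {g : (A → Str) → List Str} (hg : PolyList m g) (j : ℕ) :
    PolyFun fun v => (g v).getD j [] :=
  (PolyList.call (PolyTime.getD (inp := id) j) hg g (fun _ => rfl) fun _ => rfl).polyFun

theorem PolyList.of_getD {m : ℕ} {g : (A → Str) → List Str} (hl : ∀ v, (g v).length = m)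
    (h : ∀ j < m, PolyFun fun v => (g v).getD j []) : PolyList m g := by
  have := PolyList.ofFn (g := fun (j : Fin m) v => (g v).getD j []) fun j => h j j.2
  convert this using 2 with v
  apply List.ext_getElem
  · simp [hl]
  · intro j h₁ h₂
    rw [List.getElem_ofFn, List.getD_eq_getElem _ _ h₁]

theorem PolyList.branch {m : ℕ} {g : (A → Str) → Str} {f f₀ f₁ f₂ : (A → Str) → List Str}
    (hg : PolyFun g) (h₀ : PolyList m f₀) (h₁ : PolyList m f₁) (h₂ : PolyList m f₂)
    (e₀ : ∀ v, g v = [] → f v = f₀ v) (e₁ : ∀ v, (g v).head? = some false → f v = f₁ v)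
    (e₂ : ∀ v, (g v).head? = some true → f v = f₂ v) : PolyList m f := by
  have hm : ∀ v, (f v).length = m := by
    intro v
    rcases hgv : g v with _ | ⟨_ | _, w⟩
    · rw [e₀ v hgv, h₀.1]
    · rw [e₁ v (by rw [hgv]; rfl), h₁.1]
    · rw [e₂ v (by rw [hgv]; rfl), h₂.1]
  exact ⟨hm, PolyTime.branch varList_length hm hg h₀.2 h₁.2 h₂.2 e₀ e₁ e₂⟩

theorem PolyList.ite {m : ℕ} {P : (A → Str) → Prop} [DecidablePred P] {f₀ f₁ : (A → Str) → List Str}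
    (hP : PolyPred P) (h₀ : PolyList m f₀) (h₁ : PolyList m f₁) :
    PolyList m fun v => if P v then f₀ v else f₁ v := by
  refine PolyList.branch hP h₁ h₁ h₀ ?_ ?_ ?_ <;> intro v <;> by_cases h : P v <;> simp [h]

theorem PolyFun.ite {P : (A → Str) → Prop} [DecidablePred P] {f₀ f₁ : (A → Str) → Str}
    (hP : PolyPred P) (h₀ : PolyFun f₀) (h₁ : PolyFun f₁) :
    PolyFun fun v => if P v then f₀ v else f₁ v := by
  have := PolyList.ite hP h₀.polyList h₁.polyList
  simp only [← apply_ite (fun w : Str => [w])] at this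
  exact this.polyFun

theorem PolyPred.congr {P Q : (A → Str) → Prop} (hP : PolyPred P) (h : ∀ v, P v ↔ Q v) :
    PolyPred Q := by
  obtain rfl : P = Q := funext fun v => propext (h v)
  exact hP

/-- One of two constant programs is correct; `p` itself need not be decided by a program. -/
theorem PolyPred.const (p : Prop) : PolyPred fun _ : A → Str => p :=
  PolyFun.const (if p then [true] else [])

theorem PolyPred.not {P : (A → Str) → Prop} (hP : PolyPred P) : PolyPred fun v => ¬ P v := by
  have := PolyFun.ite hP (PolyFun.const []) (PolyFun.const [true])
  unfold PolyPred
  convert this using 2 with v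
  by_cases h : P v <;> simp [h]

theorem PolyPred.and {P Q : (A → Str) → Prop} (hP : PolyPred P) (hQ : PolyPred Q) :
    PolyPred fun v => P v ∧ Q v := by
  have := PolyFun.ite hP hQ (PolyFun.const [])
  unfold PolyPred
  convert this using 2 with v
  by_cases h : P v <;> simp [h]

theorem PolyPred.or {P Q : (A → Str) → Prop} (hP : PolyPred P) (hQ : PolyPred Q) :
    PolyPred fun v => P v ∨ Q v :=
  (hP.not.and hQ.not).not.congr fun v => by tauto

theorem PolyPred.exists_mem {T : Type} (U : Finset T) {P : T → (A → Str) → Prop}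
    (hP : ∀ x, PolyPred (P x)) : PolyPred fun v => ∃ x ∈ U, P x v := by
  induction U using Finset.induction_on with
  | empty => simpa using PolyPred.const False
  | insert x U hx ih => simpa [or_and_right, exists_or] using (hP x).or ih

theorem PolyPred.forall_fintype {T : Type} [Fintype T] {P : T → (A → Str) → Prop}
    (hP : ∀ x, PolyPred (P x)) : PolyPred fun v => ∀ x, P x v :=
  (PolyPred.exists_mem Finset.univ fun x => (hP x).not).not.congr fun v => by simp

theorem PolyPred.head_eq {g : (A → Str) → Str} (hg : PolyFun g) (b : Bool) :
    PolyPred fun v => (g v).head? = some b := by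
  have : PolyList 1 fun v => [if (g v).head? = some b then [true] else []] := by
    refine PolyList.branch hg (PolyFun.const []).polyList
      (PolyFun.const (if b = false then [true] else [])).polyList
      (PolyFun.const (if b = true then [true] else [])).polyList ?_ ?_ ?_
    · intro v h; simp [h]
    · intro v h; simp [h, eq_comm]
    · intro v h; simp [h, eq_comm]
  unfold PolyPred
  convert this.polyFun

/-- Comparison bit by bit; the number of tests depends on the fixed string `w` only. -/
theorem PolyPred.eq_const {g : (A → Str) → Str} (hg : PolyFun g) (w : Str) :
    PolyPred fun v => g v = w := by
  induction w generalizing g with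
  | nil =>
    refine ((PolyPred.head_eq hg true).or (PolyPred.head_eq hg false)).not.congr fun v => ?_
    rcases g v with _ | ⟨_ | _, _⟩ <;> simp
  | cons b w ih =>
    refine ((PolyPred.head_eq hg b).and (ih hg.tail)).congr fun v => ?_
    rcases g v with _ | ⟨_, _⟩ <;> simp

/-- A function that is constant outside a finite set of arguments can be looked up in a table. -/
theorem PolyPred.table {B Z : Type} [Fintype B] {g : B → (A → Str) → Str}
    (hg : ∀ b, PolyFun (g b)) (F : (B → Str) → Z) (U : Finset (B → Str)) (z₀ : Z)
    (hF : ∀ u ∉ U, F u = z₀) (z : Z) : PolyPred fun v => F (fun b => g b v) = z := by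
  have hmem : ∀ U' : Finset (B → Str), PolyPred fun v => ∃ u ∈ U', ∀ b, g b v = u b := fun U' =>
    PolyPred.exists_mem U' fun u => PolyPred.forall_fintype fun b => PolyPred.eq_const (hg b) (u b)
  -- Either the argument is tabulated with value `z`, or it is not tabulated and `z` is the default
  -- value.
  refine ((hmem (U.filter fun u => F u = z)).or ((PolyPred.const (z₀ = z)).and (hmem U).not)).congr
    fun v => ?_
  have key : ∀ U' : Finset (B → Str), (∃ u ∈ U', ∀ b, g b v = u b) ↔ (fun b => g b v) ∈ U' := by
    intro U'
    constructor
    · rintro ⟨u, hu, h⟩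
      rwa [show (fun b => g b v) = u from funext h]
    · exact fun h => ⟨_, h, fun _ => rfl⟩
  rw [key, key, Finset.mem_filter]
  by_cases h : (fun b => g b v) ∈ U
  · simp [h]
  · simp [h, hF _ h]

/-- A cascade of tests for the finitely many values `z`, with a separate program for each. Nothing
uniform in `z` is required. -/
theorem PolyFun.lookup {Z : Type} [Fintype Z] {c : (A → Str) → Z} (hc : ∀ z, PolyPred (c · = z))
    {g : Z → (A → Str) → Str} (hg : ∀ z, PolyFun (g z)) : PolyFun fun v => g (c v) v := by
  suffices h : ∀ U : Finset Z, PolyFun fun v => if c v ∈ U then g (c v) v else [] by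
    simpa using h Finset.univ
  intro U
  induction U using Finset.induction_on with
  | empty => simpa using PolyFun.const []
  | insert z U hz ih =>
    have := PolyFun.ite (hc z) (hg z) ih
    convert this using 2 with v
    by_cases h : c v = z
    · simp [h]
    · simp [h]

theorem PolyList.lookup {Z : Type} [Fintype Z] {m : ℕ} {c : (A → Str) → Z}
    (hc : ∀ z, PolyPred (c · = z)) {g : Z → (A → Str) → List Str} (hg : ∀ z, PolyList m (g z)) :
    PolyList m fun v => g (c v) v :=
  PolyList.of_getD (fun v => (hg _).1 v) fun j _ =>
    PolyFun.lookup (g := fun z v => (g z v).getD j []) hc fun z => (hg z).getD j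

end

/-! ## Building probabilistic algorithms -/

/-- Tapes with polynomial lengths `len`. -/
abbrev Tapes {J : Type} (len : J → Polynomial ℕ) (κ : ℕ) : Type := ∀ j, Bits ((len j).eval κ)

def Tapes.str {J : Type} {len : J → Polynomial ℕ} {κ : ℕ} (ρ : Tapes len κ) (j : J) : Str :=
  (ρ j).str

/-- `run`, whose arguments are strings, maps polynomial-time arguments to polynomial-time results -/
def PolyOp {X Y : Type} (m : ℕ) (run : (X → Str) → (Y → Str) → List Str) : Prop :=
  ∀ (A : Type) [Fintype A] (g : X → (A → Str) → Str) (h : Y → (A → Str) → Str),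
    (∀ x, PolyFun (g x)) → (∀ y, PolyFun (h y)) →
      PolyList m fun v => run (fun x => g x v) fun y => h y v

/-- Arbitrary strings are constant functions of an empty family of variables. -/
theorem PolyOp.length_eq {X Y : Type} {m : ℕ} {run : (X → Str) → (Y → Str) → List Str}
    (h : PolyOp m run) (u : X → Str) (r : Y → Str) : (run u r).length = m :=
  (h Empty (fun x _ => u x) (fun y _ => r y) (fun _ => PolyFun.const _)
    (fun _ => PolyFun.const _)).1 Empty.elim

theorem unary_injective : Function.Injective unary := fun a b h => by
  simpa [unary] using congrArg List.length h

namespace PPT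

variable (Z : Type) [Fintype Z] [Nonempty Z] {J : Type} [Fintype J] (len : J → Polynomial ℕ)

/-- Decodes a uniform choice from `Z`. -/
def dieValue (w : Str) : Z :=
  if h : ∃ z : Z, w = unary (Fintype.equivFin Z z) then h.choose else Classical.arbitrary Z

theorem dieValue_unary (z : Z) : dieValue Z (unary (Fintype.equivFin Z z)) = z := by
  have h : ∃ z' : Z, unary (Fintype.equivFin Z z) = unary (Fintype.equivFin Z z') := ⟨z, rfl⟩
  rw [dieValue, dif_pos h]
  have := unary_injective h.choose_spec
  exact ((Fintype.equivFin Z).injective (Fin.ext this)).symm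

/-- Only finitely many strings encode an element of `Z`, and all others decode to one default: a
finite table. -/
theorem polyPred_dieValue {A : Type} [Fintype A] {g : (A → Str) → Str} (hg : PolyFun g) (z : Z) :
    PolyPred fun v => dieValue Z (g v) = z := by
  refine PolyPred.table (B := Unit) (g := fun _ => g) (fun _ => hg)
    (fun u => dieValue Z (u ())) (Finset.univ.image fun z : Z => fun _ : Unit =>
      unary (Fintype.equivFin Z z)) (Classical.arbitrary Z) ?_ z
  intro u hu
  rw [dieValue, dif_neg]
  rintro ⟨z, hz⟩
  exact hu (Finset.mem_image.2 ⟨z, Finset.mem_univ _, funext fun _ => hz.symm⟩)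

/-- The random choices of an algorithm that chooses from `Z` and has the tapes `len`. -/
def randSpec : RandSpec where
  -- A die has `die + 1` faces.
  die := Fintype.card Z - 1
  num := Fintype.card J
  tape i := len ((Fintype.equivFin J).symm i)

def randEquiv (κ : ℕ) : (randSpec Z len).Space κ ≃ Z × Tapes len κ :=
  Equiv.prodCongr
    ((finCongr (Nat.sub_add_cancel (Fintype.card_pos (α := Z)))).trans (Fintype.equivFin Z).symm)
    (Equiv.piCongrLeft (fun j => Bits ((len j).eval κ)) (Fintype.equivFin J).symm)

variable {a b : ℕ} (run : Z → (Fin a → Str) → (J → Str) → List Str)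
  (hrun : ∀ z, PolyOp b (run z))

/-- The algorithm on a list of input strings and random tapes. -/
def runList (l : List Str) : List Str :=
  run (dieValue Z (l.getD a [])) (fun i => l.getD i [])
    fun j => l.getD (a + 1 + Fintype.equivFin J j) []

/-- The entries of the list become variables; the choice `z` is then handled by a finite case
distinction. -/
theorem runList_poly (hrun : ∀ z, PolyOp b (run z)) : PolyTime
    (fun l : {l : List Str // l.length = a + ((randSpec Z len).num + 1)} => l.1)
    (fun l => runList Z run l.1) := by
  set N := a + ((randSpec Z len).num + 1) with hN
  have h : PolyList b fun v : Fin N → Str => runList Z run (List.ofFn v) := by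
    have hget : ∀ i, PolyFun fun v : Fin N → Str => (List.ofFn v).getD i [] := fun i =>
      (PolyList.ofFn fun j => PolyFun.var j).getD i
    exact PolyList.lookup (c := fun v : Fin N → Str => dieValue Z ((List.ofFn v).getD a []))
      (polyPred_dieValue Z (hget a)) fun z =>
        hrun z _ (fun (i : Fin a) v => (List.ofFn v).getD i [])
          (fun j v => (List.ofFn v).getD (a + 1 + Fintype.equivFin J j) [])
          (fun i => hget i) fun j => hget _
  -- `varList` orders the variables by an unspecified enumeration, so the input has to be permuted
  -- first.
  have hmid : PolyTime (fun l : {l : List Str // l.length = N} => l.1)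
      (fun l => varList fun i : Fin N => l.1.getD i []) := by
    have : ∀ m (f : Fin m → Fin N), PolyTime (fun l : {l : List Str // l.length = N} => l.1)
        (fun l => List.ofFn fun i => l.1.getD (f i) []) := by
      intro m
      induction m with
      | zero => intro f; simpa using PolyTime.nil
      | succ m ih =>
        intro f
        simp only [List.ofFn_succ]
        exact PolyTime.append (a := N) (m₁ := 1) (m₂ := m)
          (inp := fun l : {l : List Str // l.length = N} => l.1) (out₁ := fun l => [l.1.getD (f 0) []])
          (fun l => l.2) (fun _ => rfl) (fun _ => List.length_ofFn) (PolyTime.getD _)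
          (ih fun i => f i.succ)
    exact this _ _
  refine PolyTime.comp (fun l => l.2) (fun _ => varList_length _) (fun l => (hrun _).length_eq _ _)
    hmid h.2 (fun l => fun i : Fin N => l.1.getD i []) (fun _ => rfl) fun l => ?_
  congr 1
  apply List.ext_getElem
  · rw [List.length_ofFn, l.2]
  · intro j h₁ h₂
    rw [List.getElem_ofFn, List.getD_eq_getElem _ _ h₂]

/-- The algorithm that chooses `z : Z` and random tapes and runs `run z`. -/
def ofPolyOp : PPT a b where
  rand := randSpec Z len
  run := runList Z run
  run_length _ _ := (hrun _).length_eq _ _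
  poly := runList_poly Z len run hrun

/-- The program receives `a` inputs, then the die at position `a`, then the tapes; the three
auxiliary facts read off these blocks. -/
theorem ofPolyOp_exec {κ : ℕ} (l : List Str) (hl : l.length = a)
    (ω : (ofPolyOp Z len run hrun).rand.Space κ) :
    (ofPolyOp Z len run hrun).exec l ω = run (randEquiv Z len κ ω).1 (fun i => l.getD i [])
      (Tapes.str (randEquiv Z len κ ω).2) := by
  have h₁ : ∀ i : Fin a, (l ++ (randSpec Z len).strs ω).getD i [] = l.getD i [] := fun i =>
    List.getD_append _ _ _ _ (by rw [hl]; exact i.2)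
  have h₂ : (l ++ (randSpec Z len).strs ω).getD a [] =
      unary (Fintype.equivFin Z (randEquiv Z len κ ω).1) := by
    rw [List.getD_append_right _ _ _ _ hl.le]
    rw [hl, Nat.sub_self]
    change unary ω.1 = unary (Fintype.equivFin Z ((Fintype.equivFin Z).symm _))
    rw [Equiv.apply_symm_apply]
    rfl
  have h₃ : ∀ j : J, (l ++ (randSpec Z len).strs ω).getD (a + 1 + Fintype.equivFin J j) [] =
      Tapes.str (randEquiv Z len κ ω).2 j := by
    intro j
    obtain ⟨i, rfl⟩ := (Fintype.equivFin J).symm.surjective j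
    rw [List.getD_append_right _ _ _ _ (by omega)]
    have : a + 1 + ((Fintype.equivFin J) ((Fintype.equivFin J).symm i) : ℕ) - l.length =
      i + 1 := by rw [hl]; simp; omega
    rw [this]
    change (List.ofFn fun i => (ω.2 i).str).getD i [] = _
    rw [List.getD_eq_getElem _ _ (by rw [List.length_ofFn]; exact i.2)]
    rw [List.getElem_ofFn]
    exact congrArg Bits.str (Equiv.piCongrLeft_apply_apply (fun j => Bits ((len j).eval κ))
      (Fintype.equivFin J).symm ω.2 i).symm
  change runList Z run (l ++ (randSpec Z len).strs ω) = _
  rw [runList, h₂, dieValue_unary]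
  congr 1
  · funext i; exact h₁ i
  · funext j; exact h₃ j

theorem ofPolyOp_exec_symm {κ : ℕ} (l : List Str) (hl : l.length = a) (z : Z)
    (ρ : Tapes len κ) :
    (ofPolyOp Z len run hrun).exec l ((randEquiv Z len κ).symm (z, ρ)) =
      run z (fun i => l.getD i []) (Tapes.str ρ) :=
  (ofPolyOp_exec Z len run hrun l hl _).trans (by rw [Equiv.apply_symm_apply])

end PPT

/-! ## Uniform maps between finite probability spaces -/

/-- The image of the uniform distribution is uniform. -/
structure Unif {Ω Ω' : Type} [Fintype Ω] [Fintype Ω'] (φ : Ω → Ω') : Prop where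
  prob_eq : ∀ p : Ω' → Prop, prob (fun ω => p (φ ω)) = prob p

section

variable {Ω Ω' Ω'' Z : Type} [Fintype Ω] [Fintype Ω'] [Fintype Ω''] [Fintype Z]

theorem Equiv.unif (e : Ω ≃ Ω') : Unif e := by
  refine ⟨fun p => ?_⟩
  unfold prob
  rw [Fintype.card_congr e]
  congr 2
  exact Finset.card_equiv e (by simp)

theorem Unif.comp {φ : Ω → Ω'} {ψ : Ω' → Ω''} (hψ : Unif ψ) (hφ : Unif φ) (χ : Ω → Ω'')
    (h : ∀ ω, χ ω = ψ (φ ω)) : Unif χ := by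
  obtain rfl : χ = fun ω => ψ (φ ω) := funext h
  exact ⟨fun p => (hφ.prob_eq fun ω => p (ψ ω)).trans (hψ.prob_eq p)⟩

theorem prob_prod (p : Z × Ω → Prop) :
    prob p = (∑ z, prob fun ω => p (z, ω)) / Fintype.card Z := by
  unfold prob
  rw [← Finset.sum_div, div_div, Fintype.card_prod, Nat.cast_mul, mul_comm (Fintype.card Z : ℝ)]
  congr 1
  rw [← Nat.cast_sum]
  congr 1
  simp only [Finset.card_filter]
  rw [Fintype.sum_prod_type]

theorem unif_id : Unif (id : Ω → Ω) := ⟨fun _ => rfl⟩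

/-- An average of equal terms. Nonemptiness matters: over an empty space `prob` is 0. -/
theorem unif_snd [Nonempty Z] : Unif (Prod.snd : Z × Ω → Ω) := by
  refine ⟨fun p => ?_⟩
  rw [prob_prod]
  simp

theorem unif_fst [Nonempty Z] : Unif (Prod.fst : Ω × Z → Ω) :=
  unif_snd.comp (Equiv.prodComm Ω Z).unif _ fun _ => rfl

theorem Unif.prodMap_left {φ : Ω → Ω'} (hφ : Unif φ) : Unif (Prod.map (id : Z → Z) φ) := by
  refine ⟨fun p => ?_⟩
  rw [prob_prod, prob_prod]
  congr 1
  exact Finset.sum_congr rfl fun z _ => hφ.prob_eq fun ω => p (z, ω)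

theorem Unif.prodMap {Z' : Type} [Fintype Z'] {φ : Ω → Ω'} {ψ : Z → Z'} (hφ : Unif φ)
    (hψ : Unif ψ) : Unif (Prod.map φ ψ) := by
  have h₁ : Unif (Prod.map φ (id : Z → Z) ∘ Prod.swap) :=
    (Equiv.prodComm Z Ω').unif.comp hφ.prodMap_left _ fun _ => rfl
  have h₂ : Unif (Prod.map φ (id : Z → Z)) := h₁.comp (Equiv.prodComm Ω Z).unif _ fun _ => rfl
  exact hψ.prodMap_left.comp h₂ _ fun _ => rfl

end

/-! ## Functions of the security parameter with negligible difference -/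

/-- The difference is negligible. -/
def Close (f g : ℕ → ℝ) : Prop := Negligible fun κ => |f κ - g κ|

theorem Negligible.mono {ε δ : ℕ → ℝ} (h : Negligible δ) (hle : ∀ κ, |ε κ| ≤ |δ κ|) :
    Negligible ε :=
  Asymptotics.SuperpolynomialDecay.trans_abs_le h hle

theorem Close.refl (f : ℕ → ℝ) : Close f f := by
  simp only [Close, sub_self, abs_zero]
  exact Asymptotics.superpolynomialDecay_zero _ _

theorem Close.symm {f g : ℕ → ℝ} (h : Close f g) : Close g f := by
  unfold Close
  simp only [abs_sub_comm (g _)]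
  exact h

theorem Close.trans {f g h : ℕ → ℝ} (h₁ : Close f g) (h₂ : Close g h) : Close f h := by
  refine Negligible.mono (Asymptotics.SuperpolynomialDecay.add h₁ h₂) fun κ => ?_
  rw [abs_abs, Pi.add_apply]
  exact (abs_sub_le _ (g κ) _).trans (le_abs_self _)

/-- The number of summands does not grow with the security parameter, so a finite sum of negligible
functions suffices. -/
theorem Close.average {Z : Type} [Fintype Z] {f g : Z → ℕ → ℝ} (h : ∀ z, Close (f z) (g z))
    (c : ℝ) : Close (fun κ => (∑ z, f z κ) / c) fun κ => (∑ z, g z κ) / c := by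
  have hsum : Negligible fun κ => ∑ z, |f z κ - g z κ| := by
    have : ∀ U : Finset Z, Negligible fun κ => ∑ z ∈ U, |f z κ - g z κ| := by
      intro U
      induction U using Finset.induction_on with
      | empty =>
        simp only [Finset.sum_empty]
        exact Asymptotics.superpolynomialDecay_zero _ _
      | insert z U hz ih =>
        simp only [Finset.sum_insert hz]
        exact Asymptotics.SuperpolynomialDecay.add (h z) ih
    exact this Finset.univ
  refine Negligible.mono (Asymptotics.SuperpolynomialDecay.mul_const hsum |c⁻¹|) fun κ => ?_
  rw [abs_abs, abs_mul, abs_abs, ← sub_div, div_eq_mul_inv, abs_mul, ← Finset.sum_sub_distrib]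
  refine mul_le_mul_of_nonneg_right ?_ (abs_nonneg _)
  exact (Finset.abs_sum_le_sum_abs _ _).trans (le_abs_self _)

theorem Close.of_eq {f g f' g' : ℕ → ℝ} (h : Close f g) (hf : ∀ κ, f' κ = f κ)
    (hg : ∀ κ, g' κ = g κ) : Close f' g' := by
  obtain rfl : f' = f := funext hf
  obtain rfl : g' = g := funext hg
  exact h

/-! ## Distinguishers -/

theorem List.ofFn_getD_self {l : List Str} {a : ℕ} (h : l.length = a) :
    (List.ofFn fun i : Fin a => l.getD i []) = l := by
  apply List.ext_getElem
  · rw [List.length_ofFn, h]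
  · intro j h₁ h₂
    rw [List.getElem_ofFn, List.getD_eq_getElem _ _ h₂]

theorem polyList_run {a b m : ℕ} (D : PPT a b) {A : Type} [Fintype A] {g : (A → Str) → List Str}
    (hg : PolyList m g) (hm : m = a + (D.rand.num + 1)) : PolyList b fun v => D.run (g v) := by
  subst hm
  exact PolyList.call D.poly hg (fun v => ⟨g v, hg.1 v⟩) (fun _ => rfl)
    fun v => D.run_length _ (hg.1 v)

/-- The output of a distinguisher on `1^κ` and `l`, with the value `d` of the die and tapes `r`. -/
def PPT.distinguish {b : ℕ} (D : PPT (b + 1) 1) (d : Fin (D.rand.die + 1)) (κ : Str)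
    (l : List Str) (r : Fin D.rand.num → Str) : List Str :=
  D.run (κ :: l ++ unary d :: List.ofFn r)

theorem polyList_distinguish {b : ℕ} (D : PPT (b + 1) 1) (d : Fin (D.rand.die + 1)) {A : Type}
    [Fintype A] {κ : (A → Str) → Str} {l : (A → Str) → List Str}
    {r : Fin D.rand.num → (A → Str) → Str} (hκ : PolyFun κ) (hl : PolyList b l)
    (hr : ∀ i, PolyFun (r i)) :
    PolyList 1 fun v => D.distinguish d (κ v) (l v) fun i => r i v :=
  polyList_run D ((hl.cons hκ).append ((PolyList.ofFn hr).cons (PolyFun.const (unary d)))) rfl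

/-- To show that two ensembles are indistinguishable, one may fix the finite choice `z` and the die
of the distinguisher. -/
theorem compIndist_of_close {b : ℕ} {Ω₁ Ω₂ : ℕ → Type} [∀ κ, Fintype (Ω₁ κ)]
    [∀ κ, Fintype (Ω₂ κ)] {X : ∀ κ, Ω₁ κ → List Str} {Y : ∀ κ, Ω₂ κ → List Str}
    {Z : Type} [Fintype Z] {J : Type} [Fintype J] [DecidableEq J] (len : J → Polynomial ℕ)
    (φ : ∀ κ, Z × Tapes len κ → Ω₁ κ) (hφ : ∀ κ, Unif (φ κ))
    (ψ : ∀ κ, Z × Tapes len κ → Ω₂ κ) (hψ : ∀ κ, Unif (ψ κ))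
    (h : ∀ (D : PPT (b + 1) 1) (d : Fin (D.rand.die + 1)) (z : Z),
      Close (fun κ => prob fun ρ : Tapes (Sum.elim len D.rand.tape) κ =>
          D.distinguish d (unary κ) (X κ (φ κ (z, fun j => ρ (.inl j))))
            (fun i => (ρ (.inr i)).str) = [[true]])
        (fun κ => prob fun ρ : Tapes (Sum.elim len D.rand.tape) κ =>
          D.distinguish d (unary κ) (Y κ (ψ κ (z, fun j => ρ (.inl j))))
            (fun i => (ρ (.inr i)).str) = [[true]])) :
    CompIndist b X Y := by
  intro D
  -- The acceptance probability is the average, over the finite choice and the die, of the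
  -- conditional ones. It is stated for a general ensemble in order to serve both sides.
  have key : ∀ (Ω : ℕ → Type) [∀ κ, Fintype (Ω κ)] (X : ∀ κ, Ω κ → List Str)
      (φ : ∀ κ, Z × Tapes len κ → Ω κ), (∀ κ, Unif (φ κ)) → ∀ κ,
      prob (fun ω : Ω κ × D.rand.Space κ => D.exec (unary κ :: X κ ω.1) ω.2 = [[true]]) =
      (∑ dz : Fin (D.rand.die + 1) × Z, prob fun ρ : Tapes (Sum.elim len D.rand.tape) κ =>
          D.distinguish dz.1 (unary κ) (X κ (φ κ (dz.2, fun j => ρ (.inl j))))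
            (fun i => (ρ (.inr i)).str) = [[true]]) /
        Fintype.card (Fin (D.rand.die + 1) × Z) := by
    intro Ω _ X φ hφ κ
    rw [← prob_prod fun x : (Fin (D.rand.die + 1) × Z) × Tapes (Sum.elim len D.rand.tape) κ =>
          D.distinguish x.1.1 (unary κ) (X κ (φ κ (x.1.2, fun j => x.2 (.inl j))))
            (fun i => (x.2 (.inr i)).str) = [[true]]]
    let e : (Fin (D.rand.die + 1) × Z) × Tapes (Sum.elim len D.rand.tape) κ ≃
        (Z × Tapes len κ) × D.rand.Space κ :=
      { toFun := fun x => ((x.1.2, fun j => x.2 (.inl j)), (x.1.1, fun i => x.2 (.inr i)))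
        invFun := fun y => ((y.2.1, y.1.1), fun j => match j with
          | .inl j => y.1.2 j
          | .inr i => y.2.2 i)
        left_inv := fun x => by
          refine Prod.ext rfl (funext fun j => ?_)
          cases j <;> rfl
        right_inv := fun y => rfl }
    have hu := ((hφ κ).prodMap (unif_id (Ω := D.rand.Space κ))).comp e.unif _ fun _ => rfl
    exact (hu.prob_eq _).symm
  exact (Close.average (fun dz : Fin (D.rand.die + 1) × Z => h D dz.1 dz.2) _).of_eq
    (key Ω₁ X φ hφ) (key Ω₂ Y ψ hψ)

/-! ## The security games with explicit functions in place of adversaries -/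

theorem polyFun_ofFn_getD {A : Type} [Fintype A] {a : ℕ} {g : Fin a → (A → Str) → Str}
    (hg : ∀ i, PolyFun (g i)) (j : ℕ) : PolyFun fun v => (List.ofFn fun i => g i v).getD j [] :=
  (PolyList.ofFn hg).getD j

theorem unif_rand (Z : Type) [Fintype Z] [Nonempty Z] {J : Type} [Fintype J] [DecidableEq J]
    (len : J → Polynomial ℕ) (κ : ℕ) : Unif fun ω => (PPT.randEquiv Z len κ ω).2 :=
  unif_snd.comp (PPT.randEquiv Z len κ).unif _ fun _ => rfl

/-! ### The public-key game. -/

section PKE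

variable (E : PKE) {J : Type} [Fintype J] {len : J → Polynomial ℕ}
  {m : Bool → (Fin 2 → Str) → (J → Str) → Str} {D : (Fin 3 → Str) → (J → Str) → List Str}

/-- Chooses two messages and passes everything on. -/
def PKE.chooser (len : J → Polynomial ℕ) (hm : ∀ b, PolyOp 1 fun u r => [m b u r]) :
    PPT 2 (2 + (2 + Fintype.card J)) :=
  PPT.ofPolyOp Unit len (fun _ u r => [m false u r, m true u r] ++ ([u 0, u 1] ++ varList r))
    fun _ A _ g h hg hh =>
      ((((PolyList.nil).cons (hm true A g h hg hh).polyFun).cons (hm false A g h hg hh).polyFun)).append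
        (((PolyList.nil.cons (hg 1)).cons (hg 0)).append (PolyList.ofFn fun _ => hh _))

/-- Runs `D` on what the first part of the adversary passed on, and the challenge. -/
def PKE.guesser (hD : PolyOp 1 D) : PPT (2 + Fintype.card J + 1) 1 :=
  PPT.ofPolyOp Unit (Empty.elim : Empty → Polynomial ℕ)
    (fun _ u _ => D
      ![(List.ofFn u).getD 0 [], (List.ofFn u).getD 1 [], (List.ofFn u).getD (2 + Fintype.card J) []]
      fun j => (List.ofFn u).getD (2 + Fintype.equivFin J j) [])
    fun _ A _ g h hg hh => hD A
      (fun x v => (![(List.ofFn fun i => g i v).getD 0 [], (List.ofFn fun i => g i v).getD 1 [],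
        (List.ofFn fun i => g i v).getD (2 + Fintype.card J) []] : Fin 3 → Str) x)
      (fun j v => (List.ofFn fun i => g i v).getD (2 + Fintype.equivFin J j) [])
      (fun x => by fin_cases x <;> exact polyFun_ofFn_getD hg _)
      fun j => polyFun_ofFn_getD hg _

theorem PKE.chooser_exec (hm : ∀ b, PolyOp 1 fun u r => [m b u r]) {κ : ℕ} (w pk : Str)
    (ω : (PKE.chooser len hm).rand.Space κ) :
    (PKE.chooser len hm).exec [w, pk] ω =
      [m false ![w, pk] (Tapes.str (PPT.randEquiv Unit len κ ω).2),
        m true ![w, pk] (Tapes.str (PPT.randEquiv Unit len κ ω).2)] ++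
      ([w, pk] ++ varList (Tapes.str (PPT.randEquiv Unit len κ ω).2)) := by
  have hpad : (fun i : Fin 2 => [w, pk].getD i []) = ![w, pk] := by
    funext i; fin_cases i <;> rfl
  refine (PPT.ofPolyOp_exec (a := 2) Unit len _ _ [w, pk] rfl ω).trans ?_
  rw [hpad]
  rfl

theorem PKE.guesser_exec (hD : PolyOp 1 D) {κ : ℕ} (w pk c : Str) (r : J → Str)
    (ω : (PKE.guesser hD).rand.Space κ) :
    (PKE.guesser hD).exec ([w, pk] ++ varList r ++ [c]) ω = D ![w, pk, c] r := by
  have hl : ([w, pk] ++ varList r ++ [c]).length = 2 + Fintype.card J + 1 := by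
    simp [varList_length]; omega
  refine (PPT.ofPolyOp_exec Unit _ _ _ _ hl ω).trans ?_
  rw [List.ofFn_getD_self hl]
  have h₂ : ([w, pk] ++ varList r ++ [c]).getD (2 + Fintype.card J) [] = c := by
    rw [List.getD_append_right _ _ _ _ (by simp [varList_length]; omega)]
    have : 2 + Fintype.card J - ([w, pk] ++ varList r).length = 0 := by
      simp [varList_length]; omega
    rw [this]
    rfl
  have h₃ : ∀ j, ([w, pk] ++ varList r ++ [c]).getD (2 + Fintype.equivFin J j) [] = r j := by
    intro j
    have := (Fintype.equivFin J j).2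
    rw [List.getD_append _ _ _ _ (by simp [varList_length]; omega),
      List.getD_append_right _ _ _ _ (by simp)]
    simp only [List.length_cons, List.length_nil, zero_add, Nat.reduceAdd, Nat.add_sub_cancel_left]
    exact varList_getD r j
  rw [h₂]
  simp only [h₃]
  rfl

/-- The two stages of an adversary merge into one function: the first stage hands all it knows,
including its tapes, to the second. The length tests of the game always succeed by `hlen` and drop
out. -/
theorem PKE.IndCPA.close [DecidableEq J] {E : PKE} (hE : E.IndCPA)
    (hm : ∀ b, PolyOp 1 fun u r => [m b u r])
    (hlen : ∀ b κ (key : Bits (E.keyRand.eval κ)) (ρ : Tapes len κ),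
      (m b ![unary κ, (E.keyGen (unary κ) key.str).1] ρ.str).length = E.msgLen κ)
    (hD : PolyOp 1 D) :
    let p : Bool → ℕ → ℝ := fun b κ => prob
      fun ω : Bits (E.keyRand.eval κ) × Tapes len κ × Bits (E.encRand.eval κ) =>
        D ![unary κ, (E.keyGen (unary κ) ω.1.str).1, E.enc (E.keyGen (unary κ) ω.1.str).1
          (m b ![unary κ, (E.keyGen (unary κ) ω.1.str).1] ω.2.1.str) ω.2.2.str] ω.2.1.str = [[true]]
    Close (p false) (p true) := by
  intro p
  have key : ∀ b κ, p b κ = prob (E.Game (PKE.chooser len hm) (PKE.guesser hD) b κ) := by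
    intro b κ
    -- The trivial die of the first stage and all randomness of the second stage are projected away.
    have hu := (unif_id (Ω := Bits (E.keyRand.eval κ))).prodMap ((unif_rand Unit len κ).prodMap
      (unif_fst (Ω := Bits (E.encRand.eval κ)) (Z := (PKE.guesser hD).rand.Space κ)))
    refine (hu.prob_eq _).symm.trans (congrArg prob (funext fun ω => propext ?_))
    obtain ⟨ωk, ω₁, ωe, ω₂⟩ := ω
    have hce := PKE.chooser_exec hm (unary κ) (E.keyGen (unary κ) ωk.str).1 ω₁
    simp only [PKE.Game]
    rw [hce]
    set r := Tapes.str (PPT.randEquiv Unit len κ ω₁).2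
    set pk := (E.keyGen (unary κ) ωk.str).1
    have h₂ : ([m false ![unary κ, pk] r, m true ![unary κ, pk] r] ++
      ([unary κ, pk] ++ varList r)).drop 2 = [unary κ, pk] ++ varList r := rfl
    rw [h₂, PKE.guesser_exec]
    have h₀ := hlen false κ ωk (PPT.randEquiv Unit len κ ω₁).2
    have h₁ := hlen true κ ωk (PPT.randEquiv Unit len κ ω₁).2
    have h₃ : ([m false ![unary κ, pk] r, m true ![unary κ, pk] r] ++
      ([unary κ, pk] ++ varList r)).getD 0 [] = m false ![unary κ, pk] r := rfl
    have h₄ : ([m false ![unary κ, pk] r, m true ![unary κ, pk] r] ++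
      ([unary κ, pk] ++ varList r)).getD 1 [] = m true ![unary κ, pk] r := rfl
    have h₅ : (if b then m true ![unary κ, pk] r else m false ![unary κ, pk] r) =
      m b ![unary κ, pk] r := by cases b <;> rfl
    rw [h₃, h₄, h₅]
    exact ⟨fun h => ⟨h₀, h₁, h⟩, fun h => h.2.2⟩
  exact Close.of_eq (hE _ (PKE.chooser len hm) (PKE.guesser hD)) (key false) (key true)

end PKE

/-! ### The threshold game for fixed pairs of plaintext tuples. -/

section SHE

/-- What the adversary against the threshold scheme learns. -/
inductive GameVar (n N : ℕ) : Type
  | security : GameVar n N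
  | pk : GameVar n N
  | ek : GameVar n N
  | share : Fin n → GameVar n N
  | ct : Fin N → GameVar n N
  | tape : Fin N → GameVar n N
  | result : GameVar n N
  | partDec : Fin n → GameVar n N

/-- The position in the input of the second part of the adversary. -/
def GameVar.index {n N : ℕ} : GameVar n N → ℕ
  | security => 0
  | pk => 1
  | ek => 2
  | share i => 3 + i
  | ct j => 3 + n + j
  | tape j => 3 + n + N + j
  | result => 3 + n + N + N
  | partDec i => 3 + n + N + N + 1 + i

namespace ThresholdSHE

variable {n t N : ℕ} (S : ThresholdSHE n t) (f : Circuit (Fin N)) (C : Finset (Fin n))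
  (R : Finset (Fin N)) (m : Bool → Fin N → Str) {J : Type} [Fintype J] {len : J → Polynomial ℕ}
  {D : (GameVar n N → Str) → (J → Str) → List Str}

/-- The ciphertexts in the game. -/
def gameCt {κ : ℕ} (b : Bool) (key : Bits (S.keyRand.eval κ))
    (enc : Fin N → Bits (S.encRand.eval κ)) (j : Fin N) : Str :=
  S.enc (S.keyGen (unary κ) key.str).1 (m b j) (enc j).str

def gameResult {κ : ℕ} (b : Bool) (key : Bits (S.keyRand.eval κ))
    (enc : Fin N → Bits (S.encRand.eval κ)) (ev : Bits ((S.evalRand f).eval κ)) : Str :=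
  S.eval f (S.keyGen (unary κ) key.str).2.1 (S.gameCt m b key enc) ev.str

/-- The two tuples of plaintexts have the same value. -/
def SameValue (κ : ℕ) : Prop :=
  ∀ s : Fin (S.slots κ), f.eval (fun j => slot (m false j) s) = f.eval fun j => slot (m true j) s

/-- What the adversary learns in the game with plaintexts `m`. -/
def gameEnv {κ : ℕ} (b : Bool) (key : Bits (S.keyRand.eval κ))
    (enc : Fin N → Bits (S.encRand.eval κ)) (ev : Bits ((S.evalRand f).eval κ))
    (dec : Fin n → Bits (S.decRand.eval κ)) : GameVar n N → Str
  | .security => unary κ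
  | .pk => (S.keyGen (unary κ) key.str).1
  | .ek => (S.keyGen (unary κ) key.str).2.1
  | .share i => if i ∈ C then (S.keyGen (unary κ) key.str).2.2 i else []
  | .ct j => S.gameCt m b key enc j
  | .tape j => if j ∈ R then (enc j).str else []
  | .result => if S.SameValue f m κ then S.gameResult f m b key enc ev else []
  | .partDec i => if S.SameValue f m κ then (if i ∈ C then [] else
      S.partDec ((S.keyGen (unary κ) key.str).2.2 i) (S.gameResult f m b key enc ev) (dec i).str)
      else []

/-- The same as a list. -/
def gameList (u : GameVar n N → Str) : List Str :=
  ([u .security, u .pk, u .ek] ++ List.ofFn fun i => u (.share i)) ++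
    (List.ofFn fun j => u (.ct j)) ++ (List.ofFn fun j => u (.tape j)) ++
    ([u .result] ++ List.ofFn fun i => u (.partDec i))

theorem gameList_length (u : GameVar n N → Str) :
    (gameList u).length = 3 + n + N + N + (1 + n) := by
  simp [gameList]; omega

theorem gameList_getD (u : GameVar n N → Str) (x : GameVar n N) :
    (gameList u).getD x.index [] = u x := by
  have hofFn : ∀ (k : ℕ) (g : Fin k → Str) (j : Fin k), (List.ofFn g).getD j [] = g j := by
    intro k g j
    rw [List.getD_eq_getElem _ _ (by simp)]
    simp
  unfold gameList
  cases x with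
  | security => rfl
  | pk => rfl
  | ek => rfl
  | share i =>
    rw [GameVar.index, List.getD_append _ _ _ _ (by simp; omega),
      List.getD_append _ _ _ _ (by simp; omega), List.getD_append _ _ _ _ (by simp; omega),
      List.getD_append_right _ _ _ _ (by simp)]
    simp
  | ct j =>
    rw [GameVar.index, List.getD_append _ _ _ _ (by simp; omega),
      List.getD_append _ _ _ _ (by simp; omega), List.getD_append_right _ _ _ _ (by simp; omega)]
    convert hofFn N (fun i => u (.ct i)) j using 2
    simp; omega
  | tape j =>
    rw [GameVar.index, List.getD_append _ _ _ _ (by simp; omega),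
      List.getD_append_right _ _ _ _ (by simp; omega)]
    convert hofFn N (fun i => u (.tape i)) j using 2
    simp; omega
  | result =>
    rw [GameVar.index, List.getD_append_right _ _ _ _ (by simp; omega)]
    have : 3 + n + N + N - ([u .security, u .pk, u .ek] ++ (List.ofFn fun i => u (.share i)) ++
      (List.ofFn fun j => u (.ct j)) ++ List.ofFn fun j => u (.tape j)).length = 0 := by
      simp; omega
    rw [this]
    rfl
  | partDec i =>
    rw [GameVar.index, List.getD_append_right _ _ _ _ (by simp; omega),
      List.getD_append_right _ _ _ _ (by simp; omega)]
    convert hofFn n (fun i => u (.partDec i)) i using 2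
    simp; omega

/-- The plaintexts are independent of the security parameter and can be built into the program; the
whole input is kept as state. -/
def chooser : PPT (3 + n) (N + N + (3 + n)) :=
  PPT.ofPolyOp Unit (Empty.elim : Empty → Polynomial ℕ)
    (fun _ u _ => List.ofFn (m false) ++ List.ofFn (m true) ++ List.ofFn u)
    fun _ _ _ _ _ hg _ => ((PolyList.ofFn fun _ => PolyFun.const _).append
      (PolyList.ofFn fun _ => PolyFun.const _)).append (PolyList.ofFn hg)

theorem chooser_exec {κ : ℕ} (l : List Str) (hl : l.length = 3 + n)
    (ω : (chooser (n := n) m).rand.Space κ) :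
    (chooser m).exec l ω = List.ofFn (m false) ++ List.ofFn (m true) ++ l := by
  refine (PPT.ofPolyOp_exec Unit _ _ _ _ hl ω).trans ?_
  rw [List.ofFn_getD_self hl]

def guesser (len : J → Polynomial ℕ) (hD : PolyOp 1 D) : PPT (3 + n + N + N + (1 + n)) 1 :=
  PPT.ofPolyOp Unit len (fun _ u r => D (fun x => (List.ofFn u).getD x.index []) r)
    fun _ A _ g h hg hh => hD A (fun x v => (List.ofFn fun i => g i v).getD x.index []) h
      (fun _ => polyFun_ofFn_getD hg _) hh

theorem guesser_exec (hD : PolyOp 1 D) {κ : ℕ} (u : GameVar n N → Str)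
    (ω : (guesser len hD).rand.Space κ) :
    (guesser len hD).exec (gameList u) ω =
      D u (Tapes.str (PPT.randEquiv Unit len κ ω).2) := by
  refine (PPT.ofPolyOp_exec Unit _ _ _ _ (gameList_length u) ω).trans ?_
  rw [List.ofFn_getD_self (gameList_length u)]
  simp only [gameList_getD]

/-- As for the public-key game, a single function `D` replaces the adversary. Since the plaintexts
are constant, random tapes are needed in the second stage only. -/
theorem IndCPA.close [DecidableEq J] {S : ThresholdSHE n t} (hS : S.IndCPA) (hf : S.Permitted f) (hC : C.card < t)
    (hm : ∀ b κ j, IsPlaintext (S.slots κ) (m b j)) (hR : ∀ j ∈ R, m false j = m true j)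
    (hD : PolyOp 1 D) :
    let p : Bool → ℕ → ℝ := fun b κ => prob
      fun ω : Bits (S.keyRand.eval κ) × (Fin N → Bits (S.encRand.eval κ)) ×
        Bits ((S.evalRand f).eval κ) × (Fin n → Bits (S.decRand.eval κ)) × Tapes len κ =>
        D (S.gameEnv f C R m b ω.1 ω.2.1 ω.2.2.1 ω.2.2.2.1) ω.2.2.2.2.str = [[true]]
    Close (p false) (p true) := by
  intro p
  have key : ∀ b κ, p b κ = prob (S.Game f C R (chooser m) (guesser len hD) b κ) := by
    intro b κ
    have hu := (unif_id (Ω := Bits (S.keyRand.eval κ))).prodMap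
      ((unif_id (Ω := Fin N → Bits (S.encRand.eval κ))).prodMap
      ((unif_id (Ω := Bits ((S.evalRand f).eval κ))).prodMap
      ((unif_id (Ω := Fin n → Bits (S.decRand.eval κ))).prodMap (unif_rand Unit len κ))))
    have hu' := (unif_id (Ω := Bits (S.keyRand.eval κ))).prodMap
      (unif_snd (Z := (chooser (n := n) m).rand.Space κ)
        (Ω := (Fin N → Bits (S.encRand.eval κ)) × Bits ((S.evalRand f).eval κ) ×
          (Fin n → Bits (S.decRand.eval κ)) × (guesser len hD).rand.Space κ))
    refine ((hu.comp hu' _ fun _ => rfl).prob_eq _).symm.trans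
      (congrArg prob (funext fun ω => propext ?_))
    obtain ⟨ωk, ω₁, enc, ev, dec, ω₂⟩ := ω
    have hl : ([unary κ, (S.keyGen (unary κ) ωk.str).1, (S.keyGen (unary κ) ωk.str).2.1] ++
      List.ofFn fun i => if i ∈ C then (S.keyGen (unary κ) ωk.str).2.2 i else []).length =
      3 + n := by simp; omega
    have h₀ : ∀ (l : List Str) (j : Fin N),
        (List.ofFn (m false) ++ List.ofFn (m true) ++ l).getD j [] = m false j := by
      intro l j
      rw [List.getD_append _ _ _ _ (by simp; omega), List.getD_append _ _ _ _ (by simp),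
        List.getD_eq_getElem _ _ (by simp)]
      simp
    have h₁ : ∀ (l : List Str) (j : Fin N),
        (List.ofFn (m false) ++ List.ofFn (m true) ++ l).getD (N + j) [] = m true j := by
      intro l j
      rw [List.getD_append _ _ _ _ (by simp), List.getD_append_right _ _ _ _ (by simp),
        List.getD_eq_getElem _ _ (by simp)]
      simp
    have h₂ : ∀ (l : List Str),
        (List.ofFn (m false) ++ List.ofFn (m true) ++ l).drop (N + N) = l := by
      intro l
      exact List.drop_left' (by simp)
    have h₅ : ∀ j, (if b then m true j else m false j) = m b j := by intro j; cases b <;> rfl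
    simp only [Game, chooser_exec m _ hl, h₀, h₁, h₂, h₅]
    have h₆ : ([unary κ, (S.keyGen (unary κ) ωk.str).1, (S.keyGen (unary κ) ωk.str).2.1] ++
        List.ofFn fun i => if i ∈ C then (S.keyGen (unary κ) ωk.str).2.2 i else []) ++
        (List.ofFn fun j => S.enc (S.keyGen (unary κ) ωk.str).1 (m b j) (enc j).str) ++
        (List.ofFn fun j => if j ∈ R then (enc j).str else []) ++
        (if ∀ s : Fin (S.slots κ), f.eval (fun j => slot (m false j) s) =
            f.eval (fun j => slot (m true j) s)
          then [S.gameResult f m b ωk enc ev] ++ List.ofFn fun i =>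
            if i ∈ C then [] else S.partDec ((S.keyGen (unary κ) ωk.str).2.2 i)
              (S.gameResult f m b ωk enc ev) (dec i).str
          else List.replicate (1 + n) []) = gameList (S.gameEnv f C R m b ωk enc ev dec) := by
      unfold gameList
      simp only [gameEnv, gameCt]
      congr 1
      by_cases h : S.SameValue f m κ
      · have h' := h
        unfold SameValue at h'
        simp only [if_pos h, if_pos h']
      · have h' := h
        unfold SameValue at h'
        simp only [if_neg h, if_neg h']
        -- When the values differ, the game supplies `1 + n` empty strings: one for the result, `n`
        -- for the partial decryptions.
        rw [List.replicate_add, List.ofFn_const]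
        rfl
    have h₇ := guesser_exec (len := len) hD (S.gameEnv f C R m b ωk enc ev dec) ω₂
    rw [← h₆] at h₇
    exact ⟨fun h => ⟨hm false κ, hm true κ, hR, h₇.trans h⟩, fun h => h₇.symm.trans h.2.2.2⟩
  exact Close.of_eq (hS N f hf C hC R _ (chooser m) (guesser len hD)) (key false) (key true)

end ThresholdSHE

end SHE

/-! ## The circuit computes the `k`-th ranked element -/

/-- The number with the given bits, most significant bit first. -/
def msbVal : List Bool → ℕ
  | [] => 0
  | a :: as => a.toNat * 2 ^ as.length + msbVal as

/-- The number with the given bits, least significant bit first. -/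
def lsbVal : List Bool → ℕ
  | [] => 0
  | a :: as => a.toNat + 2 * lsbVal as

theorem msbVal_lt (l : List Bool) : msbVal l < 2 ^ l.length := by
  induction l with
  | nil => simp [msbVal]
  | cons a l ih =>
    rw [msbVal, List.length_cons, pow_succ]
    cases a <;> simp <;> omega

theorem msbVal_concat (l : List Bool) (a : Bool) : msbVal (l ++ [a]) = 2 * msbVal l + a.toNat := by
  induction l with
  | nil => simp [msbVal]
  | cons b l ih => simp only [List.cons_append, msbVal, ih, List.length_append, List.length_cons,
      List.length_nil]; ring

theorem msbVal_reverse (l : List Bool) : msbVal l.reverse = lsbVal l := by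
  induction l with
  | nil => rfl
  | cons a l ih => rw [List.reverse_cons, msbVal_concat, ih, lsbVal]; ring

theorem bitRep_length (m v : ℕ) : (bitRep m v).length = m := by simp [bitRep]

theorem bitRep_succ (m v : ℕ) : bitRep (m + 1) v = v.testBit m :: bitRep m v := by
  simp only [bitRep, List.ofFn_succ, Fin.val_zero, Nat.add_sub_cancel, Nat.sub_zero, Fin.val_succ]
  congr 2
  funext j
  congr 1
  omega

theorem msbVal_bitRep (m v : ℕ) : msbVal (bitRep m v) = v % 2 ^ m := by
  induction m with
  | zero => simp [bitRep, msbVal, Nat.mod_one]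
  | succ m ih =>
    rw [bitRep_succ, msbVal, ih, bitRep_length, Nat.mod_pow_succ, Nat.testBit_eq_decide_div_mod_eq]
    rcases Nat.mod_two_eq_zero_or_one (v / 2 ^ m) with h | h <;> simp [h, add_comm]

theorem bitRep_injective {m v w : ℕ} (hv : v < 2 ^ m) (hw : w < 2 ^ m)
    (h : bitRep m v = bitRep m w) : v = w := by
  have := congrArg msbVal h
  rwa [msbVal_bitRep, msbVal_bitRep, Nat.mod_eq_of_lt hv, Nat.mod_eq_of_lt hw] at this

theorem Circuit.eval_rename {ι ι' : Type} (e : ι → ι') (v : ι' → Bool) (f : Circuit ι) :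
    (f.rename e).eval v = f.eval fun i => v (e i) := by
  induction f with
  | var i => rfl
  | add f g hf hg => simp [rename, eval, hf, hg]
  | mul f g hf hg => simp [rename, eval, hf, hg]

/-! ### Values of the subroutines of the circuit. -/

section Routines

variable {n μ : ℕ} {V : Wire n μ → Bool}

theorem eval_cOne (h : V Wire.one = true) : cOne.eval V = true := h

theorem eval_cZero : (cZero : Circuit (Wire n μ)).eval V = false := by
  simp [cZero, Circuit.eval]

/-- The leading bit outweighs all lower bits (`msbVal_lt`), so the tails matter only if the leading
bits agree. The two summands exclude each other, which makes addition modulo 2 a disjunction. -/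
theorem eval_sheGreater (h : V Wire.one = true) (a b : List (Circuit (Wire n μ)))
    (hl : a.length = b.length) : (sheGreater a b).eval V =
      decide (msbVal (b.map (Circuit.eval V)) < msbVal (a.map (Circuit.eval V))) := by
  induction a generalizing b with
  | nil =>
    obtain rfl : b = [] := List.eq_nil_of_length_eq_zero hl.symm
    simp [sheGreater, eval_cZero]
  | cons c a ih =>
    cases b with
    | nil => simp at hl
    | cons d b =>
      have hl' : a.length = b.length := by simpa using hl
      have h₁ := msbVal_lt (a.map (Circuit.eval V))
      have h₂ := msbVal_lt (b.map (Circuit.eval V))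
      simp only [List.length_map] at h₁ h₂
      simp only [sheGreater, Circuit.eval, cNot, eval_cOne h, ih b hl', List.map_cons, msbVal,
        List.length_map]
      rw [hl'] at h₁ ⊢
      cases c.eval V <;> cases d.eval V <;> simp <;> omega

theorem addBit_length (a : List (Circuit (Wire n μ))) (c : Circuit (Wire n μ)) :
    (addBit a c).length = a.length := by
  induction a generalizing c with
  | nil => rfl
  | cons d a ih => simp [addBit, ih]

/-- A chain of half adders; the last carry is dropped, whence the modulus. -/
theorem eval_addBit (a : List (Circuit (Wire n μ))) (c : Circuit (Wire n μ)) :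
    lsbVal ((addBit a c).map (Circuit.eval V)) =
      (lsbVal (a.map (Circuit.eval V)) + (c.eval V).toNat) % 2 ^ a.length := by
  induction a generalizing c with
  | nil => simp [addBit, lsbVal, Nat.mod_one]
  | cons d a ih =>
    simp only [addBit, List.map_cons, lsbVal, ih, Circuit.eval, List.length_cons, pow_succ']
    -- Splits the residue into the lowest bit and the part that receives the carry.
    rw [Nat.mod_mul]
    set u := lsbVal (a.map (Circuit.eval V))
    have h₁ : (2 * u + 1) / 2 = u := by omega
    have h₂ : (1 + 2 * u) / 2 = u := by omega
    have h₃ : (1 + 2 * u + 1) / 2 = u + 1 := by omega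
    cases d.eval V <;> cases c.eval V <;> simp [h₁, h₂, h₃] <;> omega

theorem eval_foldl_addBit (bs a : List (Circuit (Wire n μ)))
    (ha : lsbVal (a.map (Circuit.eval V)) < 2 ^ a.length) :
    (bs.foldl addBit a).length = a.length ∧
    lsbVal ((bs.foldl addBit a).map (Circuit.eval V)) =
      (lsbVal (a.map (Circuit.eval V)) + (bs.map fun b => (b.eval V).toNat).sum) %
        2 ^ a.length := by
  induction bs generalizing a with
  | nil => simpa using (Nat.mod_eq_of_lt ha).symm
  | cons b bs ih =>
    have h := ih (addBit a b) (by
      rw [eval_addBit, addBit_length]; exact Nat.mod_lt _ (by positivity))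
    rw [addBit_length, eval_addBit] at h
    refine ⟨h.1, ?_⟩
    rw [List.foldl_cons, h.2, List.map_cons, List.sum_cons, Nat.mod_add_mod, add_assoc]

theorem lsbVal_replicate_false (m : ℕ) : lsbVal (List.replicate m false) = 0 := by
  induction m with
  | zero => rfl
  | succ m ih => simp [List.replicate_succ, lsbVal, ih]

theorem sheFadder_length (bs : List (Circuit (Wire n μ))) :
    (sheFadder bs).length = rankLen n := by
  -- The length does not depend on the assignment, so any one will do.
  have h := (eval_foldl_addBit (V := fun _ => false) bs
    (List.replicate (rankLen n) (cZero : Circuit (Wire n μ))) (by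
      simp [eval_cZero, lsbVal_replicate_false])).1
  simpa [sheFadder] using h

theorem eval_sheFadder (bs : List (Circuit (Wire n μ))) :
    msbVal ((sheFadder bs).map (Circuit.eval V)) =
      (bs.map fun b => (b.eval V).toNat).sum % 2 ^ rankLen n := by
  have h := (eval_foldl_addBit (V := V) bs
    (List.replicate (rankLen n) (cZero : Circuit (Wire n μ))) (by
      simp [eval_cZero, lsbVal_replicate_false])).2
  rw [sheFadder, List.map_reverse, msbVal_reverse, h]
  simp [eval_cZero, lsbVal_replicate_false]

/-- By trichotomy at most one of the two strict comparisons holds; adding 1 to their sum tests that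
neither does. -/
theorem eval_sheEqual (h : V Wire.one = true) (a b : List (Circuit (Wire n μ)))
    (hl : a.length = b.length) : (sheEqual a b).eval V =
      decide (msbVal (a.map (Circuit.eval V)) = msbVal (b.map (Circuit.eval V))) := by
  simp only [sheEqual, sheCmp, Circuit.eval, eval_cOne h, eval_sheGreater h a b hl,
    eval_sheGreater h b a hl.symm]
  rcases lt_trichotomy (msbVal (a.map (Circuit.eval V))) (msbVal (b.map (Circuit.eval V)))
    with h | h | h
  · simp [h, h.not_gt, h.ne]
  · simp [h]
  · simp [h, h.not_gt, h.ne']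

theorem eval_sheAdd (l : List (Circuit (Wire n μ))) :
    (sheAdd l).eval V = (l.map (Circuit.eval V)).foldr xor false := by
  induction l with
  | nil => exact eval_cZero
  | cons a l ih =>
    cases l with
    | nil => simp [sheAdd]
    | cons b l => simp only [sheAdd, Circuit.eval, ih, List.map_cons, List.foldr_cons]

/-- Used for the selection: all masked inputs but one vanish. -/
theorem foldr_xor_ofFn {m : ℕ} (g : Fin m → Bool) (i : Fin m) (h : ∀ j ≠ i, g j = false) :
    (List.ofFn g).foldr xor false = g i := by
  have h₀ : ∀ {m : ℕ} (g : Fin m → Bool), (∀ j, g j = false) →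
      (List.ofFn g).foldr xor false = false := by
    intro m
    induction m with
    | zero => intro g _; simp
    | succ m ih => intro g hg; rw [List.ofFn_succ, List.foldr_cons, ih _ fun j => hg _, hg]; rfl
  induction m with
  | zero => exact i.elim0
  | succ m ih =>
    rw [List.ofFn_succ, List.foldr_cons]
    refine Fin.cases ?_ (fun i => ?_) i h
    · intro h
      rw [h₀ _ fun j => h _ (Fin.succ_ne_zero j)]
      simp
    · intro h
      rw [h 0 (Fin.succ_ne_zero i).symm, ih _ i fun j hj => h _ (by simpa using hj)]
      simp

end Routines

/-! ### Ranks of distinct inputs. -/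

section Rank

variable {n μ : ℕ}

/-- The rank of the input of client `i`. -/
def rank (x : Inputs n μ) (i : Fin n) : ℕ := (Finset.univ.filter fun j => i = j ∨ x j < x i).card

theorem rank_eq (x : Inputs n μ) (hx : Function.Injective x) (i : Fin n) :
    rank x i = (Finset.univ.filter fun j => x j ≤ x i).card := by
  unfold rank
  congr 1
  ext j
  simp only [Finset.mem_filter, Finset.mem_univ, true_and, le_iff_lt_or_eq]
  constructor
  · rintro (rfl | h)
    exacts [Or.inr rfl, Or.inl h]
  · rintro (h | h)
    exacts [Or.inr h, Or.inl (hx h).symm]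

/-- A larger input has a strictly larger rank, because it also counts itself. -/
theorem rank_injective (x : Inputs n μ) (hx : Function.Injective x) :
    Function.Injective (rank x) := by
  have h : ∀ i j, x i < x j → rank x i < rank x j := by
    intro i j hij
    rw [rank_eq x hx, rank_eq x hx]
    refine Finset.card_lt_card (Finset.ssubset_iff_of_subset ?_ |>.2 ⟨j, by simp, by simpa using hij⟩)
    intro l hl
    simp only [Finset.mem_filter, Finset.mem_univ, true_and] at hl ⊢
    exact hl.trans hij.le
  intro i j hij
  rcases lt_trichotomy (x i) (x j) with h' | h' | h'
  · exact absurd hij (h i j h').ne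
  · exact hx h'
  · exact absurd hij (h j i h').ne'

/-- In the increasing enumeration `e` of the values, those not exceeding `e l` are exactly the `e j`
with `j ≤ l`. -/
theorem exists_rank_eq (x : Inputs n μ) (hx : Function.Injective x) {k : ℕ} (hk : 1 ≤ k)
    (hkn : k ≤ n) : ∃ i, rank x i = k ∧ (x i : ℕ) = kre k x := by
  set s := Finset.univ.image fun i => (x i : ℕ) with hs
  have hinj : Function.Injective fun i => (x i : ℕ) := fun i j h => hx (Fin.ext h)
  have hc : s.card = n := by rw [hs, Finset.card_image_of_injective _ hinj]; simp
  let e := s.orderEmbOfFin hc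
  -- `e` counts from 0, ranks count from 1.
  let l : Fin n := ⟨k - 1, by omega⟩
  have hkre : kre k x = e l := by
    rw [kre, ← hs, List.getD_eq_getElem _ _ (by rw [Finset.length_sort, hc]; omega)]
    exact (Finset.orderEmbOfFin_apply s hc l).symm
  have hmem : e l ∈ Finset.univ.image fun i => (x i : ℕ) := s.orderEmbOfFin_mem hc l
  obtain ⟨i, -, hi⟩ := Finset.mem_image.1 hmem
  refine ⟨i, ?_, hi.trans hkre.symm⟩
  rw [rank_eq x hx]
  have h₁ : (Finset.univ.filter fun j => x j ≤ x i).card = (s.filter fun y => y ≤ e l).card := by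
    rw [← hi, hs, Finset.filter_image, Finset.card_image_of_injective _ hinj]
    rfl
  have h₂ : (s.filter fun y => y ≤ e l) = (Finset.Iic l).map e.toEmbedding := by
    ext y
    simp only [Finset.mem_filter, Finset.mem_map, Finset.mem_Iic]
    constructor
    · rintro ⟨hy, hle⟩
      have : y ∈ Set.range e := by rw [Finset.range_orderEmbOfFin]; exact hy
      obtain ⟨j, rfl⟩ := this
      exact ⟨j, e.le_iff_le.1 hle, rfl⟩
    · rintro ⟨j, hj, rfl⟩
      exact ⟨s.orderEmbOfFin_mem hc j, e.le_iff_le.2 hj⟩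
  rw [h₁, h₂, Finset.card_map, Fin.card_Iic]
  simp only [l]
  omega

end Rank

theorem kre_lt {n μ : ℕ} (x : Inputs n μ) (hx : Function.Injective x) {k : ℕ} (hk : 1 ≤ k)
    (hkn : k ≤ n) : kre k x < 2 ^ μ := by
  obtain ⟨i, -, h⟩ := exists_rank_eq x hx hk hkn
  rw [← h]
  exact (x i).2

/-! ### The server's circuit on the plaintexts of an execution. -/

section Kre

variable {n μ k : ℕ} (x : Inputs n μ) (s : ℕ)

theorem eval_cInput (i : Fin n) : (cInput n μ i).map
    (Circuit.eval fun w => slot (wireMsg k x w) s) = bitRep μ (x i) := by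
  have h : ∀ j : Fin μ, slot (wireMsg k x (Wire.xBit i j)) s = (bitRep μ (x i)).getD j false :=
    fun _ => rfl
  apply List.ext_getElem
  · simp [cInput, bitRep_length]
  · intro j h₁ h₂
    rw [List.getElem_map]
    simp only [cInput, List.getElem_ofFn, Circuit.eval, h]
    rw [List.getD_eq_getElem _ _ h₂]

theorem eval_cRankK : (cRankK n μ).map
    (Circuit.eval fun w => slot (wireMsg k x w) s) = bitRep (rankLen n) k := by
  have h : ∀ j, slot (wireMsg k x (Wire.kBit j)) s = (bitRep (rankLen n) k).getD j false :=
    fun _ => rfl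
  apply List.ext_getElem
  · simp [cRankK, bitRep_length]
  · intro j h₁ h₂
    rw [List.getElem_map]
    simp only [cRankK, List.getElem_ofFn, Circuit.eval, h]
    rw [List.getD_eq_getElem _ _ h₂]

theorem eval_cCmpBit (i j : Fin n) : (cCmpBit n μ i j).eval (fun w => slot (wireMsg k x w) s) =
    decide (i = j ∨ x j < x i) := by
  have hone : slot (wireMsg k x Wire.one) s = true := rfl
  have hl : ∀ i j, (cInput n μ i).length = (cInput n μ j).length := by simp [cInput]
  have hv : ∀ i, (x i : ℕ) % 2 ^ μ = x i := fun i => Nat.mod_eq_of_lt (x i).2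
  unfold cCmpBit
  split_ifs with h h'
  · simp [h, eval_cOne (V := fun w => slot (wireMsg k x w) s) hone]
  all_goals
    simp only [sheCmp]
    rw [eval_sheGreater hone _ _ (hl _ _), eval_cInput, eval_cInput, msbVal_bitRep, msbVal_bitRep]
    simp [h, hv]

theorem eval_cSelect (hkn : k ≤ n) (i : Fin n) :
    (cSelect n μ i).eval (fun w => slot (wireMsg k x w) s) = decide (rank x i = k) := by
  have hone : slot (wireMsg k x Wire.one) s = true := rfl
  -- Neither a rank nor `k` exceeds `n`, so `rankLen n` bits represent both without reduction.
  have hn : n < 2 ^ rankLen n := Nat.lt_size_self n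
  have hr : rank x i ≤ n := (Finset.card_filter_le _ _).trans (by simp)
  unfold cSelect cRank
  rw [eval_sheEqual hone _ _ (by rw [sheFadder_length]; simp [cRankK]), eval_cRankK,
    msbVal_bitRep, Nat.mod_eq_of_lt (hkn.trans_lt hn), eval_sheFadder]
  have : ((List.ofFn fun j => cCmpBit n μ i j).map fun b =>
      (b.eval (fun w => slot (wireMsg k x w) s)).toNat).sum = rank x i := by
    rw [List.map_ofFn, List.sum_ofFn, rank, Finset.card_filter]
    refine Finset.sum_congr rfl fun j _ => ?_
    simp only [Function.comp_apply, eval_cCmpBit]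
    by_cases h : i = j ∨ x j < x i <;> simp [h]
  rw [this, Nat.mod_eq_of_lt (hr.trans_lt hn)]

/-- In each slot the circuit computes the corresponding bit of the `k`-th ranked element. -/
theorem eval_kreCircuit (hx : Function.Injective x) (hk : 1 ≤ k) (hkn : k ≤ n) :
    (kreCircuit n μ).eval (fun v => slot (wireMsg k x ((wireEquiv n μ).symm v)) s) =
      (bitRep μ (kre k x)).getD s false := by
  obtain ⟨i, hi, hik⟩ := exists_rank_eq x hx hk hkn
  rw [kreCircuit, Circuit.eval_rename]
  simp only [Equiv.symm_apply_apply]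
  -- `i` is the client of rank `k`; by injectivity of the rank every other mask is 0.
  rw [computeKre, eval_sheAdd, List.map_ofFn, foldr_xor_ofFn _ i]
  · simp only [Function.comp_apply, Circuit.eval, eval_cSelect x s hkn, hi, ← hik]
    simp only [decide_true, Bool.and_true]
    rfl
  · intro j hj
    have : rank x j ≠ k := fun h => hj (rank_injective x hx (h.trans hi.symm))
    simp [Circuit.eval, eval_cSelect x s hkn, this]

end Kre

theorem isPlaintext_wireMsg {n μ m : ℕ} (k : ℕ) (x : Inputs n μ) (hm : μ ≤ m) (w : Wire n μ) :
    IsPlaintext m (wireMsg k x w) := by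
  rcases w with ⟨i, j⟩ | i | j | j
  · exact Or.inl ⟨_, rfl⟩
  · exact Or.inr ⟨_, by rw [bitRep_length]; exact hm, rfl⟩
  · exact Or.inl ⟨_, rfl⟩
  · exact Or.inl ⟨_, rfl⟩

namespace Protocol

variable {n t : ℕ} {S : ThresholdSHE n t} {E : PKE} {μ κ : ℕ} {k : ℕ} {x : Inputs n μ}

theorem kreCt_length (hslots : ∀ κ, μ ≤ S.slots κ) (hperm : S.Permitted (kreCircuit n μ))
    (ω : Coins S E μ κ) : (kreCt k x ω).length = S.ctLen κ :=
  S.eval_length _ hperm _ _ _ _ fun _ =>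
    S.enc_length _ _ _ _ (isPlaintext_wireMsg k x (hslots κ) _)

theorem partialDec_length (hslots : ∀ κ, μ ≤ S.slots κ) (hperm : S.Permitted (kreCircuit n μ))
    (ω : Coins S E μ κ) (i : Fin n) : (partialDec k x ω i).length = S.pdLen κ :=
  S.partDec_length _ _ _ _ _ (kreCt_length hslots hperm ω)

/-- Partial decryptions have the message length of the public-key scheme, so they arrive intact;
`FinDec` then yields the circuit value slot by slot. -/
theorem correct (hk : 1 ≤ k) (hkn : k ≤ n) (hslots : ∀ κ, μ ≤ S.slots κ)
    (hperm : S.Permitted (kreCircuit n μ)) (hlen : ∀ κ, E.msgLen κ = S.pdLen κ) :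
    Correct S E k μ := by
  intro x hx κ ω i
  have hdec : ∀ j, E.dec (ownSk ω i) (reEncrypted k x ω j i) =
      partialDec k x ω (decryptor ω j) := fun j =>
    E.dec_enc _ _ _ _ (by rw [partialDec_length hslots hperm, hlen])
  unfold output
  simp only [hdec]
  have h := S.dec_eval (kreCircuit n μ) hperm κ ω.key
    (fun v => wireMsg k x ((wireEquiv n μ).symm v)) (fun v => ω.enc ((wireEquiv n μ).symm v))
    ω.eval ω.decryptors.1 ω.decryptors.2 (fun j => ω.dec (decryptor ω j))
    fun v => isPlaintext_wireMsg k x (hslots κ) _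
  have h' : (S.finDec fun j => partialDec k x ω (decryptor ω j)) = _ := h
  rw [h']
  simp only [eval_kreCircuit x _ hx hk hkn]
  -- There are at least `μ` slots, and `take μ` discards the padding.
  apply List.ext_getElem
  · simp [bitRep_length, hslots κ]
  · intro j h₁ h₂
    rw [List.getElem_take, List.getElem_ofFn, List.getD_eq_getElem _ _ h₂]

end Protocol

/-! ## The algorithms of the schemes as polynomial-time functions of variables -/

section Schemes

variable {A : Type} [Fintype A] {n t : ℕ} (S : ThresholdSHE n t) (E : PKE)

theorem polyList_pkeKeys {a b : (A → Str) → Str} (ha : PolyFun a) (hb : PolyFun b) :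
    PolyList 2 fun v => [(E.keyGen (a v) (b v)).1, (E.keyGen (a v) (b v)).2] :=
  PolyList.call E.keyGen_poly ((PolyList.nil.cons hb).cons ha) (fun v => (a v, b v)) (fun _ => rfl)
    fun _ => rfl

theorem polyFun_pkePk {a b : (A → Str) → Str} (ha : PolyFun a) (hb : PolyFun b) :
    PolyFun fun v => (E.keyGen (a v) (b v)).1 := (polyList_pkeKeys E ha hb).getD 0

theorem polyFun_pkeEnc {a b c : (A → Str) → Str} (ha : PolyFun a) (hb : PolyFun b)
    (hc : PolyFun c) : PolyFun fun v => E.enc (a v) (b v) (c v) :=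
  (PolyList.call E.enc_poly (((PolyList.nil.cons hc).cons hb).cons ha)
    (fun v => (a v, b v, c v)) (fun _ => rfl) fun _ => rfl).polyFun

theorem polyList_sheKeys {a b : (A → Str) → Str} (ha : PolyFun a) (hb : PolyFun b) :
    PolyList (n + 1 + 1) fun v => (S.keyGen (a v) (b v)).1 :: (S.keyGen (a v) (b v)).2.1 ::
      List.ofFn (S.keyGen (a v) (b v)).2.2 :=
  PolyList.call S.keyGen_poly ((PolyList.nil.cons hb).cons ha) (fun v => (a v, b v)) (fun _ => rfl)
    fun _ => by simp

theorem polyFun_shePk {a b : (A → Str) → Str} (ha : PolyFun a) (hb : PolyFun b) :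
    PolyFun fun v => (S.keyGen (a v) (b v)).1 := (polyList_sheKeys S ha hb).getD 0

theorem polyFun_sheEk {a b : (A → Str) → Str} (ha : PolyFun a) (hb : PolyFun b) :
    PolyFun fun v => (S.keyGen (a v) (b v)).2.1 := (polyList_sheKeys S ha hb).getD 1

theorem polyFun_sheShare {a b : (A → Str) → Str} (ha : PolyFun a) (hb : PolyFun b) (i : Fin n) :
    PolyFun fun v => (S.keyGen (a v) (b v)).2.2 i := by
  have := (polyList_sheKeys S ha hb).getD (i + 1 + 1)
  convert this using 2 with v
  rw [List.getD_cons_succ, List.getD_cons_succ, List.getD_eq_getElem _ _ (by simp)]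
  simp

theorem polyFun_sheEnc {a b c : (A → Str) → Str} (ha : PolyFun a) (hb : PolyFun b)
    (hc : PolyFun c) : PolyFun fun v => S.enc (a v) (b v) (c v) :=
  (PolyList.call S.enc_poly (((PolyList.nil.cons hc).cons hb).cons ha)
    (fun v => (a v, b v, c v)) (fun _ => rfl) fun _ => rfl).polyFun

theorem polyFun_shePartDec {a b c : (A → Str) → Str} (ha : PolyFun a) (hb : PolyFun b)
    (hc : PolyFun c) : PolyFun fun v => S.partDec (a v) (b v) (c v) :=
  (PolyList.call S.partDec_poly (((PolyList.nil.cons hc).cons hb).cons ha)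
    (fun v => (a v, b v, c v)) (fun _ => rfl) fun _ => rfl).polyFun

theorem polyFun_sheEval {N : ℕ} {f : Circuit (Fin N)} (hf : S.Permitted f) {a c : (A → Str) → Str}
    {b : Fin N → (A → Str) → Str} (ha : PolyFun a) (hb : ∀ j, PolyFun (b j)) (hc : PolyFun c) :
    PolyFun fun v => S.eval f (a v) (fun j => b j v) (c v) :=
  (PolyList.call (S.eval_poly f hf) (((PolyList.ofFn hb).cons hc).cons ha)
    (fun v => (a v, fun j => b j v, c v)) (fun _ => rfl) fun _ => rfl).polyFun

end Schemes

/-! ## The random tapes of an execution -/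

/-- The random tapes of an execution, and of the encryption of a dummy message. -/
inductive CoinIdx (n μ : ℕ) : Type
  | key : CoinIdx n μ
  | ownKey : Fin n → CoinIdx n μ
  | enc : Wire n μ → CoinIdx n μ
  | eval : CoinIdx n μ
  | dec : Fin n → CoinIdx n μ
  | reEnc : Fin n → Fin n → CoinIdx n μ
  | dummyKey : CoinIdx n μ
  | dummyEnc : CoinIdx n μ
  | dummyDec : CoinIdx n μ

namespace CoinIdx

variable {n t μ : ℕ}

/-- Serves only to show that there are finitely many tapes. -/
def toSum : CoinIdx n μ → Fin 5 ⊕ (Fin n ⊕ Wire n μ) ⊕ (Fin n ⊕ Fin n × Fin n)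
  | key => .inl 0
  | eval => .inl 1
  | dummyKey => .inl 2
  | dummyEnc => .inl 3
  | dummyDec => .inl 4
  | ownKey i => .inr (.inl (.inl i))
  | enc w => .inr (.inl (.inr w))
  | dec i => .inr (.inr (.inl i))
  | reEnc i l => .inr (.inr (.inr (i, l)))

theorem toSum_injective : Function.Injective (toSum (n := n) (μ := μ)) := by
  intro a b h
  cases a <;> cases b <;> simp [toSum] at h ⊢ <;> exact h

instance : Fintype (CoinIdx n μ) := Fintype.ofInjective toSum toSum_injective

variable (S : ThresholdSHE n t) (E : PKE) (μ)

/-- The lengths of the tapes. -/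
def len : CoinIdx n μ → Polynomial ℕ
  | key => S.keyRand
  | ownKey _ => E.keyRand
  | enc _ => S.encRand
  | eval => S.evalRand (kreCircuit n μ)
  | dec _ => S.decRand
  | reEnc _ _ => E.encRand
  | dummyKey => S.keyRand
  | dummyEnc => S.encRand
  | dummyDec => S.decRand

/-- The coins of an execution from the set of decryptors and the tapes. -/
def coins (κ : ℕ) (z : {T : Finset (Fin n) // T.card = t} × Tapes (len μ S E) κ) :
    Coins S E μ κ where
  key := z.2 key
  ownKey i := z.2 (ownKey i)
  enc w := z.2 (enc w)
  eval := z.2 eval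
  decryptors := z.1
  dec i := z.2 (dec i)
  reEnc i l := z.2 (reEnc i l)

def coinsEquiv (κ : ℕ) : {T : Finset (Fin n) // T.card = t} × Tapes (len μ S E) κ ≃
    Coins S E μ κ × Bits (S.keyRand.eval κ) × Bits (S.encRand.eval κ) × Bits (S.decRand.eval κ) where
  toFun z := (coins μ S E κ z, z.2 dummyKey, z.2 dummyEnc, z.2 dummyDec)
  invFun y := (y.1.decryptors, fun c => match c with
    | key => y.1.key
    | ownKey i => y.1.ownKey i
    | enc w => y.1.enc w
    | eval => y.1.eval
    | dec i => y.1.dec i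
    | reEnc i l => y.1.reEnc i l
    | dummyKey => y.2.1
    | dummyEnc => y.2.2.1
    | dummyDec => y.2.2.2)
  left_inv z := by
    refine Prod.ext rfl (funext fun c => ?_)
    cases c <;> rfl
  right_inv _ := rfl

/-- The three dummy tapes are independent of the execution and can be forgotten. -/
theorem unif_coins (κ : ℕ) : Unif (coins μ S E κ) :=
  unif_fst.comp (coinsEquiv μ S E κ).unif _ fun _ => rfl

/-- The part of the tapes that the game for the threshold scheme uses. -/
def gamePart {κ : ℕ} (ρ : Tapes (len μ S E) κ) :
    Bits (S.keyRand.eval κ) × (Fin (wireCount n μ) → Bits (S.encRand.eval κ)) ×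
      Bits ((S.evalRand (kreCircuit n μ)).eval κ) × (Fin n → Bits (S.decRand.eval κ)) :=
  (ρ key, fun v => ρ (enc ((wireEquiv n μ).symm v)), ρ eval, fun i => ρ (dec i))

def gameEquiv (κ : ℕ) : Tapes (len μ S E) κ ≃
    (Bits (S.keyRand.eval κ) × (Fin (wireCount n μ) → Bits (S.encRand.eval κ)) ×
      Bits ((S.evalRand (kreCircuit n μ)).eval κ) × (Fin n → Bits (S.decRand.eval κ))) ×
    (Fin n → Bits (E.keyRand.eval κ)) × (Fin n → Fin n → Bits (E.encRand.eval κ)) ×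
      Bits (S.keyRand.eval κ) × Bits (S.encRand.eval κ) × Bits (S.decRand.eval κ) where
  toFun ρ := (gamePart μ S E ρ, fun i => ρ (ownKey i), fun i l => ρ (reEnc i l), ρ dummyKey,
    ρ dummyEnc, ρ dummyDec)
  invFun y c := match c with
    | key => y.1.1
    | ownKey i => y.2.1 i
    | enc w => y.1.2.1 (wireEquiv n μ w)
    | eval => y.1.2.2.1
    | dec i => y.1.2.2.2 i
    | reEnc i l => y.2.2.1 i l
    | dummyKey => y.2.2.2.1
    | dummyEnc => y.2.2.2.2.1
    | dummyDec => y.2.2.2.2.2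
  left_inv ρ := by
    funext c
    have h : ∀ w w' : Wire n μ, w = w' →
        (show Bits (S.encRand.eval κ) from ρ (enc w)) = ρ (enc w') := by
      rintro w _ rfl
      rfl
    cases c
    case enc w => exact h _ _ ((wireEquiv n μ).symm_apply_apply w)
    all_goals rfl
  right_inv y := by
    simp [gamePart]

theorem unif_gamePart (κ : ℕ) : Unif (gamePart μ S E (κ := κ)) :=
  unif_fst.comp (gameEquiv μ S E κ).unif _ fun _ => rfl

end CoinIdx

/-! ### Resampling some of the tapes. -/

section Mix

variable {J K : Type} {len : J → Polynomial ℕ} {len' : K → Polynomial ℕ}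
  {κ : ℕ}

/-- `ρ` on `P` and elsewhere `σ`, where `σ` has additional components. -/
def Tapes.mix (P : J → Prop) (ρ : Tapes len κ) (σ : Tapes (Sum.elim len len') κ) :
    Tapes (Sum.elim len len') κ
  | .inl j => if P j then ρ j else σ (.inl j)
  | .inr i => σ (.inr i)

theorem Tapes.str_mix (P : J → Prop) (ρ : Tapes len κ) (σ : Tapes (Sum.elim len len') κ) (j : J) :
    Tapes.str (Tapes.mix P ρ σ) (.inl j) = if P j then Tapes.str ρ j else Tapes.str σ (.inl j) := by
  by_cases h : P j <;> simp [Tapes.str, Tapes.mix, h]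

/-- Exchanging the components in `P` between the two families is an involution of the product, hence
preserves the uniform distribution; the mixture is its second coordinate. -/
theorem unif_mix [Fintype J] [DecidableEq J] [Fintype K] [DecidableEq K] (P : J → Prop) :
    Unif fun z : Tapes len κ × Tapes (Sum.elim len len') κ => Tapes.mix P z.1 z.2 := by
  let swap : Tapes len κ × Tapes (Sum.elim len len') κ →
      Tapes len κ × Tapes (Sum.elim len len') κ := fun z =>
    (fun j => if P j then z.2 (.inl j) else z.1 j, Tapes.mix P z.1 z.2)
  have hswap : Function.Involutive swap := by
    rintro ⟨ρ, σ⟩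
    refine Prod.ext (funext fun j => ?_) (funext fun j => ?_)
    · by_cases h : P j <;> simp [swap, Tapes.mix, h]
    · rcases j with j | i
      · by_cases h : P j <;> simp [swap, Tapes.mix, h] <;> rfl
      · rfl
  exact unif_snd.comp hswap.toPerm.unif _ fun _ => rfl

/-- The same argument with a single tape exchanged. -/
theorem unif_update [Fintype J] [DecidableEq J] (j : J) :
    Unif fun z : Bits ((len j).eval κ) × Tapes len κ => Function.update z.2 j z.1 := by
  let swap : Bits ((len j).eval κ) × Tapes len κ → Bits ((len j).eval κ) × Tapes len κ :=
    fun z => (z.2 j, Function.update z.2 j z.1)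
  have hswap : Function.Involutive swap := by
    rintro ⟨a, ρ⟩
    simp [swap]
  exact unif_snd.comp hswap.toPerm.unif _ fun _ => rfl

end Mix

/-! ## Views as functions of strings -/

namespace Protocol

section Views

variable {n t μ : ℕ} (S : ThresholdSHE n t) (E : PKE) (k : ℕ) (x : Inputs n μ)
  (T : {T : Finset (Fin n) // T.card = t})

section Strings

variable (w : Str) (c : CoinIdx n μ → Str)

/-- Keys, ciphertexts and partial decryptions from `1^κ` and the tapes. -/
def strPk : Str := (S.keyGen w (c .key)).1
def strEk : Str := (S.keyGen w (c .key)).2.1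
def strShare (i : Fin n) : Str := (S.keyGen w (c .key)).2.2 i
def strOwnPk (i : Fin n) : Str := (E.keyGen w (c (.ownKey i))).1
def strWireCt (v : Wire n μ) : Str := S.enc (strPk S w c) (wireMsg k x v) (c (.enc v))
def strKreCt : Str :=
  S.eval (kreCircuit n μ) (strEk S w c) (fun v => strWireCt S k x w c ((wireEquiv n μ).symm v))
    (c .eval)
def strPartialDec (i : Fin n) : Str :=
  S.partDec (strShare S w c i) (strKreCt S k x w c) (c (.dec i))

end Strings

/-- The view of client `i` with given keys, result and partial decryptions. -/
def clientViewOf (pk ek result : Str) (share pd ownPk : Fin n → Str) (c : CoinIdx n μ → Str)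
    (i : Fin n) : List Str :=
  [bitRep μ (x i)] ++
  ([c (.ownKey i)] ++ (List.ofFn fun j => c (.enc (Wire.xBit i j))) ++
    [c (.enc (Wire.xPacked i)), c (.dec i)] ++ List.ofFn fun l => c (.reEnc i l)) ++
  ([pk, ek, share i] ++ List.ofFn fun l => ownPk l) ++
  [optStr (if i ∈ T.1 then some result else none)] ++
  List.ofFn fun j => E.enc (ownPk i) (pd (T.1.orderEmbOfFin T.2 j))
    (c (.reEnc (T.1.orderEmbOfFin T.2 j) i))

/-- The joint view with given keys, result and partial decryptions. -/
def jointViewOf (I : Finset (Fin n)) (pk ek result : Str) (share pd ownPk : Fin n → Str)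
    (c : CoinIdx n μ → Str) : List Str :=
  subsetStrs I ++ (List.ofFn fun i =>
    if i ∈ I then clientViewOf E x T pk ek result share pd ownPk c i
    else List.replicate (2 * n + μ + t + 8) []).flatten

/-- The joint view from `1^κ` and the tapes. -/
def strJointView (I : Finset (Fin n)) (w : Str) (c : CoinIdx n μ → Str) : List Str :=
  jointViewOf E x T I (strPk S w c) (strEk S w c) (strKreCt S k x w c) (strShare S w c)
    (strPartialDec S k x w c) (strOwnPk E w c) c

theorem jointView_coins {κ : ℕ} (I : Finset (Fin n)) (ρ : Tapes (CoinIdx.len μ S E) κ) :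
    jointView k x (CoinIdx.coins μ S E κ (T, ρ)) I =
      strJointView S E k x T I (unary κ) (Tapes.str ρ) := rfl

/-- Of the inputs, the shares and the tapes for encrypting inputs and for partial decryption, the
view contains only those of clients in `I`. This is why the data revealed by the game suffice. -/
theorem jointViewOf_congr {x x' : Inputs n μ} {I : Finset (Fin n)} {pk ek result : Str}
    {share share' pd pd' ownPk ownPk' : Fin n → Str} {c c' : CoinIdx n μ → Str}
    (hx : ∀ i ∈ I, x i = x' i) (hshare : ∀ i ∈ I, share i = share' i) (hpd : ∀ i, pd i = pd' i)
    (hown : ∀ i, ownPk i = ownPk' i) (hkey : ∀ i, c (.ownKey i) = c' (.ownKey i))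
    (hbit : ∀ i ∈ I, ∀ j, c (.enc (Wire.xBit i j)) = c' (.enc (Wire.xBit i j)))
    (hpack : ∀ i ∈ I, c (.enc (Wire.xPacked i)) = c' (.enc (Wire.xPacked i)))
    (hdec : ∀ i ∈ I, c (.dec i) = c' (.dec i)) (hre : ∀ i l, c (.reEnc i l) = c' (.reEnc i l)) :
    jointViewOf E x T I pk ek result share pd ownPk c =
      jointViewOf E x' T I pk ek result share' pd' ownPk' c' := by
  unfold jointViewOf
  congr 3
  funext i
  by_cases hi : i ∈ I
  · rw [if_pos hi, if_pos hi]
    simp only [clientViewOf, hx i hi, hshare i hi, hpd, hown, hkey, hbit i hi, hpack i hi,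
      hdec i hi, hre]
  · rw [if_neg hi, if_neg hi]

end Views

/-! ### The joint view is computable in polynomial time. -/

section Poly

variable {A : Type} [Fintype A] {n t μ : ℕ} (S : ThresholdSHE n t) (E : PKE) (k : ℕ)
  (x : Inputs n μ) (T : {T : Finset (Fin n) // T.card = t})
  {w : (A → Str) → Str} {c : CoinIdx n μ → (A → Str) → Str}

theorem polyFun_strPk (hw : PolyFun w) (hc : ∀ a, PolyFun (c a)) :
    PolyFun fun v => strPk S (w v) fun a => c a v := polyFun_shePk S hw (hc _)

theorem polyFun_strEk (hw : PolyFun w) (hc : ∀ a, PolyFun (c a)) :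
    PolyFun fun v => strEk S (w v) fun a => c a v := polyFun_sheEk S hw (hc _)

theorem polyFun_strShare (hw : PolyFun w) (hc : ∀ a, PolyFun (c a)) (i : Fin n) :
    PolyFun fun v => strShare S (w v) (fun a => c a v) i := polyFun_sheShare S hw (hc _) i

theorem polyFun_strOwnPk (hw : PolyFun w) (hc : ∀ a, PolyFun (c a)) (i : Fin n) :
    PolyFun fun v => strOwnPk E (w v) (fun a => c a v) i := polyFun_pkePk E hw (hc _)

theorem polyFun_strWireCt (hw : PolyFun w) (hc : ∀ a, PolyFun (c a)) (z : Wire n μ) :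
    PolyFun fun v => strWireCt S k x (w v) (fun a => c a v) z :=
  polyFun_sheEnc S (polyFun_strPk S hw hc) (PolyFun.const _) (hc _)

theorem polyFun_strKreCt (hperm : S.Permitted (kreCircuit n μ)) (hw : PolyFun w)
    (hc : ∀ a, PolyFun (c a)) : PolyFun fun v => strKreCt S k x (w v) fun a => c a v :=
  polyFun_sheEval S hperm (polyFun_strEk S hw hc) (fun _ => polyFun_strWireCt S k x hw hc _) (hc _)

theorem polyFun_strPartialDec (hperm : S.Permitted (kreCircuit n μ)) (hw : PolyFun w)
    (hc : ∀ a, PolyFun (c a)) (i : Fin n) :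
    PolyFun fun v => strPartialDec S k x (w v) (fun a => c a v) i :=
  polyFun_shePartDec S (polyFun_strShare S hw hc i) (polyFun_strKreCt S k x hperm hw hc) (hc _)

/-- `I` and `T` are fixed here, so membership is settled when the program is chosen, not when it
runs. -/
theorem polyList_jointViewOf (I : Finset (Fin n)) {pk ek result : (A → Str) → Str}
    {share pd ownPk : Fin n → (A → Str) → Str} (hpk : PolyFun pk) (hek : PolyFun ek)
    (hres : PolyFun result) (hshare : ∀ i, PolyFun (share i)) (hpd : ∀ i, PolyFun (pd i))
    (hown : ∀ i, PolyFun (ownPk i)) (hc : ∀ a, PolyFun (c a)) :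
    PolyList (jointViewLen n t μ) fun v => jointViewOf E x T I (pk v) (ek v) (result v)
      (fun i => share i v) (fun i => pd i v) (fun i => ownPk i v) fun a => c a v := by
  unfold jointViewOf
  refine PolyList.append (PolyList.ofFn fun i => PolyFun.const _) (PolyList.flatten_ofFn fun i => ?_)
  by_cases hi : i ∈ I
  · simp only [if_pos hi]
    unfold clientViewOf
    have hopt : PolyFun fun v => optStr (if i ∈ T.1 then some (result v) else none) := by
      by_cases hT : i ∈ T.1
      · simp only [if_pos hT]
        exact hres.cons true
      · simp only [if_neg hT]
        exact PolyFun.const []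
    refine PolyList.cast (PolyList.append (PolyList.append (PolyList.append (PolyList.append
      (PolyFun.const _).polyList
      (PolyList.append (PolyList.append (PolyList.append (hc _).polyList
        (PolyList.ofFn fun j => hc _)) (PolyList.cons (hc _) (hc _).polyList))
        (PolyList.ofFn fun l => hc _)))
      (PolyList.append (PolyList.cons hpk (PolyList.cons hek (hshare i).polyList))
        (PolyList.ofFn fun l => hown l))) hopt.polyList)
      (PolyList.ofFn fun j => polyFun_pkeEnc E (hown _) (hpd _) (hc _))) ?_
    omega
  · simp only [if_neg hi]
    have := PolyList.ofFn (A := A) (m := 2 * n + μ + t + 8) fun _ => PolyFun.const []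
    simpa only [List.ofFn_const] using this

theorem polyList_strJointView (hperm : S.Permitted (kreCircuit n μ)) (I : Finset (Fin n))
    (hw : PolyFun w) (hc : ∀ a, PolyFun (c a)) :
    PolyList (jointViewLen n t μ) fun v => strJointView S E k x T I (w v) fun a => c a v :=
  polyList_jointViewOf E x T I (polyFun_strPk S hw hc) (polyFun_strEk S hw hc)
    (polyFun_strKreCt S k x hperm hw hc) (polyFun_strShare S hw hc)
    (polyFun_strPartialDec S k x hperm hw hc) (polyFun_strOwnPk E hw hc) hc

end Poly

/-! ## Privacy against clients -/

section Clients

variable {n t μ : ℕ} (S : ThresholdSHE n t) (E : PKE) (k : ℕ)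
  (T : {T : Finset (Fin n) // T.card = t})

/-- Replaces the tapes for the encryption of the inputs. -/
def withEnc (g : Wire n μ → Str) (r : CoinIdx n μ → Str) : CoinIdx n μ → Str
  | .enc w => g w
  | c => r c

theorem polyFun_withEnc {A : Type} [Fintype A] {g : Wire n μ → (A → Str) → Str}
    {r : CoinIdx n μ → (A → Str) → Str} (hg : ∀ z, PolyFun (g z)) (hr : ∀ a, PolyFun (r a))
    (a : CoinIdx n μ) : PolyFun fun v => withEnc (fun z => g z v) (fun a => r a v) a := by
  cases a
  case enc w => exact hg w
  all_goals exact hr _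

/-- The wires that belong to clients in `I`. -/
def clientWire (I : Finset (Fin n)) : Wire n μ → Prop
  | .inl (i, _) => i ∈ I
  | .inr (.inl i) => i ∈ I
  | _ => False

/-- The tapes that the adversary against the clients in `I` leaves to the game. -/
def clientGameTapes (I : Finset (Fin n)) : CoinIdx n μ → Prop
  | .key => True
  | .enc _ => True
  | .eval => True
  | .dec i => i ∉ I
  | _ => False

/-- Reconstructs the joint view of the clients in `I` from the game, and runs `D`. -/
def clientGuess (x : Inputs n μ) (I : Finset (Fin n)) (D : PPT (jointViewLen n t μ + 1) 1)
    (d : Fin (D.rand.die + 1)) (u : GameVar n (wireCount n μ) → Str)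
    (r : CoinIdx n μ ⊕ Fin D.rand.num → Str) : List Str :=
  D.distinguish d (u .security)
    (jointViewOf E x T I (u .pk) (u .ek) (u .result) (fun i => u (.share i))
      (fun i => if i ∈ I then S.partDec (u (.share i)) (u .result) (r (.inl (.dec i)))
        else u (.partDec i))
      (fun l => (E.keyGen (u .security) (r (.inl (.ownKey l)))).1)
      (withEnc (fun z => u (.tape (wireEquiv n μ z))) fun a => r (.inl a)))
    fun i => r (.inr i)

theorem polyOp_clientGuess (x : Inputs n μ) (I : Finset (Fin n))
    (D : PPT (jointViewLen n t μ + 1) 1) (d : Fin (D.rand.die + 1)) :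
    PolyOp 1 (clientGuess S E T x I D d) := by
  intro A _ g h hg hh
  refine polyList_distinguish D d (hg _) (polyList_jointViewOf E x T I (hg _) (hg _) (hg _)
    (fun i => hg (.share i)) (pd := fun i v => if i ∈ I then
      S.partDec (g (.share i) v) (g .result v) (h (.inl (.dec i)) v) else g (.partDec i) v)
    (fun i => ?_) (fun l => polyFun_pkePk E (hg _) (hh _))
    (polyFun_withEnc (fun _ => hg _) fun a => hh _)) fun i => hh _
  by_cases hi : i ∈ I
  · simp only [if_pos hi]
    exact polyFun_shePartDec S (hg _) (hg _) (hh _)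
  · simp only [if_neg hi]
    exact hg _

variable {S} {k}

/-- The game for the threshold scheme in terms of the tapes of an execution. -/
theorem close_of_game {E : PKE} {K : Type} [Fintype K] [DecidableEq K]
    (len' : K → Polynomial ℕ) (hS : S.IndCPA)
    (hperm : S.Permitted (kreCircuit n μ)) {C : Finset (Fin n)} (hC : C.card < t)
    {R : Finset (Fin (wireCount n μ))} {m : Bool → Fin (wireCount n μ) → Str}
    (hm : ∀ b κ j, IsPlaintext (S.slots κ) (m b j)) (hR : ∀ j ∈ R, m false j = m true j)
    {G : (GameVar n (wireCount n μ) → Str) → (CoinIdx n μ ⊕ K → Str) → List Str}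
    (hG : PolyOp 1 G) (P : CoinIdx n μ → Prop)
    (V : Bool → ∀ κ, Tapes (Sum.elim (CoinIdx.len μ S E) len') κ → Prop)
    (h : ∀ b κ (ρ : Tapes (CoinIdx.len μ S E) κ)
      (σ : Tapes (Sum.elim (CoinIdx.len μ S E) len') κ),
      G (S.gameEnv (kreCircuit n μ) C R m b
        (CoinIdx.gamePart μ S E ρ).1 (CoinIdx.gamePart μ S E ρ).2.1
        (CoinIdx.gamePart μ S E ρ).2.2.1 (CoinIdx.gamePart μ S E ρ).2.2.2)
        (Tapes.str σ) = [[true]] ↔ V b κ (Tapes.mix P ρ σ)) :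
    Close (fun κ => prob (V false κ)) fun κ => prob (V true κ) := by
  have hgame := ThresholdSHE.IndCPA.close (len := Sum.elim (CoinIdx.len μ S E) len')
      (kreCircuit n μ) C R m hS hperm hC hm hR hG
  have hu : ∀ κ, Unif fun z : Tapes (CoinIdx.len μ S E) κ ×
      Tapes (Sum.elim (CoinIdx.len μ S E) len') κ =>
      ((CoinIdx.gamePart μ S E z.1).1, (CoinIdx.gamePart μ S E z.1).2.1,
        (CoinIdx.gamePart μ S E z.1).2.2.1, (CoinIdx.gamePart μ S E z.1).2.2.2, z.2) := by
    intro κ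
    let e : (Bits (S.keyRand.eval κ) × (Fin (wireCount n μ) → Bits (S.encRand.eval κ)) ×
        Bits ((S.evalRand (kreCircuit n μ)).eval κ) × (Fin n → Bits (S.decRand.eval κ))) ×
        Tapes (Sum.elim (CoinIdx.len μ S E) len') κ ≃
        Bits (S.keyRand.eval κ) × (Fin (wireCount n μ) → Bits (S.encRand.eval κ)) ×
        Bits ((S.evalRand (kreCircuit n μ)).eval κ) × (Fin n → Bits (S.decRand.eval κ)) ×
        Tapes (Sum.elim (CoinIdx.len μ S E) len') κ :=
      { toFun := fun y => (y.1.1, y.1.2.1, y.1.2.2.1, y.1.2.2.2, y.2)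
        invFun := fun y => ((y.1, y.2.1, y.2.2.1, y.2.2.2.1), y.2.2.2.2)
        left_inv := fun _ => rfl
        right_inv := fun _ => rfl }
    exact e.unif.comp ((CoinIdx.unif_gamePart μ S E κ).prodMap unif_id) _ fun _ => rfl
  have key : ∀ b κ, prob (V b κ) = prob
      fun ω : Bits (S.keyRand.eval κ) × (Fin (wireCount n μ) → Bits (S.encRand.eval κ)) ×
        Bits ((S.evalRand (kreCircuit n μ)).eval κ) × (Fin n → Bits (S.decRand.eval κ)) ×
        Tapes (Sum.elim (CoinIdx.len μ S E) len') κ =>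
        G (S.gameEnv (kreCircuit n μ) C R m b ω.1 ω.2.1 ω.2.2.1 ω.2.2.2.1)
          (Tapes.str ω.2.2.2.2) = [[true]] := by
    intro b κ
    -- Both probabilities are pulled back to independent families: `ρ`, from which the game draws,
    -- and `σ`, which the adversary draws itself.
    rw [← (hu κ).prob_eq, ← (unif_mix P).prob_eq]
    exact congrArg prob (funext fun z => propext (h b κ z.1 z.2).symm)
  exact hgame.of_eq (key false) (key true)

/-- The joint view of the clients in `I` depends on the inputs of the other clients only through
the `k`-th ranked element, up to indistinguishability. -/
theorem close_jointView (hk : 1 ≤ k) (hkn : k ≤ n) (hslots : ∀ κ, μ ≤ S.slots κ)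
    (hperm : S.Permitted (kreCircuit n μ)) (hS : S.IndCPA) {I : Finset (Fin n)} (hI : I.card < t)
    (x : Bool → Inputs n μ) (hx : ∀ b, Function.Injective (x b))
    (hxI : ∀ i ∈ I, x false i = x true i) (hkre : kre k (x false) = kre k (x true))
    (D : PPT (jointViewLen n t μ + 1) 1) (d : Fin (D.rand.die + 1)) :
    let p : Bool → ℕ → ℝ := fun b κ => prob
      fun ρ : Tapes (Sum.elim (CoinIdx.len μ S E) D.rand.tape) κ =>
        D.distinguish d (unary κ)
          (strJointView S E k (x b) T I (unary κ) fun a => (ρ (.inl a)).str)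
          (fun i => (ρ (.inr i)).str) = [[true]]
    Close (p false) (p true) := by
  intro p
  let m : Bool → Fin (wireCount n μ) → Str := fun b v => wireMsg k (x b) ((wireEquiv n μ).symm v)
  -- The encryption tapes of the clients in `I` belong to their view, so the game has to reveal
  -- them; on these wires the two tuples agree.
  let R : Finset (Fin (wireCount n μ)) :=
    Finset.univ.filter fun v => clientWire I ((wireEquiv n μ).symm v)
  have hm : ∀ b κ j, IsPlaintext (S.slots κ) (m b j) := fun b κ j =>
    isPlaintext_wireMsg k (x b) (hslots κ) _
  have hR : ∀ j ∈ R, m false j = m true j := by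
    intro j hj
    have hj' : clientWire I ((wireEquiv n μ).symm j) := (Finset.mem_filter.1 hj).2
    simp only [m]
    generalize (wireEquiv n μ).symm j = w at hj' ⊢
    rcases w with ⟨i, l⟩ | i | l | l
    · simp only [wireMsg, hxI i hj']
    · simp only [wireMsg, hxI i hj']
    · exact hj'.elim
    · exact hj'.elim
  -- Equality of the `k`-th ranked elements enters here; it makes the game release the result and
  -- the honest partial decryptions.
  have hsame : ∀ κ, S.SameValue (kreCircuit n μ) m κ := by
    intro κ s
    simp only [m, eval_kreCircuit _ _ (hx _) hk hkn, hkre]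
  -- The adversary may use `x false` in both cases, since the view shows inputs of clients in `I`
  -- only.
  refine close_of_game D.rand.tape hS hperm hI hm hR (polyOp_clientGuess S E T (x false) I D d)
    (clientGameTapes I) (fun b κ (ρ : Tapes (Sum.elim (CoinIdx.len μ S E) D.rand.tape) κ) =>
      D.distinguish d (unary κ) (strJointView S E k (x b) T I (unary κ) fun a => (ρ (.inl a)).str)
        (fun i => (ρ (.inr i)).str) = [[true]]) fun b κ ρ σ => ?_
  have hgr : S.gameResult (kreCircuit n μ) m b (CoinIdx.gamePart μ S E ρ).1
      (CoinIdx.gamePart μ S E ρ).2.1 (CoinIdx.gamePart μ S E ρ).2.2.1 =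
      strKreCt S k (x b) (unary κ) (Tapes.str ρ) := rfl
  let c : CoinIdx n μ → Str := fun a => if clientGameTapes I a then Tapes.str ρ a
    else Tapes.str σ (.inl a)
  have hc : (fun a => Tapes.str (Tapes.mix (clientGameTapes I) ρ σ) (.inl a)) = c :=
    funext (Tapes.str_mix _ ρ σ)
  have hkct : strKreCt S k (x b) (unary κ) c = strKreCt S k (x b) (unary κ) (Tapes.str ρ) := by
    simp [strKreCt, strEk, strWireCt, strPk, c, clientGameTapes]
  -- Clients in `I` decrypt with the revealed shares and tapes of the adversary; the other partial
  -- decryptions come from the game.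
  have hview : strJointView S E k (x b) T I (unary κ) c = jointViewOf E (x false) T I
      ((S.keyGen (unary κ) (ρ .key).str).1) ((S.keyGen (unary κ) (ρ .key).str).2.1)
      (strKreCt S k (x b) (unary κ) (Tapes.str ρ))
      (fun i => if i ∈ I then (S.keyGen (unary κ) (ρ .key).str).2.2 i else [])
      (fun i => if i ∈ I then S.partDec
          (if i ∈ I then (S.keyGen (unary κ) (ρ .key).str).2.2 i else [])
          (strKreCt S k (x b) (unary κ) (Tapes.str ρ)) (Tapes.str σ (.inl (.dec i)))
        else if i ∈ I then [] else S.partDec ((S.keyGen (unary κ) (ρ .key).str).2.2 i)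
          (strKreCt S k (x b) (unary κ) (Tapes.str ρ)) (ρ (.dec i)).str)
      (fun l => (E.keyGen (unary κ) (Tapes.str σ (.inl (.ownKey l)))).1)
      (withEnc (fun z => if wireEquiv n μ z ∈ R then
        (ρ (.enc ((wireEquiv n μ).symm (wireEquiv n μ z)))).str else [])
        fun a => Tapes.str σ (.inl a)) := by
    unfold strJointView
    rw [hkct]
    have hpk : strPk S (unary κ) c = (S.keyGen (unary κ) (ρ .key).str).1 := by
      simp [strPk, c, clientGameTapes, Tapes.str]
    have hek : strEk S (unary κ) c = (S.keyGen (unary κ) (ρ .key).str).2.1 := by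
      simp [strEk, c, clientGameTapes, Tapes.str]
    have hsh : strShare S (unary κ) c = (S.keyGen (unary κ) (ρ .key).str).2.2 := by
      funext i
      simp [strShare, c, clientGameTapes, Tapes.str]
    have henc : ∀ z, clientWire I z → (if wireEquiv n μ z ∈ R then
        (ρ (.enc ((wireEquiv n μ).symm (wireEquiv n μ z)))).str else []) =
        Tapes.str ρ (.enc z) := by
      intro z hz
      have hz' : wireEquiv n μ z ∈ R := by
        rw [Finset.mem_filter, Equiv.symm_apply_apply]
        exact ⟨Finset.mem_univ _, hz⟩
      rw [if_pos hz']
      change Tapes.str ρ (.enc ((wireEquiv n μ).symm (wireEquiv n μ z))) = _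
      rw [Equiv.symm_apply_apply]
    rw [hpk, hek]
    apply jointViewOf_congr
    · intro i hi
      cases b
      · rfl
      · exact (hxI i hi).symm
    · intro i hi
      rw [if_pos hi, hsh]
    · intro i
      unfold strPartialDec
      rw [hkct, hsh]
      by_cases hi : i ∈ I
      · simp [hi, c, clientGameTapes]
      · simp [hi, c, clientGameTapes, Tapes.str]
    · intro i
      simp [strOwnPk, c, clientGameTapes]
    · intro i
      simp [c, clientGameTapes, withEnc]
    · intro i hi j
      exact (if_pos trivial).trans (henc (Wire.xBit i j) hi).symm
    · intro i hi
      exact (if_pos trivial).trans (henc (Wire.xPacked i) hi).symm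
    · intro i hi
      simp [c, clientGameTapes, withEnc, hi]
    · intro i l
      simp [c, clientGameTapes, withEnc]
  have hg : clientGuess S E T (x false) I D d (S.gameEnv (kreCircuit n μ) I R m b
      (CoinIdx.gamePart μ S E ρ).1 (CoinIdx.gamePart μ S E ρ).2.1 (CoinIdx.gamePart μ S E ρ).2.2.1
      (CoinIdx.gamePart μ S E ρ).2.2.2) (Tapes.str σ) =
      D.distinguish d (unary κ) (strJointView S E k (x b) T I (unary κ) c)
        fun i => Tapes.str σ (.inr i) := by
    rw [hview]
    unfold clientGuess
    simp only [ThresholdSHE.gameEnv, if_pos (hsame κ), hgr]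
    rfl
  rw [hg, ← hc]
  rfl

/-- The part of the input of the simulator that tells the set `y.1`, its inputs and the result. -/
def simCode (k : ℕ) (y : Finset (Fin n) × Inputs n μ) (b : Fin (n + 1)) : Str :=
  ((List.ofFn fun i => optStr (if i ∈ y.1 then some (bitRep μ (y.2 i)) else none)) ++
    [bitRep μ (kre k y.2)]).getD b []

/-- Distinct inputs of all clients that agree with what the simulator is given. -/
def pickInputs (k : ℕ) (u : Fin (n + 1) → Str) : Finset (Fin n) × Inputs n μ :=
  if h : ∃ y : Finset (Fin n) × Inputs n μ, Function.Injective y.2 ∧ simCode k y = u then h.choose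
  else (∅, fun _ => 0)

/-- The true inputs show that a choice exists. The code determines `I`, the inputs on `I` and the
result, because `μ` bits determine a number below `2 ^ μ`. -/
theorem pickInputs_spec (hk : 1 ≤ k) (hkn : k ≤ n) (I : Finset (Fin n)) (x : Inputs n μ)
    (hx : Function.Injective x) : ∃ x' : Inputs n μ,
      pickInputs k (simCode k (I, x)) = (I, x') ∧ Function.Injective x' ∧
      (∀ i ∈ I, x' i = x i) ∧ kre k x' = kre k x := by
  have h : ∃ y : Finset (Fin n) × Inputs n μ, Function.Injective y.2 ∧
      simCode k y = simCode k (I, x) := ⟨(I, x), hx, rfl⟩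
  obtain ⟨hinj, hcode⟩ := h.choose_spec
  have hpick : pickInputs k (simCode k (I, x)) = h.choose := by
    rw [pickInputs, dif_pos h]
  rw [hpick]
  generalize h.choose = y at hinj hcode
  obtain ⟨I', x'⟩ := y
  have hi : ∀ i : Fin n, optStr (if i ∈ I' then some (bitRep μ (x' i)) else none) =
      optStr (if i ∈ I then some (bitRep μ (x i)) else none) := by
    intro i
    have := congrFun hcode i.castSucc
    simp only [simCode] at this
    rw [List.getD_append _ _ _ _ (by simp), List.getD_append _ _ _ _ (by simp),
      List.getD_eq_getElem _ _ (by simp), List.getD_eq_getElem _ _ (by simp)] at this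
    simpa using this
  have hlast : bitRep μ (kre k x') = bitRep μ (kre k x) := by
    have := congrFun hcode (Fin.last n)
    simp only [simCode] at this
    rw [List.getD_append_right _ _ _ _ (by simp), List.getD_append_right _ _ _ _ (by simp)] at this
    simpa using this
  have hI : ∀ i, i ∈ I' ↔ i ∈ I := by
    intro i
    have := hi i
    -- The leading bit of `optStr` distinguishes a member from a non-member even if `μ = 0`.
    by_cases h₁ : i ∈ I' <;> by_cases h₂ : i ∈ I <;> simp [h₁, h₂, optStr] at this ⊢
  obtain rfl : I' = I := Finset.ext hI
  refine ⟨x', rfl, hinj, fun i hiI => ?_, ?_⟩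
  · have := hi i
    simp only [if_pos hiI, optStr, List.cons.injEq, true_and] at this
    exact Fin.ext (bitRep_injective (x' i).2 (x i).2 this)
  · exact bitRep_injective (kre_lt x' hinj hk hkn) (kre_lt x hx hk hkn) hlast

variable (S k) in
/-- The simulator for clients executes the protocol with inputs that it picks itself. -/
def clientSimRun (T : {T : Finset (Fin n) // T.card = t}) (u : Fin (n + 1 + 6) → Str)
    (r : CoinIdx n μ → Str) : List Str :=
  strJointView S E k (pickInputs k fun b => u (b.castAdd 6)).2 T
    -- Entry 4 of the leakage is `1^κ`.
    (pickInputs (μ := μ) k fun b => u (b.castAdd 6)).1 (u (Fin.natAdd (n + 1) 4)) r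

/-- With `n` and `μ` fixed only finitely many codes occur, so `pickInputs` is a finite table
although it is defined by choice. -/
theorem polyOp_clientSimRun (hperm : S.Permitted (kreCircuit n μ))
    (T : {T : Finset (Fin n) // T.card = t}) :
    PolyOp (jointViewLen n t μ) (clientSimRun S E k (μ := μ) T) := by
  intro A _ g h hg hh
  refine PolyList.lookup (c := fun v => pickInputs (μ := μ) k fun b => g (b.castAdd 6) v) ?_
    (g := fun y v => strJointView S E k y.2 T y.1 (g (Fin.natAdd (n + 1) 4) v) fun a => h a v)
    fun y => polyList_strJointView S E k y.2 T hperm y.1 (hg _) hh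
  refine PolyPred.table (fun b => hg _) (pickInputs k) (Finset.univ.image (simCode (μ := μ) k))
    (∅, fun _ => 0) ?_
  intro u hu
  rw [pickInputs, dif_neg]
  rintro ⟨y, -, hy⟩
  exact hu (Finset.mem_image.2 ⟨y, Finset.mem_univ _, hy⟩)

theorem nonempty_decryptors (htn : t ≤ n) : Nonempty {T : Finset (Fin n) // T.card = t} := by
  obtain ⟨T, -, hT⟩ := Finset.exists_subset_card_eq (s := (Finset.univ : Finset (Fin n)))
    (n := t) (by simpa using htn)
  exact ⟨T, hT⟩

/-- For a fixed set of decryptors, simulated and real view are the same function of the tapes at the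
inputs `x'` and `x`, which `close_jointView` compares. -/
theorem privateAgainstClients {τ : ℕ} (htn : t ≤ n) (hτ : τ < t) (hk : 1 ≤ k) (hkn : k ≤ n)
    (hslots : ∀ κ, μ ≤ S.slots κ) (hperm : S.Permitted (kreCircuit n μ)) (hS : S.IndCPA) :
    PrivateAgainstClients S E k μ τ := by
  have := nonempty_decryptors htn
  let Z := {T : Finset (Fin n) // T.card = t}
  refine ⟨PPT.ofPolyOp Z (CoinIdx.len μ S E) (clientSimRun S E k) (polyOp_clientSimRun E hperm),
    fun I hI x hx => ?_⟩
  obtain ⟨x', hpick, hx', hxI, hkre⟩ := pickInputs_spec hk hkn I x hx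
  have hexec : ∀ κ T (ρ : Tapes (CoinIdx.len μ S E) κ),
      (PPT.ofPolyOp Z (CoinIdx.len μ S E) (clientSimRun S E k)
      (polyOp_clientSimRun E hperm)).exec (simInput S k x I κ)
        ((PPT.randEquiv Z (CoinIdx.len μ S E) κ).symm (T, ρ)) =
      strJointView S E k x' T I (unary κ) (Tapes.str ρ) := by
    intro κ T ρ
    have hlen : (simInput S k x I κ).length = n + 1 + 6 := by simp [simInput, leakage]
    rw [PPT.ofPolyOp_exec_symm Z _ _ _ _ hlen]
    have hcode : (fun b : Fin (n + 1) => (simInput S k x I κ).getD (b.castAdd 6) []) =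
        simCode k (I, x) := by
      funext b
      unfold simInput
      rw [List.getD_append _ _ _ _ (by simp; omega)]
      rfl
    have hκ : (simInput S k x I κ).getD (Fin.natAdd (n + 1) (4 : Fin 6)) [] = unary κ := by
      unfold simInput
      rw [List.getD_append_right _ _ _ _ (by simp)]
      simp [leakage]
    unfold clientSimRun
    rw [hcode, hpick]
    exact congrArg (fun w => strJointView S E k x' T I w (Tapes.str ρ)) hκ
  refine compIndist_of_close (CoinIdx.len μ S E)
    (fun κ => (PPT.randEquiv Z (CoinIdx.len μ S E) κ).symm) (fun κ => Equiv.unif _)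
    (CoinIdx.coins μ S E) (CoinIdx.unif_coins μ S E) fun D d T => ?_
  have h := close_jointView E T hk hkn hslots hperm hS (hI.trans_lt hτ)
    (fun b => if b then x else x') (by rintro (_ | _); exacts [hx', hx]) hxI hkre D d
  exact Close.of_eq h
    (fun κ => congrArg prob (funext fun ρ => congrArg
      (fun l => D.distinguish d (unary κ) l (fun i => (ρ (.inr i)).str) = [[true]])
      (hexec κ T fun j => ρ (.inl j))))
    fun κ => congrArg prob (funext fun ρ => congrArg
      (fun l => D.distinguish d (unary κ) l (fun i => (ρ (.inr i)).str) = [[true]])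
      (jointView_coins S E k x T I fun j => ρ (.inl j)))

end Clients

end Protocol

/-! ## Privacy against the server -/

namespace Protocol

section ServerViews

variable {n t μ : ℕ} (S : ThresholdSHE n t) (E : PKE) (k : ℕ) (x : Inputs n μ)
  (T : {T : Finset (Fin n) // T.card = t})

/-- The view of the server with given keys and ciphertexts. -/
def serverViewOf (pk ek : Str) (ownPk : Fin n → Str) (wct : Wire n μ → Str)
    (re : Fin t → Fin n → Str) (c : CoinIdx n μ → Str) : List Str :=
  ((List.ofFn fun j => c (.enc (Wire.kBit j))) ++ [c (.enc Wire.one), c .eval] ++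
    subsetStrs T.1) ++
  ([pk, ek] ++ List.ofFn fun l => ownPk l) ++
  (List.ofFn fun i => (List.ofFn fun j => wct (Wire.xBit i j)) ++ [wct (Wire.xPacked i)]).flatten ++
  (List.ofFn fun j => List.ofFn fun l => re j l).flatten

/-- A message of the length of a partial decryption, made with fresh keys. -/
def dummyMsg (i₀ : Fin n) (w : Str) (c : CoinIdx n μ → Str) : Str :=
  S.partDec ((S.keyGen w (c .dummyKey)).2.2 i₀)
    (S.enc (S.keyGen w (c .dummyKey)).1 (bitMsg true) (c .dummyEnc)) (c .dummyDec)

/-- The view of the server, where the partial decryptions at the places in `A` are replaced by a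
dummy message. -/
def hybridView (i₀ : Fin n) (A : Finset (Fin t × Fin n)) (w : Str) (c : CoinIdx n μ → Str) :
    List Str :=
  serverViewOf T (strPk S w c) (strEk S w c) (strOwnPk E w c) (strWireCt S k x w c)
    (fun j l => E.enc (strOwnPk E w c l) (if (j, l) ∈ A then dummyMsg S i₀ w c
      else strPartialDec S k x w c (T.1.orderEmbOfFin T.2 j))
      (c (.reEnc (T.1.orderEmbOfFin T.2 j) l))) c

theorem serverView_coins {κ : ℕ} (i₀ : Fin n) (ρ : Tapes (CoinIdx.len μ S E) κ) :
    serverView k x (CoinIdx.coins μ S E κ (T, ρ)) =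
      hybridView S E k x T i₀ ∅ (unary κ) (Tapes.str ρ) := rfl

theorem serverViewOf_congr {pk ek : Str} {ownPk ownPk' : Fin n → Str} {wct wct' : Wire n μ → Str}
    {re re' : Fin t → Fin n → Str} {c c' : CoinIdx n μ → Str} (hown : ∀ l, ownPk l = ownPk' l)
    (hwct : ∀ z, wct z = wct' z) (hre : ∀ j l, re j l = re' j l)
    (hk : ∀ j, c (.enc (Wire.kBit j)) = c' (.enc (Wire.kBit j)))
    (hone : c (.enc Wire.one) = c' (.enc Wire.one)) (hev : c .eval = c' .eval) :
    serverViewOf T pk ek ownPk wct re c = serverViewOf T pk ek ownPk' wct' re' c' := by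
  simp only [serverViewOf, hown, hwct, hre, hk, hone, hev]

/-- The public-key game demands two messages of the exact length. Running the threshold scheme under
fresh keys produces one in polynomial time, without a program for `pdLen` and independently of the
inputs. -/
theorem dummyMsg_length {κ : ℕ} (i₀ : Fin n) (ρ : Tapes (CoinIdx.len μ S E) κ) :
    (dummyMsg S i₀ (unary κ) (Tapes.str ρ)).length = S.pdLen κ :=
  S.partDec_length κ (ρ .dummyKey) i₀ _ (ρ .dummyDec)
    (S.enc_length κ (ρ .dummyKey) (ρ .dummyEnc) _ (Or.inl ⟨true, rfl⟩))

/-- `T` only completes the tapes to the coins of an execution. -/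
theorem strPartialDec_length (T : {T : Finset (Fin n) // T.card = t}) {κ : ℕ}
    (hslots : ∀ κ, μ ≤ S.slots κ)
    (hperm : S.Permitted (kreCircuit n μ)) (ρ : Tapes (CoinIdx.len μ S E) κ) (i : Fin n) :
    (strPartialDec S k x (unary κ) (Tapes.str ρ) i).length = S.pdLen κ :=
  partialDec_length hslots hperm (CoinIdx.coins μ S E κ (T, ρ)) i

section Poly

variable {A : Type} [Fintype A] {w : (A → Str) → Str} {c : CoinIdx n μ → (A → Str) → Str}

theorem polyList_serverViewOf {pk ek : (A → Str) → Str} {ownPk : Fin n → (A → Str) → Str}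
    {wct : Wire n μ → (A → Str) → Str} {re : Fin t → Fin n → (A → Str) → Str}
    (hpk : PolyFun pk) (hek : PolyFun ek) (hown : ∀ l, PolyFun (ownPk l))
    (hwct : ∀ z, PolyFun (wct z)) (hre : ∀ j l, PolyFun (re j l)) (hc : ∀ a, PolyFun (c a)) :
    PolyList (serverViewLen n t μ) fun v => serverViewOf T (pk v) (ek v) (fun l => ownPk l v)
      (fun z => wct z v) (fun j l => re j l v) fun a => c a v := by
  unfold serverViewOf
  refine PolyList.cast (PolyList.append (PolyList.append (PolyList.append
    (PolyList.append (PolyList.append (PolyList.ofFn fun j => hc _)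
      (PolyList.cons (hc _) (hc _).polyList)) (PolyList.ofFn fun i => PolyFun.const _))
    (PolyList.append (PolyList.cons hpk hek.polyList) (PolyList.ofFn hown)))
    (PolyList.flatten_ofFn fun i => PolyList.append (PolyList.ofFn fun j => hwct _)
      (hwct _).polyList))
    (PolyList.flatten_ofFn fun j => PolyList.ofFn fun l => hre j l)) ?_
  simp only [serverViewLen]

theorem polyFun_dummyMsg (i₀ : Fin n) (hw : PolyFun w) (hc : ∀ a, PolyFun (c a)) :
    PolyFun fun v => dummyMsg S i₀ (w v) fun a => c a v :=
  polyFun_shePartDec S (polyFun_sheShare S hw (hc _) _)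
    (polyFun_sheEnc S (polyFun_shePk S hw (hc _)) (PolyFun.const _) (hc _)) (hc _)

theorem polyList_hybridView (hperm : S.Permitted (kreCircuit n μ)) (i₀ : Fin n)
    (B : Finset (Fin t × Fin n)) (hw : PolyFun w) (hc : ∀ a, PolyFun (c a)) :
    PolyList (serverViewLen n t μ) fun v => hybridView S E k x T i₀ B (w v) fun a => c a v := by
  refine polyList_serverViewOf T (polyFun_strPk S hw hc) (polyFun_strEk S hw hc)
    (polyFun_strOwnPk E hw hc) (polyFun_strWireCt S k x hw hc) (fun j l => ?_) hc
  refine polyFun_pkeEnc E (polyFun_strOwnPk E hw hc _) ?_ (hc _)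
  by_cases h : (j, l) ∈ B
  · simp only [if_pos h]
    exact polyFun_dummyMsg S i₀ hw hc
  · simp only [if_neg h]
    exact polyFun_strPartialDec S k x hperm hw hc _

end Poly

end ServerViews

/-! ### The hybrid argument for the server. -/

section Server

variable {n t μ : ℕ} (S : ThresholdSHE n t) (E : PKE) (k : ℕ) (x : Inputs n μ)
  (T : {T : Finset (Fin n) // T.card = t}) (i₀ : Fin n)

/-- The acceptance probability of a distinguisher on a hybrid view. -/
def hybridProb (D : PPT (serverViewLen n t μ + 1) 1) (d : Fin (D.rand.die + 1))
    (A : Finset (Fin t × Fin n)) (κ : ℕ) : ℝ :=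
  prob fun ρ : Tapes (Sum.elim (CoinIdx.len μ S E) D.rand.tape) κ =>
    D.distinguish d (unary κ) (hybridView S E k x T i₀ A (unary κ) fun a => (ρ (.inl a)).str)
      (fun i => (ρ (.inr i)).str) = [[true]]

/-- The tapes that the adversary for the change of the inputs leaves to the game. -/
def serverGameTapes : CoinIdx n μ → Prop
  | .key => True
  | .enc _ => True
  | _ => False

/-- The wires that belong to the server. -/
def serverWire : Wire n μ → Prop
  | .inr (.inr _) => True
  | _ => False

/-- Reconstructs the view of the server with dummy messages from the game, and runs `D`. -/
def serverGuess (D : PPT (serverViewLen n t μ + 1) 1) (d : Fin (D.rand.die + 1))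
    (u : GameVar n (wireCount n μ) → Str) (r : CoinIdx n μ ⊕ Fin D.rand.num → Str) : List Str :=
  D.distinguish d (u .security)
    (serverViewOf T (u .pk) (u .ek) (fun l => (E.keyGen (u .security) (r (.inl (.ownKey l)))).1)
      (fun z => u (.ct (wireEquiv n μ z)))
      (fun j l => E.enc (E.keyGen (u .security) (r (.inl (.ownKey l)))).1
        (dummyMsg S i₀ (u .security) fun a => r (.inl a))
        (r (.inl (.reEnc (T.1.orderEmbOfFin T.2 j) l))))
      (withEnc (fun z => u (.tape (wireEquiv n μ z))) fun a => r (.inl a)))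
    fun i => r (.inr i)

theorem polyOp_serverGuess (D : PPT (serverViewLen n t μ + 1) 1) (d : Fin (D.rand.die + 1)) :
    PolyOp 1 (serverGuess S E T i₀ D d) := by
  intro A _ g h hg hh
  have hown : ∀ l : Fin n, PolyFun fun v =>
      (E.keyGen (g .security v) (h (.inl (.ownKey l)) v)).1 := fun l =>
    polyFun_pkePk E (hg _) (hh _)
  exact polyList_distinguish D d (hg _) (polyList_serverViewOf T (hg _) (hg _) hown
    (fun _ => hg _)
    (fun j l => polyFun_pkeEnc E (hown l) (polyFun_dummyMsg S i₀ (hg _) fun a => hh (.inl a)) (hh _))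
    (polyFun_withEnc (fun _ => hg _) fun a => hh _)) fun i => hh _

variable {S} {k}

/-- With dummy messages only, the view of the server does not depend on the inputs, up to
indistinguishability. -/
theorem close_hybridProb_inputs (ht : 0 < t) (hslots : ∀ κ, μ ≤ S.slots κ)
    (hperm : S.Permitted (kreCircuit n μ)) (hS : S.IndCPA) (x : Bool → Inputs n μ)
    (D : PPT (serverViewLen n t μ + 1) 1) (d : Fin (D.rand.die + 1)) :
    Close (hybridProb S E k (x false) T i₀ D d Finset.univ)
      (hybridProb S E k (x true) T i₀ D d Finset.univ) := by
  let m : Bool → Fin (wireCount n μ) → Str := fun b v => wireMsg k (x b) ((wireEquiv n μ).symm v)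
  -- The server sees its own encryption tapes; its plaintexts, the bits of `k` and the constant 1,
  -- do not depend on the inputs.
  let R : Finset (Fin (wireCount n μ)) :=
    Finset.univ.filter fun v => serverWire ((wireEquiv n μ).symm v)
  have hm : ∀ b κ j, IsPlaintext (S.slots κ) (m b j) := fun b κ j =>
    isPlaintext_wireMsg k (x b) (hslots κ) _
  have hR : ∀ j ∈ R, m false j = m true j := by
    intro j hj
    have hj' : serverWire ((wireEquiv n μ).symm j) := (Finset.mem_filter.1 hj).2
    simp only [m]
    generalize (wireEquiv n μ).symm j = w at hj' ⊢
    rcases w with ⟨i, l⟩ | i | l | l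
    · exact hj'.elim
    · exact hj'.elim
    · rfl
    · rfl
  -- The values of the circuit may differ here. This is harmless: with dummies everywhere,
  -- `serverGuess` consults neither the evaluated ciphertext nor a partial decryption.
  refine close_of_game D.rand.tape hS hperm (C := ∅) (by simpa using ht) hm hR
    (polyOp_serverGuess S E T i₀ D d) serverGameTapes
    (fun b κ (ρ : Tapes (Sum.elim (CoinIdx.len μ S E) D.rand.tape) κ) =>
      D.distinguish d (unary κ)
        (hybridView S E k (x b) T i₀ Finset.univ (unary κ) fun a => (ρ (.inl a)).str)
        (fun i => (ρ (.inr i)).str) = [[true]]) fun b κ ρ σ => ?_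
  let c : CoinIdx n μ → Str := fun a => if serverGameTapes a then Tapes.str ρ a
    else Tapes.str σ (.inl a)
  have hc : (fun a => Tapes.str (Tapes.mix serverGameTapes ρ σ) (.inl a)) = c :=
    funext (Tapes.str_mix _ ρ σ)
  have hg : serverGuess S E T i₀ D d (S.gameEnv (kreCircuit n μ) ∅ R m b
      (CoinIdx.gamePart μ S E ρ).1 (CoinIdx.gamePart μ S E ρ).2.1 (CoinIdx.gamePart μ S E ρ).2.2.1
      (CoinIdx.gamePart μ S E ρ).2.2.2) (Tapes.str σ) =
      D.distinguish d (unary κ) (hybridView S E k (x b) T i₀ Finset.univ (unary κ) c)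
        fun i => Tapes.str σ (.inr i) := by
    refine congrArg (fun l => D.distinguish d (unary κ) l fun i => Tapes.str σ (.inr i)) ?_
    have hkey : c .key = Tapes.str ρ .key := if_pos trivial
    have hcenc : ∀ z, c (.enc z) = Tapes.str ρ (.enc z) := fun z => if_pos trivial
    have hdum : dummyMsg S i₀ (unary κ) c = dummyMsg S i₀ (unary κ) fun a => Tapes.str σ (.inl a) := by
      simp [dummyMsg, c, serverGameTapes]
    have hwct : ∀ z, S.gameCt m b (CoinIdx.gamePart μ S E ρ).1 (CoinIdx.gamePart μ S E ρ).2.1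
        (wireEquiv n μ z) = strWireCt S k (x b) (unary κ) c z := by
      intro z
      unfold strWireCt strPk
      rw [hkey, hcenc]
      change S.enc _ (wireMsg k (x b) ((wireEquiv n μ).symm (wireEquiv n μ z)))
        (Tapes.str ρ (.enc ((wireEquiv n μ).symm (wireEquiv n μ z)))) = _
      rw [Equiv.symm_apply_apply]
      rfl
    have henc : ∀ z, serverWire z → (if wireEquiv n μ z ∈ R then
        (ρ (.enc ((wireEquiv n μ).symm (wireEquiv n μ z)))).str else []) = c (.enc z) := by
      intro z hz
      have hz' : wireEquiv n μ z ∈ R := by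
        rw [Finset.mem_filter, Equiv.symm_apply_apply]
        exact ⟨Finset.mem_univ _, hz⟩
      rw [if_pos hz', hcenc]
      change Tapes.str ρ (.enc ((wireEquiv n μ).symm (wireEquiv n μ z))) = _
      rw [Equiv.symm_apply_apply]
    unfold hybridView
    rw [show strPk S (unary κ) c = (S.keyGen (unary κ) (ρ .key).str).1 by
        unfold strPk; rw [hkey]; rfl,
      show strEk S (unary κ) c = (S.keyGen (unary κ) (ρ .key).str).2.1 by
        unfold strEk; rw [hkey]; rfl]
    refine serverViewOf_congr T (fun l => ?_) hwct (fun j l => ?_) (fun j => henc _ trivial)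
      (henc _ trivial) ?_
    · simp [strOwnPk, c, serverGameTapes, ThresholdSHE.gameEnv]
    · rw [if_pos (Finset.mem_univ _), hdum]
      simp [strOwnPk, c, serverGameTapes, ThresholdSHE.gameEnv]
    · simp [withEnc, c, serverGameTapes]
  rw [hg, ← hc]
  rfl

variable (S k) in
/-- The message at the place `(j₀, l₀)` before and after its replacement by the dummy. -/
def placeMsg {K : Type} (j₀ : Fin t) (b : Bool) (u : Fin 2 → Str) (r : CoinIdx n μ ⊕ K → Str) :
    Str :=
  if b then dummyMsg S i₀ (u 0) fun a => r (.inl a)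
  else strPartialDec S k x (u 0) (fun a => r (.inl a)) (T.1.orderEmbOfFin T.2 j₀)

theorem polyOp_placeMsg {K : Type} (hperm : S.Permitted (kreCircuit n μ)) (j₀ : Fin t) (b : Bool) :
    PolyOp 1 fun u r => [placeMsg S k x T i₀ (K := K) j₀ b u r] := by
  intro A _ g h hg hh
  refine PolyFun.polyList ?_
  cases b
  · exact polyFun_strPartialDec S k x hperm (hg 0) (fun a => hh (.inl a)) _
  · exact polyFun_dummyMsg S i₀ (hg 0) fun a => hh (.inl a)

variable (S k) in
/-- Reconstructs a hybrid view from a public key for client `l₀` and a ciphertext for the place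
`(j₀, l₀)`, and runs `D`. -/
def placeGuess (D : PPT (serverViewLen n t μ + 1) 1) (d : Fin (D.rand.die + 1))
    (A : Finset (Fin t × Fin n)) (j₀ : Fin t) (l₀ : Fin n)
    (u : Fin 3 → Str) (r : CoinIdx n μ ⊕ Fin D.rand.num → Str) : List Str :=
  let c : CoinIdx n μ → Str := fun a => r (.inl a)
  let own : Fin n → Str := fun l => if l = l₀ then u 1 else strOwnPk E (u 0) c l
  D.distinguish d (u 0)
    (serverViewOf T (strPk S (u 0) c) (strEk S (u 0) c) own (strWireCt S k x (u 0) c)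
      (fun j l => if j = j₀ ∧ l = l₀ then u 2 else
        E.enc (own l) (if (j, l) ∈ A then dummyMsg S i₀ (u 0) c
          else strPartialDec S k x (u 0) c (T.1.orderEmbOfFin T.2 j))
          (c (.reEnc (T.1.orderEmbOfFin T.2 j) l))) c)
    fun i => r (.inr i)

theorem polyOp_placeGuess (hperm : S.Permitted (kreCircuit n μ))
    (D : PPT (serverViewLen n t μ + 1) 1) (d : Fin (D.rand.die + 1))
    (A : Finset (Fin t × Fin n)) (j₀ : Fin t) (l₀ : Fin n) :
    PolyOp 1 (placeGuess S E k x T i₀ D d A j₀ l₀) := by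
  intro A' _ g h hg hh
  have hc : ∀ a : CoinIdx n μ, PolyFun (h (.inl a)) := fun a => hh _
  have hown : ∀ l, PolyFun fun v => if l = l₀ then g 1 v
      else strOwnPk E (g 0 v) (fun a => h (.inl a) v) l := by
    intro l
    by_cases hl : l = l₀
    · simp only [if_pos hl]
      exact hg 1
    · simp only [if_neg hl]
      exact polyFun_strOwnPk E (hg 0) hc l
  refine polyList_distinguish D d (hg 0) (polyList_serverViewOf T (polyFun_strPk S (hg 0) hc)
    (polyFun_strEk S (hg 0) hc) hown (polyFun_strWireCt S k x (hg 0) hc)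
    (re := fun j l v => if j = j₀ ∧ l = l₀ then g 2 v else
        E.enc (if l = l₀ then g 1 v else strOwnPk E (g 0 v) (fun a => h (.inl a) v) l)
          (if (j, l) ∈ A then dummyMsg S i₀ (g 0 v) (fun a => h (.inl a) v)
          else strPartialDec S k x (g 0 v) (fun a => h (.inl a) v) (T.1.orderEmbOfFin T.2 j))
          (h (.inl (.reEnc (T.1.orderEmbOfFin T.2 j) l)) v)) (fun j l => ?_) hc) fun i => hh _
  by_cases hjl : j = j₀ ∧ l = l₀
  · simp only [if_pos hjl]
    exact hg 2
  · simp only [if_neg hjl]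
    refine polyFun_pkeEnc E (hown l) ?_ (hc _)
    by_cases hA : (j, l) ∈ A
    · simp only [if_pos hA]
      exact polyFun_dummyMsg S i₀ (hg 0) hc
    · simp only [if_neg hA]
      exact polyFun_strPartialDec S k x hperm (hg 0) hc _

theorem str_update {J : Type} [DecidableEq J] {len : J → Polynomial ℕ} {κ : ℕ} (ρ : Tapes len κ)
    (j : J) (a : Bits ((len j).eval κ)) :
    Tapes.str (len := len) (Function.update ρ j a) = Function.update (Tapes.str ρ) j a.str := by
  funext i
  by_cases h : i = j
  · subst h
    simp [Tapes.str]
  · simp [Tapes.str, h]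

/-- The challenge takes over the key tape of client `l₀` and one encryption tape. The server's view
uses these only through the public key and the challenge ciphertext, and other ciphertexts for `l₀`
can be made from the public key. By `hA` the place still holds a true partial decryption when `b` is
`false`. -/
theorem placeGuess_eq (D : PPT (serverViewLen n t μ + 1) 1) (d : Fin (D.rand.die + 1))
    (A : Finset (Fin t × Fin n)) (j₀ : Fin t) (l₀ : Fin n) (hA : (j₀, l₀) ∉ A) (b : Bool)
    (w a e : Str) (r : CoinIdx n μ ⊕ Fin D.rand.num → Str) :
    placeGuess S E k x T i₀ D d A j₀ l₀
      ![w, (E.keyGen w a).1, E.enc (E.keyGen w a).1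
        (placeMsg S k x T i₀ j₀ b ![w, (E.keyGen w a).1] r) e] r =
    D.distinguish d w (hybridView S E k x T i₀ (if b then insert (j₀, l₀) A else A) w
      (Function.update (Function.update (fun a => r (.inl a)) (.ownKey l₀) a)
        (.reEnc (T.1.orderEmbOfFin T.2 j₀) l₀) e)) fun i => r (.inr i) := by
  set c : CoinIdx n μ → Str := fun a => r (.inl a) with hc
  set c' := Function.update (Function.update c (.ownKey l₀) a)
    (.reEnc (T.1.orderEmbOfFin T.2 j₀) l₀) e with hc'
  have hkey : c' .key = c .key := by simp [hc']
  have henc : ∀ z, c' (.enc z) = c (.enc z) := fun z => by simp [hc']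
  have heval : c' .eval = c .eval := by simp [hc']
  have hdec : ∀ i, c' (.dec i) = c (.dec i) := fun i => by simp [hc']
  have hpk : strPk S w c' = strPk S w c := by rw [strPk, hkey, strPk]
  have hek : strEk S w c' = strEk S w c := by rw [strEk, hkey, strEk]
  have hwct : ∀ z, strWireCt S k x w c' z = strWireCt S k x w c z := fun z => by
    rw [strWireCt, hpk, henc, strWireCt]
  have hpd : ∀ i, strPartialDec S k x w c' i = strPartialDec S k x w c i := fun i => by
    simp only [strPartialDec, strKreCt, strShare, hkey, hek, hwct, heval, hdec]
  have hdum : dummyMsg S i₀ w c' = dummyMsg S i₀ w c := by simp [dummyMsg, hc']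
  have hown : ∀ l, strOwnPk E w c' l = if l = l₀ then (E.keyGen w a).1 else strOwnPk E w c l := by
    intro l
    by_cases hl : l = l₀
    · subst hl
      simp [strOwnPk, hc']
    · simp [strOwnPk, hc', hl]
  unfold placeGuess hybridView
  refine congrArg (fun l => D.distinguish d w l fun i => r (.inr i)) ?_
  rw [hpk, hek]
  refine serverViewOf_congr T (fun l => (hown l).symm) (fun z => (hwct z).symm) (fun j l => ?_)
    (fun j => (henc _).symm) (henc _).symm heval.symm
  rw [hown, hdum, hpd]
  by_cases hjl : j = j₀ ∧ l = l₀
  · obtain ⟨rfl, rfl⟩ := hjl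
    cases b <;> simp [hA, hc', placeMsg, hc]
  -- Distinct positions `j` belong to distinct decryptors, so no other place uses the replaced tape.
  · have hne : c' (.reEnc (T.1.orderEmbOfFin T.2 j) l) =
        c (.reEnc (T.1.orderEmbOfFin T.2 j) l) := by
      simp [hc', hjl]
    rw [if_neg hjl, hne]
    cases b <;> simp [hjl, hc]

/-- Replacing one more message by the dummy. -/
theorem close_hybridProb_insert (hslots : ∀ κ, μ ≤ S.slots κ)
    (hperm : S.Permitted (kreCircuit n μ)) (hlen : ∀ κ, E.msgLen κ = S.pdLen κ) (hE : E.IndCPA)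
    (D : PPT (serverViewLen n t μ + 1) 1) (d : Fin (D.rand.die + 1))
    (A : Finset (Fin t × Fin n)) (j₀ : Fin t) (l₀ : Fin n) (hA : (j₀, l₀) ∉ A) :
    Close (hybridProb S E k x T i₀ D d A)
      (hybridProb S E k x T i₀ D d (insert (j₀, l₀) A)) := by
  have hgame := PKE.IndCPA.close (len := Sum.elim (CoinIdx.len μ S E) D.rand.tape) hE
    (polyOp_placeMsg (k := k) x T i₀ hperm j₀)
    (by
      rintro (_ | _) κ key ρ
      · exact (strPartialDec_length S E k x T hslots hperm (fun a => ρ (.inl a)) _).trans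
          (hlen κ).symm
      · exact (dummyMsg_length S E i₀ (fun a => ρ (.inl a))).trans (hlen κ).symm)
    (polyOp_placeGuess (k := k) E x T i₀ hperm D d A j₀ l₀)
  set i₁ := T.1.orderEmbOfFin T.2 j₀ with hi₁
  let B : Bool → Finset (Fin t × Fin n) := fun b => if b then insert (j₀, l₀) A else A
  have key : ∀ b κ, hybridProb S E k x T i₀ D d (B b) κ = prob
      fun ω : Bits (E.keyRand.eval κ) × Tapes (Sum.elim (CoinIdx.len μ S E) D.rand.tape) κ ×
        Bits (E.encRand.eval κ) =>
        placeGuess S E k x T i₀ D d A j₀ l₀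
          ![unary κ, (E.keyGen (unary κ) ω.1.str).1, E.enc (E.keyGen (unary κ) ω.1.str).1
          (placeMsg S k x T i₀ j₀ b ![unary κ, (E.keyGen (unary κ) ω.1.str).1] (Tapes.str ω.2.1))
          ω.2.2.str] (Tapes.str ω.2.1) = [[true]] := by
    intro b κ
    let L := Sum.elim (CoinIdx.len μ S E) D.rand.tape
    let e : Bits (E.keyRand.eval κ) × Tapes L κ × Bits (E.encRand.eval κ) ≃
        Bits (E.encRand.eval κ) × Bits (E.keyRand.eval κ) × Tapes L κ :=
      { toFun := fun ω => (ω.2.2, ω.1, ω.2.1)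
        invFun := fun y => (y.2.1, y.2.2, y.1)
        left_inv := fun _ => rfl
        right_inv := fun _ => rfl }
    have hu₁ : Unif fun z : Bits (E.keyRand.eval κ) × Tapes L κ =>
        (Function.update z.2 (.inl (.ownKey l₀)) z.1 : Tapes L κ) :=
      unif_update (len := L) (.inl (.ownKey l₀))
    have hu₂ : Unif fun z : Bits (E.encRand.eval κ) × Tapes L κ =>
        (Function.update z.2 (.inl (.reEnc i₁ l₀)) z.1 : Tapes L κ) :=
      unif_update (len := L) (.inl (.reEnc i₁ l₀))
    -- Overwriting the two tapes by independent ones from the game leaves the family uniform.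
    have hu := hu₂.comp ((hu₁.prodMap_left (Z := Bits (E.encRand.eval κ))).comp e.unif _
      fun _ => rfl) _ fun _ => rfl
    unfold hybridProb
    rw [← hu.prob_eq]
    refine congrArg prob (funext fun ω => ?_)
    obtain ⟨ωk, σ, ωe⟩ := ω
    have hstr : Tapes.str (len := L) (Function.update
        (Function.update σ (.inl (.ownKey l₀)) ωk) (.inl (.reEnc i₁ l₀)) ωe) =
        Function.update (Function.update (Tapes.str σ) (.inl (.ownKey l₀)) ωk.str)
          (.inl (.reEnc i₁ l₀)) ωe.str :=
      (str_update (len := L) _ _ _).trans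
        (congrArg (fun g => Function.update g (.inl (.reEnc i₁ l₀)) ωe.str)
          (str_update (len := L) _ _ _))
    have hin : ∀ i : Fin D.rand.num, Tapes.str (len := L) (Function.update
        (Function.update σ (.inl (.ownKey l₀)) ωk) (.inl (.reEnc i₁ l₀)) ωe) (.inr i) =
        Tapes.str σ (.inr i) := fun i => (congrFun hstr _).trans (by simp)
    have hl : (fun a => Tapes.str (len := L) (Function.update
        (Function.update σ (.inl (.ownKey l₀)) ωk) (.inl (.reEnc i₁ l₀)) ωe) (.inl a)) =
        Function.update (Function.update (fun a => Tapes.str σ (.inl a)) (.ownKey l₀) ωk.str)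
          (.reEnc i₁ l₀) ωe.str := by
      funext a
      refine (congrFun hstr _).trans ?_
      simp only [Function.update_apply, Sum.inl.injEq]
    rw [placeGuess_eq E x T i₀ D d A j₀ l₀ hA b, ← hi₁, ← hl, ← funext hin]
    rfl
  exact hgame.of_eq (key false) (key true)

/-- Replacing all messages by the dummy. -/
theorem close_hybridProb_univ (hslots : ∀ κ, μ ≤ S.slots κ)
    (hperm : S.Permitted (kreCircuit n μ)) (hlen : ∀ κ, E.msgLen κ = S.pdLen κ) (hE : E.IndCPA)
    (D : PPT (serverViewLen n t μ + 1) 1) (d : Fin (D.rand.die + 1)) :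
    Close (hybridProb S E k x T i₀ D d ∅) (hybridProb S E k x T i₀ D d Finset.univ) := by
  suffices h : ∀ A, Close (hybridProb S E k x T i₀ D d ∅) (hybridProb S E k x T i₀ D d A) from
    h _
  intro A
  induction A using Finset.induction_on with
  | empty => exact Close.refl _
  | insert p A hp ih =>
    exact ih.trans (close_hybridProb_insert E x T i₀ hslots hperm hlen hE D d A p.1 p.2 hp)

variable (S k) in
/-- The simulator for the server executes the protocol with the inputs `0`. -/
def serverSimRun (T : {T : Finset (Fin n) // T.card = t}) (u : Fin 6 → Str)
    (r : CoinIdx n μ → Str) : List Str :=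
  hybridView S E k (fun _ => 0) T i₀ ∅ (u 4) r

theorem polyOp_serverSimRun (hperm : S.Permitted (kreCircuit n μ))
    (T : {T : Finset (Fin n) // T.card = t}) :
    PolyOp (serverViewLen n t μ) (serverSimRun S E k (μ := μ) i₀ T) := by
  intro A _ g h hg hh
  exact polyList_hybridView S E k _ T hperm i₀ ∅ (hg 4) hh

/-- Four ensembles are linked: zero inputs, zero inputs with dummies, true inputs with dummies, true
inputs. -/
theorem privateAgainstServer (ht : 0 < t) (htn : t ≤ n) (hslots : ∀ κ, μ ≤ S.slots κ)
    (hperm : S.Permitted (kreCircuit n μ)) (hlen : ∀ κ, E.msgLen κ = S.pdLen κ)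
    (hS : S.IndCPA) (hE : E.IndCPA) : PrivateAgainstServer S E k μ := by
  have := nonempty_decryptors htn
  let Z := {T : Finset (Fin n) // T.card = t}
  let i₀ : Fin n := ⟨0, ht.trans_le htn⟩
  -- These inputs need not be distinct: the hybrid steps use lengths and security, never the value
  -- of the circuit.
  let x' : Inputs n μ := fun _ => 0
  refine ⟨PPT.ofPolyOp Z (CoinIdx.len μ S E) (serverSimRun S E k i₀)
    (polyOp_serverSimRun E i₀ hperm), fun x _ => ?_⟩
  have hexec : ∀ κ T (ρ : Tapes (CoinIdx.len μ S E) κ),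
      (PPT.ofPolyOp Z (CoinIdx.len μ S E) (serverSimRun S E k i₀)
      (polyOp_serverSimRun E i₀ hperm)).exec (leakage S k μ κ)
        ((PPT.randEquiv Z (CoinIdx.len μ S E) κ).symm (T, ρ)) =
      hybridView S E k x' T i₀ ∅ (unary κ) (Tapes.str ρ) := fun κ T ρ =>
    PPT.ofPolyOp_exec_symm Z _ _ _ _ rfl _ _
  refine compIndist_of_close (CoinIdx.len μ S E)
    (fun κ => (PPT.randEquiv Z (CoinIdx.len μ S E) κ).symm) (fun κ => Equiv.unif _)
    (CoinIdx.coins μ S E) (CoinIdx.unif_coins μ S E) fun D d T => ?_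
  have h := ((close_hybridProb_univ (k := k) E x' T i₀ hslots hperm hlen hE D d).trans
    (close_hybridProb_inputs E T i₀ ht hslots hperm hS (fun b => if b then x else x') D d)).trans
    (close_hybridProb_univ E x T i₀ hslots hperm hlen hE D d).symm
  exact Close.of_eq h
    (fun κ => congrArg prob (funext fun ρ => congrArg
      (fun l => D.distinguish d (unary κ) l (fun i => (ρ (.inr i)).str) = [[true]])
      (hexec κ T fun j => ρ (.inl j))))
    fun κ => congrArg prob (funext fun ρ => congrArg
      (fun l => D.distinguish d (unary κ) l (fun i => (ρ (.inr i)).str) = [[true]])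
      (serverView_coins S E k x T i₀ fun j => ρ (.inl j)))

end Server

end Protocol

end

theorem mainTheorem3 (n t τ k μ : ℕ) (htn : t ≤ n) (hτ : τ < t) (hk : 1 ≤ k) (hkn : k ≤ n)
    (S : ThresholdSHE n t) (E : PKE)
    (hslots : ∀ κ, μ ≤ S.slots κ) (hperm : S.Permitted (kreCircuit n μ))
    (hlen : ∀ κ, E.msgLen κ = S.pdLen κ)
    (hS : S.IndCPA) (hE : E.IndCPA) :
    Protocol.Correct S E k μ ∧
      Protocol.PrivateAgainstClients S E k μ τ ∧
      Protocol.PrivateAgainstServer S E k μ := by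
  exact ⟨Protocol.correct hk hkn hslots hperm hlen,
    Protocol.privateAgainstClients E htn hτ hk hkn hslots hperm hS,
    Protocol.privateAgainstServer E (Nat.zero_lt_of_lt hτ) htn hslots hperm hlen hS hE⟩
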